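/- A binary linear code of length $N$ is a linear subspace of $\mathbb{F}_2^N$; the weight of a word is its number of non-zero coordinates; and the effective length $n_{\mathrm{eff}}(C)$ of a code $C\subseteq\mathbb{F}_2^N$ is the number of coordinates in which at least one word of $C$ is non-zero (the smallest length attained by deleting zero coordinates). Two codes are isomorphic if, after deleting their zero coordinates, they agree up to a permutation of coordinates. Let $C_{63}$, $C_{64}$, $C_{65}$ be the three $12$-dimensional binary linear codes with weights in $\{0,24,32,40\}$ and effective lengths $63$, $64$, $65$ that are generated by the rows of the following matrices, respectively (each row is written as a string of binary digits): $$\begin{pmatrix} 001100001110000001111101000011111110010010100100001100000000000\\ 101001111111000000110111010000100110100011011000000010000000000\\ 000100111011100011110111001000010000110000110110100001000000000\\ 010001111111110011001100001001100100010001101000001000100000000\\ 110001110000010111001111011000011100100011000010100000010000000\\ 000000011000110111100011010011101110010001011110000000001000000\\ 010011110001111101010000110100100011101110111111111000000100000\\ 001000110111101100001111110000000001100110000111100000000010000\\ 000111110001100011000000001100011111100001100001111000000001000\\ 000000001111100000111111111100000000011111100000011000000000100\\ 000000000000011111111111111100000000000000011111111000000000010\\ 000000000000000000000000000011111111111111111111111000000000001\\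 \end{pmatrix}$$ $$\begin{pmatrix} 0000110001101110000100100100100011011000011011011110100000000000\\ 1011110000100110010000001100010000111101001110111000010000000000\\ 1010110001001010110010000000101111110000001100101011001000000000\\ 1111100000001100000010100100111101000011011011101000000100000000\\ 0111000000001010110110001100011000000110111100110011000010000000\\ 0000000100001001111110011010010101001101010101010101000001000000\\ 0101011111010000010001111001110011000100100000101100000000100000\\ 0011010011001000001111111001111111011111010011011100000000010000\\ 0000101111000110000000000111101111000011001111000011000000001000\\ 0000011111000001111111111111100000111111000000111111000000000100\\ 0000000000111111111111111111100000000000111111111111000000000010\\ 0000000000000000000000000000011111111111111111111111000000000001\\ \end{pmatrix}$$ $$\begin{pmatrix} 10000100000000110110010001110100111101010001011110010100000000000\\ 10100100011000001001000110100110111111001000001100011010000000000\\ 01000010011100011000000100110100110000011111011110001001000000000\\ 11110100001110110100000011010110100001011100000100001000100000000\\ 01101011000001100011010001000011001010001111000010111000010000000\\ 00101001110111101011000001011000000110111001001000100000001000000\\ 00011000111111100000111110001000100010001010101001100000000100000\\ 00000111001011100111110001010100000001111001100000011000000010000\\ 00011111000111100000001111001101111110000111100111111000000001000\\ 00000000111111100000000000111100011110000000011111111000000000100\\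 00000000000000011111111111111100000001111111111111111000000000010\\ 00000000000000000000000000000011111111111111111111111000000000001\\ \end{pmatrix}$$ Let $\mathcal{K}\subseteq\mathbb{F}_2^N$ be a binary linear code isomorphic to one of $C_{63}$, $C_{64}$, $C_{65}$, and let $\mathcal{K}'\subseteq\mathbb{F}_2^N$ be a binary linear code of dimension $\dim(\mathcal{K})+1$ with $\mathcal{K}\subseteq\mathcal{K}'$. Suppose that the weight of every word in $\mathcal{K}'\setminus\mathcal{K}$ is divisible by $4$, is at least $16$, and is equal to neither $20$ nor $24$, and that $n_{\mathrm{eff}}(\mathcal{K})<n_{\mathrm{eff}}(\mathcal{K}')\le 66$. Then $\mathcal{K}$ is isomorphic to $C_{65}$, and the maximum weight of a word in $\mathcal{K}'$ is exactly $44$. -/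

import Mathlib

/-- The binary matrix with `n` columns whose rows are the binary expansions of the given numbers,
most significant digit in the first (leftmost) column, padded with leading zeros to length `n`. -/
def bitMatrix {k : ℕ} (n : ℕ) (rows : Fin k → ℕ) : Matrix (Fin k) (Fin n) (ZMod 2) :=
  Matrix.of fun i j => if (rows i).testBit (n - 1 - (j : ℕ)) then 1 else 0

/-- The binary linear code with generator matrix `G`: the span of the rows of `G`. -/
def rowCode {k n : ℕ} (G : Matrix (Fin k) (Fin n) (ZMod 2)) :
    Submodule (ZMod 2) (Fin n → ZMod 2) :=
  Submodule.span (ZMod 2) (Set.range fun i => G i)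

/-- The effective length of a binary code: the number of coordinates that are not identically zero
on the code, i.e. the smallest length attained by deleting zero coordinates. -/
noncomputable def effLength {N : ℕ} (C : Submodule (ZMod 2) (Fin N → ZMod 2)) : ℕ :=
  Set.ncard {i : Fin N | ∃ c ∈ C, c i ≠ 0}

/-- `K` is isomorphic to the code `C`, where no coordinate of `C` is identically zero: up to a
permutation of coordinates, `K` is `C` with zero coordinates appended. Precisely, for some
injection `e` of the coordinates of `C` into those of `K`, the words of `K` are the words of `C`
transported along `e` and extended by zero. -/
def IsCopyOf {n N : ℕ} (K : Submodule (ZMod 2) (Fin N → ZMod 2))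
    (C : Submodule (ZMod 2) (Fin n → ZMod 2)) : Prop :=
  ∃ e : Fin n ↪ Fin N, K = C.map (Function.ExtendByZero.linearMap (ZMod 2) e)

/-- Generator matrix of the `[63, 12]` code. -/
def genMatrix63 : Matrix (Fin 12) (Fin 63) (ZMod 2) :=
  bitMatrix 63 ![
    0b001100001110000001111101000011111110010010100100001100000000000,
    0b101001111111000000110111010000100110100011011000000010000000000,
    0b000100111011100011110111001000010000110000110110100001000000000,
    0b010001111111110011001100001001100100010001101000001000100000000,
    0b110001110000010111001111011000011100100011000010100000010000000,
    0b000000011000110111100011010011101110010001011110000000001000000,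
    0b010011110001111101010000110100100011101110111111111000000100000,
    0b001000110111101100001111110000000001100110000111100000000010000,
    0b000111110001100011000000001100011111100001100001111000000001000,
    0b000000001111100000111111111100000000011111100000011000000000100,
    0b000000000000011111111111111100000000000000011111111000000000010,
    0b000000000000000000000000000011111111111111111111111000000000001]

/-- The `[63, 12, 24]` code with weights in `{24, 32, 40}` generated by `genMatrix63`. -/
def code63 : Submodule (ZMod 2) (Fin 63 → ZMod 2) := rowCode genMatrix63

/-- Generator matrix of the `[64, 12]` code. -/
def genMatrix64 : Matrix (Fin 12) (Fin 64) (ZMod 2) :=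
  bitMatrix 64 ![
    0b0000110001101110000100100100100011011000011011011110100000000000,
    0b1011110000100110010000001100010000111101001110111000010000000000,
    0b1010110001001010110010000000101111110000001100101011001000000000,
    0b1111100000001100000010100100111101000011011011101000000100000000,
    0b0111000000001010110110001100011000000110111100110011000010000000,
    0b0000000100001001111110011010010101001101010101010101000001000000,
    0b0101011111010000010001111001110011000100100000101100000000100000,
    0b0011010011001000001111111001111111011111010011011100000000010000,
    0b0000101111000110000000000111101111000011001111000011000000001000,
    0b0000011111000001111111111111100000111111000000111111000000000100,
    0b0000000000111111111111111111100000000000111111111111000000000010,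
    0b0000000000000000000000000000011111111111111111111111000000000001]

/-- The `[64, 12, 24]` code with weights in `{24, 32, 40}` generated by `genMatrix64`. -/
def code64 : Submodule (ZMod 2) (Fin 64 → ZMod 2) := rowCode genMatrix64

/-- Generator matrix of the `[65, 12]` code. -/
def genMatrix65 : Matrix (Fin 12) (Fin 65) (ZMod 2) :=
  bitMatrix 65 ![
    0b10000100000000110110010001110100111101010001011110010100000000000,
    0b10100100011000001001000110100110111111001000001100011010000000000,
    0b01000010011100011000000100110100110000011111011110001001000000000,
    0b11110100001110110100000011010110100001011100000100001000100000000,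
    0b01101011000001100011010001000011001010001111000010111000010000000,
    0b00101001110111101011000001011000000110111001001000100000001000000,
    0b00011000111111100000111110001000100010001010101001100000000100000,
    0b00000111001011100111110001010100000001111001100000011000000010000,
    0b00011111000111100000001111001101111110000111100111111000000001000,
    0b00000000111111100000000000111100011110000000011111111000000000100,
    0b00000000000000011111111111111100000001111111111111111000000000010,
    0b00000000000000000000000000000011111111111111111111111000000000001]

/-- The `[65, 12, 24]` code with weights in `{24, 32, 40}` generated by `genMatrix65`. -/
def code65 : Submodule (ZMod 2) (Fin 65 → ZMod 2) := rowCode genMatrix65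

/-!
Let `C` be one of the three codes, of length `n`, and let `K' = K ∪ (v + K)` where `K` is a copy
of `C`. On the coordinates of the copy, `v` is a word `x` of length `n`, and it has `t > 0`
further ones, so that `n + t ≤ 66`. The weights of `K' \ K` are the distances from `x` to the
codewords, increased by `t` (`IsCopyAlong.exists_valid`). Hence every such distance is `16 - t` or
at least `28 - t` (`Valid`), and the claim is that no word `x` is valid if `n < 65`, and that the
largest distance from a valid word is `43` if `n = 65`. Codewords are encoded as natural numbers,
the coordinates being the bits.

Either at most one codeword has distance `16 - t` from `x`, or there are two such codewords.

In the first case `x` is `Regular`: all distances are at least `b`, and all but one are at least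
`β`. If `d` is a codeword, then averaging the distances to `c` and `c + d` shows that a condition
of the same shape holds on the coordinates outside of `d` (`Regular.cut`); iterating this, one
obtains strong conditions on few coordinates that only involve the few words of a residual code
(`Averager`). They prune a tree search through the coordinates of `x`, in which the distances for
all words of several residual codes are the digits of one large number, so that one step consists
of a few operations on natural numbers (`tree_sound`). Up to the addition of codewords and the
automorphisms of the code, the search is exhausted without a solution (`not_regular63`,
`not_regular64`, `not_regular65`).

In the second case, after adding a codeword, `x` and `x + c` both have weight `16 - t` for a
codeword `c`, which has weight `24` because all weights of `C` are `0`, `24`, `32`, `40`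
(`Pinned`). Then `x` has `12` ones in `c` and `4 - t` ones outside. Consider the companions of
`c`: the codewords `d` such that `d` and `c + d` have weight `24`. If `x` has ones in `d` outside
of `c`, then `d` or `c + d` is at distance `16 - t` from `x` (`Pinned.near`). On the one hand, an
incidence count bounds the number of codewords at this distance (`IsThreeWeight.card_mul_sq_le`),
hence of the companions that are met outside of `c` (`Pinned.countP_le`). On the other hand, `x`,
up to a shift, is then in the same relation to `d` and to `c + d` as to `c`, so that codewords
that have been dealt with cannot be met (`Pinned.of_settled`). These conditions leave few
possibilities for the ones of `x` outside of `c`, and those inside are found by a search that uses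
the possible numbers of ones in the companions (`Pinned.inner_mem`, `wordTree_sound`). It suffices
to treat one codeword `c` from each orbit of the automorphism group (`settled_of_settles`). Only
the code of length `65` admits a solution, and the weights of the corresponding coset are computed
directly (`Valid.hasCoveringWeight65`).
-/

namespace CodeExtension

/-! ### Words, codes and packed arithmetic -/

/-- The coset `w + ⟨rs⟩` of the binary code generated by `rs`, listed with `2 ^ rs.length` entries.
Codewords are natural numbers, the coordinate `i` of a codeword being its bit `i`. -/
def coset : List ℕ → ℕ → List ℕ
  | [], w => [w]
  | r :: rs, w => coset rs w ++ coset rs (w ^^^ r)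

theorem length_coset (rs : List ℕ) (w : ℕ) : (coset rs w).length = 2 ^ rs.length := by
  induction rs generalizing w with
  | nil => rfl
  | cons r rs ih => simp [coset, ih, pow_succ]; ring

theorem self_mem_coset (rs : List ℕ) (w : ℕ) : w ∈ coset rs w := by
  induction rs generalizing w with
  | nil => simp [coset]
  | cons r rs ih => simp [coset, ih]

theorem xor_mem_coset {rs : List ℕ} {u v a b : ℕ} (ha : a ∈ coset rs u) (hb : b ∈ coset rs v) :
    a ^^^ b ∈ coset rs (u ^^^ v) := by
  induction rs generalizing u v with
  | nil => simp_all [coset]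
  | cons r rs ih =>
    simp only [coset, List.mem_append] at ha hb ⊢
    rcases ha with ha | ha <;> rcases hb with hb | hb
    · exact Or.inl (ih ha hb)
    · right; have := ih ha hb; rwa [← Nat.xor_assoc] at this
    · right; have := ih ha hb
      rwa [Nat.xor_assoc, Nat.xor_comm r v, ← Nat.xor_assoc] at this
    · left; have := ih ha hb
      rwa [show u ^^^ r ^^^ (v ^^^ r) = u ^^^ v by
        rw [Nat.xor_comm v r, Nat.xor_assoc, ← Nat.xor_assoc r r v, Nat.xor_self,
          Nat.zero_xor]] at this

theorem mem_coset_of_mem {rs : List ℕ} {r : ℕ} (h : r ∈ rs) : r ∈ coset rs 0 := by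
  induction rs with
  | nil => simp at h
  | cons q rs ih =>
    simp only [coset, List.mem_append]
    rcases List.mem_cons.1 h with rfl | h
    · right; simpa using self_mem_coset rs (0 ^^^ r)
    · exact Or.inl (ih h)

/-- A set of codewords that is closed under addition. -/
structure IsLinear (C : Set ℕ) : Prop where
  zero : 0 ∈ C
  xor : ∀ {a b}, a ∈ C → b ∈ C → a ^^^ b ∈ C

theorem isLinear_coset (rs : List ℕ) : IsLinear {c | c ∈ coset rs 0} :=
  ⟨self_mem_coset rs 0, fun ha hb => by simpa using xor_mem_coset ha hb⟩

theorem IsLinear.coset_subset {C : Set ℕ} (hC : IsLinear C) {rs : List ℕ} (h : ∀ r ∈ rs, r ∈ C)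
    {w c : ℕ} (hw : w ∈ C) (hc : c ∈ coset rs w) : c ∈ C := by
  induction rs generalizing w with
  | nil => simp_all [coset]
  | cons r rs ih =>
    simp only [coset, List.mem_append] at hc
    rcases hc with hc | hc
    · exact ih (fun q hq => h q (by simp [hq])) hw hc
    · exact ih (fun q hq => h q (by simp [hq])) (hC.xor hw (h r (by simp))) hc

/-- The value `Nat.testBit d i`, in a form that the kernel evaluates quickly. -/
def bitAt (d i : ℕ) : Bool := Nat.beq (Nat.land (Nat.shiftRight d i) 1) 1

theorem bitAt_eq (d i : ℕ) : bitAt d i = d.testBit i := by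
  rw [bitAt, Bool.eq_iff_iff, Nat.beq_eq, Nat.testBit, Nat.and_comm]
  change (d >>> i) &&& 1 = 1 ↔ _
  rw [Nat.and_one_is_mod]
  rcases Nat.mod_two_eq_zero_or_one (d >>> i) with h | h <;> simp [h]

/-- The list of natural numbers less than `256` written as the base `256` digits of one number. -/
def packL : List ℕ → ℕ
  | [] => 0
  | a :: l => a + 256 * packL l

theorem packL_append (l₁ l₂ : List ℕ) :
    packL (l₁ ++ l₂) = packL l₁ + 256 ^ l₁.length * packL l₂ := by
  induction l₁ with
  | nil => simp [packL]
  | cons a l ih => simp only [List.cons_append, packL, ih, List.length_cons, pow_succ]; ring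

theorem packL_map_sub {α : Type*} (l : List α) (f g : α → ℕ) (h : ∀ a ∈ l, g a ≤ f a) :
    packL (l.map f) - packL (l.map g) = packL (l.map fun a => f a - g a) := by
  suffices packL (l.map f) = packL (l.map fun a => f a - g a) + packL (l.map g) by omega
  induction l with
  | nil => rfl
  | cons a l ih =>
    have h1 := h a (by simp)
    have h2 := ih fun b hb => h b (by simp [hb])
    simp only [List.map_cons, packL, h2]
    omega

theorem packL_map_add {α : Type*} (l : List α) (f g : α → ℕ) :
    packL (l.map f) + packL (l.map g) = packL (l.map fun a => f a + g a) := by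
  induction l with
  | nil => rfl
  | cons a l ih => simp only [List.map_cons, packL]; omega

theorem packL_lt {l : List ℕ} (h : ∀ a ∈ l, a < 256) : packL l < 256 ^ l.length := by
  induction l with
  | nil => simp [packL]
  | cons a l ih =>
    have h1 := h a (by simp)
    have h2 := ih fun b hb => h b (by simp [hb])
    simp only [packL, List.length_cons, pow_succ]
    omega

theorem and_add_two_pow_mul {e a c : ℕ} (b d : ℕ) (ha : a < 2 ^ e) (hc : c < 2 ^ e) :
    (a + 2 ^ e * b) &&& (c + 2 ^ e * d) = (a &&& c) + 2 ^ e * (b &&& d) := by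
  have hac : a &&& c < 2 ^ e := lt_of_le_of_lt Nat.and_le_left ha
  rw [add_comm a, add_comm c, add_comm (a &&& c)]
  apply Nat.eq_of_testBit_eq
  intro i
  rw [Nat.testBit_and, Nat.testBit_two_pow_mul_add _ ha,
    Nat.testBit_two_pow_mul_add _ hc, Nat.testBit_two_pow_mul_add _ hac]
  split <;> simp

theorem packL_map_and {α : Type*} (l : List α) (f g : α → ℕ) (hf : ∀ a ∈ l, f a < 256)
    (hg : ∀ a ∈ l, g a < 256) :
    packL (l.map f) &&& packL (l.map g) = packL (l.map fun a => f a &&& g a) := by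
  induction l with
  | nil => simp [packL]
  | cons a l ih =>
    simp only [List.map_cons, packL]
    rw [show 256 = 2 ^ 8 by rfl, and_add_two_pow_mul _ _ (hf a (by simp)) (hg a (by simp)),
      ih (fun b hb => hf b (by simp [hb])) fun b hb => hg b (by simp [hb])]

/-- The number with `k` base `256` digits equal to `1`. -/
def ones (k : ℕ) : ℕ := (256 ^ k - 1) / 255

theorem packL_const {α : Type*} (l : List α) (v : ℕ) :
    packL (l.map fun _ => v) = v * ones l.length := by
  induction l with
  | nil => simp [packL, ones]
  | cons a l ih =>
    have h : ones (l.length + 1) = 1 + 256 * ones l.length := by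
      have h1 : 255 ∣ 256 ^ l.length - 1 := by
        simpa using Nat.sub_dvd_pow_sub_pow 256 1 l.length
      have h2 : 0 < 256 ^ l.length := by positivity
      unfold ones
      rw [pow_succ]
      omega
    simp only [List.map_cons, packL, ih, List.length_cons, h]
    ring

theorem and_128_of_ge {a : ℕ} (h : 128 ≤ a) (h' : a < 256) : a &&& 128 = 128 := by
  interval_cases a <;> rfl

theorem and_128_of_lt {a : ℕ} (h : a < 128) : a &&& 128 = 0 := by
  interval_cases a <;> rfl

/-- If at most one digit of a number with digits `0` and `128` is non-zero, then the number is zero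
or a power of two. -/
theorem packL_eq_zero_or_two_pow {l : List ℕ} (h : ∀ a ∈ l, a = 0 ∨ a = 128)
    (h1 : l.countP (fun a => a != 0) ≤ 1) : packL l = 0 ∨ ∃ k, packL l = 2 ^ k := by
  induction l with
  | nil => simp [packL]
  | cons a l ih =>
    have hl : ∀ b ∈ l, b = 0 ∨ b = 128 := fun b hb => h b (by simp [hb])
    rcases h a (by simp) with rfl | rfl
    · have := ih hl (by simpa [List.countP_cons] using h1)
      rcases this with h | ⟨k, h⟩
      · left; simp [packL, h]
      · right; exact ⟨k + 8, by simp [packL, h, pow_succ]; ring⟩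
    · right
      have h0 : l.countP (fun a => a != 0) = 0 := by
        simp at h1; simpa using h1
      have hz : l = l.map fun _ => 0 := by
        rw [List.countP_eq_zero] at h0
        conv_lhs => rw [← List.map_id l]
        exact List.map_congr_left fun b hb => by simpa using h0 b hb
      refine ⟨7, ?_⟩
      rw [hz]
      simp only [packL, packL_const]
      norm_num

/-! ### Regular words -/

/-- The number of coordinates in the list `o` and in the mask `M` where `x` and `c` differ. -/
def dist (o : List ℕ) (M : ℕ) (x : ℕ → Bool) (c : ℕ) : ℕ :=
  o.countP fun i => M.testBit i && (x i != c.testBit i)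

/-- The number of coordinates in the list `o` and in the mask `M` where `x` and `c` agree. -/
def agree (o : List ℕ) (M : ℕ) (x : ℕ → Bool) (c : ℕ) : ℕ :=
  o.countP fun i => M.testBit i && (x i == c.testBit i)

/-- The number of coordinates in the list `o` that lie in the mask `M`. -/
def size (o : List ℕ) (M : ℕ) : ℕ := o.countP fun i => bitAt M i

theorem size_eq (o : List ℕ) (M : ℕ) : size o M = o.countP fun i => M.testBit i := by
  simp only [size, bitAt_eq]

/-- On the coordinates of `o` in `M`, all codewords have distance at least `b` from `x`, and all
those at distance less than `β` agree. -/
structure Regular (C : Set ℕ) (o : List ℕ) (M β b : ℕ) (x : ℕ → Bool) : Prop where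
  le : ∀ c ∈ C, b ≤ dist o M x c
  agree : ∀ c ∈ C, ∀ d ∈ C, dist o M x c < β → dist o M x d < β →
    ∀ i ∈ o, M.testBit i → c.testBit i = d.testBit i

theorem agree_add_dist (o : List ℕ) (M : ℕ) (x : ℕ → Bool) (c : ℕ) :
    agree o M x c + dist o M x c = size o M := by
  induction o with
  | nil => rfl
  | cons i o ih =>
    simp only [agree, dist, size_eq, List.countP_cons] at ih ⊢
    cases M.testBit i <;> cases x i <;> cases c.testBit i <;> simp <;> omega

/-- The coordinates of `M` outside `d`. -/
def cut (M d : ℕ) : ℕ := M ^^^ (M &&& d)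

theorem testBit_cut (M d i : ℕ) : (cut M d).testBit i = (M.testBit i && !d.testBit i) := by
  simp only [cut, Nat.testBit_xor, Nat.testBit_and]
  cases M.testBit i <;> cases d.testBit i <;> rfl

theorem dist_add_dist_xor (o : List ℕ) (M : ℕ) (x : ℕ → Bool) (c d : ℕ) :
    dist o M x c + dist o M x (c ^^^ d) = 2 * dist o (cut M d) x c + size o (M &&& d) := by
  induction o with
  | nil => rfl
  | cons i o ih =>
    simp only [dist, size_eq, List.countP_cons, testBit_cut, Nat.testBit_xor,
      Nat.testBit_and] at ih ⊢
    cases M.testBit i <;> cases x i <;> cases c.testBit i <;> cases d.testBit i <;> simp <;> omega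

/-- Averaging the distances from `x` to `c` and `c + d` removes the support of `d`, and halves the
gap between the two bounds. -/
theorem Regular.cut {C : Set ℕ} (hC : IsLinear C) {o : List ℕ} {M β b : ℕ} {x : ℕ → Bool}
    (h : Regular C o M β b x) {d : ℕ} (hd : d ∈ C) (hk : 0 < size o (M &&& d)) :
    Regular C o (cut M d) ((2 * β + 1 - size o (M &&& d)) / 2)
      ((β + b + 1 - size o (M &&& d)) / 2) x := by
  rw [size_eq] at hk
  obtain ⟨i, hi, hMd⟩ := List.countP_pos_iff.1 hk
  rw [← size_eq] at hk
  rw [Nat.testBit_and, Bool.and_eq_true] at hMd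
  -- one of `c` and `c + d` is far from `x`, as they differ at the coordinate `i` of `M`
  have key : ∀ c ∈ C, β ≤ dist o M x c ∨ β ≤ dist o M x (c ^^^ d) := by
    intro c hc
    by_contra! hlt
    have := h.agree c hc _ (hC.xor hc hd) hlt.1 hlt.2 i hi hMd.1
    simp [hMd.2] at this
  refine ⟨fun c hc => ?_, fun c hc c' hc' h1 h2 j hj hM => ?_⟩
  · have h1 := dist_add_dist_xor o M x c d
    have h2 := h.le c hc
    have h3 := h.le _ (hC.xor hc hd)
    rcases key c hc with h4 | h4 <;> omega
  · rw [testBit_cut, Bool.and_eq_true, Bool.not_eq_true'] at hM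
    have near : ∀ c ∈ C, dist o (CodeExtension.cut M d) x c <
        (2 * β + 1 - size o (M &&& d)) / 2 →
        ∃ e ∈ C, dist o M x e < β ∧ e.testBit j = c.testBit j := by
      intro c hc hlt
      have h1 := dist_add_dist_xor o M x c d
      by_cases h2 : dist o M x c < β
      · exact ⟨c, hc, h2, rfl⟩
      · exact ⟨c ^^^ d, hC.xor hc hd, by omega, by simp [hM.2]⟩
    obtain ⟨e, he, hlt, hej⟩ := near c hc h1
    obtain ⟨e', he', hlt', hej'⟩ := near c' hc' h2
    rw [← hej, ← hej']
    exact h.agree e he e' he' hlt hlt' j hj hM.1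

/-- Gaussian elimination along the coordinates `o`: generators with successive pivots. -/
def pivots (M : ℕ) : List ℕ → List ℕ → List ℕ
  | [], _ => []
  | p :: o, rs =>
    match bitAt M p, rs.find? fun r => bitAt r p with
    | true, some r => r :: pivots M o (rs.map fun q => cond (bitAt q p) (Nat.xor q r) q)
    | _, _ => pivots M o rs

theorem pivots_mem {C : Set ℕ} (hC : IsLinear C) (M : ℕ) (o : List ℕ) {rs : List ℕ}
    (h : ∀ r ∈ rs, r ∈ C) : ∀ r ∈ pivots M o rs, r ∈ C := by
  induction o generalizing rs with
  | nil => simp [pivots]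
  | cons p o ih =>
    unfold pivots
    split
    · next r _ hr =>
      have hrC := h r (List.mem_of_find?_eq_some hr)
      refine List.forall_mem_cons.2 ⟨hrC, ih ?_⟩
      intro q hq
      obtain ⟨q', hq', rfl⟩ := List.mem_map.1 hq
      cases bitAt q' p
      · exact h _ hq'
      · exact hC.xor (h _ hq') hrC
    · exact ih h

theorem pivots_testBit (M : ℕ) (o : List ℕ) {rs : List ℕ} {p : ℕ}
    (h : ∀ r ∈ rs, r.testBit p = false) : ∀ r ∈ pivots M o rs, r.testBit p = false :=
  pivots_mem (C := {r | r.testBit p = false}) ⟨by simp, fun ha hb => by simp_all⟩ M o h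

theorem coset_testBit {rs : List ℕ} {p : ℕ} (h : ∀ r ∈ rs, r.testBit p = false) {w c : ℕ}
    (hc : c ∈ coset rs w) : c.testBit p = w.testBit p := by
  have h1 := xor_mem_coset hc (self_mem_coset rs w)
  rw [Nat.xor_self] at h1
  have h2 := IsLinear.coset_subset (C := {r | r.testBit p = false})
    ⟨by simp, fun ha hb => by simp_all⟩ h (w := 0) (by simp) h1
  simpa using h2

/-- Distinct entries of the code generated by the pivot words differ on the mask. -/
theorem pairwise_coset_pivots (M : ℕ) (o : List ℕ) (rs : List ℕ) (w : ℕ) :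
    (coset (pivots M o rs) w).Pairwise
      fun c d => ∃ i ∈ o, M.testBit i ∧ c.testBit i ≠ d.testBit i := by
  induction o generalizing rs w with
  | nil => simp [pivots, coset]
  | cons p o ih =>
    have lift : ∀ rs w, (coset (pivots M o rs) w).Pairwise
        fun c d => ∃ i ∈ p :: o, M.testBit i ∧ c.testBit i ≠ d.testBit i := fun rs w =>
      (ih rs w).imp fun {c d} ⟨i, hi, h⟩ => ⟨i, by simp [hi], h⟩
    unfold pivots
    split
    · next r hM hr =>
      have hrp : r.testBit p := by simpa [bitAt_eq] using List.find?_some hr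
      rw [bitAt_eq] at hM
      refine List.pairwise_append.2 ⟨lift _ _, lift _ _, fun c hc d hd => ⟨p, by simp, hM, ?_⟩⟩
      have hz : ∀ q ∈ pivots M o (rs.map fun q => cond (bitAt q p) (Nat.xor q r) q),
          q.testBit p = false := by
        apply pivots_testBit
        intro q hq
        obtain ⟨q', -, rfl⟩ := List.mem_map.1 hq
        rw [bitAt_eq]
        cases hqp : q'.testBit p
        · exact hqp
        · change (q' ^^^ r).testBit p = false
          simp [hqp, hrp]
      rw [coset_testBit hz hc, coset_testBit hz hd]
      simp [hrp]
    · exact lift _ _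

/-! ### Tree search with packed counters -/

/-- A set of coordinates (as a mask) with bounds `β` and `b` as in `Regular`, and generators of a
code whose words are pairwise different on these coordinates. -/
structure Averager where
  mask : ℕ
  β : ℕ
  b : ℕ
  gens : List ℕ

/-- What a regular word `x` satisfies with respect to an averager. -/
structure Averager.Holds (a : Averager) (o : List ℕ) (x : ℕ → Bool) : Prop where
  le : ∀ c ∈ coset a.gens 0, a.b ≤ dist o a.mask x c
  pairwise : (coset a.gens 0).Pairwise fun c d =>
    ¬ (dist o a.mask x c < a.β ∧ dist o a.mask x d < a.β)
  small : size o a.mask < 128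
  b_le : a.b ≤ a.β
  β_le : a.β ≤ 128

theorem Regular.holds {C : Set ℕ} (hC : IsLinear C) {o : List ℕ} {M β b : ℕ} {x : ℕ → Bool}
    (h : Regular C o M β b x) {rs : List ℕ} (hrs : ∀ r ∈ rs, r ∈ C) (hs : size o M < 128)
    (hb : b ≤ β) (hβ : β ≤ 128) : Averager.Holds ⟨M, β, b, pivots M o rs⟩ o x := by
  have hsub : ∀ c ∈ coset (pivots M o rs) 0, c ∈ C := fun c =>
    hC.coset_subset (pivots_mem hC M o hrs) hC.zero
  refine ⟨fun c hc => h.le c (hsub c hc), ?_, hs, hb, hβ⟩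
  refine (pairwise_coset_pivots M o rs 0).imp_of_mem ?_
  rintro c d hc hd ⟨i, hi, hM, hne⟩ ⟨h1, h2⟩
  exact hne (h.agree c (hsub c hc) d (hsub d hd) h1 h2 i hi hM)

/-- The averager obtained by cutting all coordinates successively with the words `ds`. -/
def averager (o rs : List ℕ) (M β b : ℕ) : List ℕ → Averager
  | [] => ⟨M, β, b, pivots M o rs⟩
  | d :: ds =>
    let k := size o (M &&& d)
    averager o rs (cut M d) ((2 * β + 1 - k) / 2) ((β + b + 1 - k) / 2) ds

/-- Each word in `ds` meets the coordinates that are left. -/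
def cutsProper (o : List ℕ) (M : ℕ) : List ℕ → Bool
  | [] => true
  | d :: ds => decide (0 < size o (M &&& d)) && cutsProper o (cut M d) ds

theorem Regular.averager_holds {C : Set ℕ} (hC : IsLinear C) {o : List ℕ} {M β b : ℕ}
    {x : ℕ → Bool} (h : Regular C o M β b x) {rs ds : List ℕ} (hrs : ∀ r ∈ rs, r ∈ C)
    (hs : o.length < 128) (hb : b ≤ β) (hβ : β ≤ 128) (hds : ∀ d ∈ ds, d ∈ C)
    (hp : cutsProper o M ds) : (averager o rs M β b ds).Holds o x := by
  induction ds generalizing M β b with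
  | nil => exact h.holds hC hrs (lt_of_le_of_lt List.countP_le_length hs) hb hβ
  | cons d ds ih =>
    rw [cutsProper, Bool.and_eq_true, decide_eq_true_eq] at hp
    exact ih (h.cut hC (hds d (by simp)) hp.1) (by omega) (by omega)
      (fun e he => hds e (by simp [he])) hp.2

/-- All pairs of an averager and a codeword that is tracked for it; the pair with `none` after each
block is a separator. -/
def cells (as : List Averager) : List (Averager × Option ℕ) :=
  as.flatMap fun a => (coset a.gens 0).map (fun c => (a, some c)) ++ [(a, none)]

/-- A function of the averager on proper cells, and zero on separators. -/
def proper (v : Averager → ℕ) : Averager × Option ℕ → ℕ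
  | (_, none) => 0
  | (a, some _) => v a

/-- The counter of a cell when the coordinates in `pre` are known: at least `128` if and only if the
distance can still reach `β`. -/
def counter (o pre : List ℕ) (x : ℕ → Bool) : Averager × Option ℕ → ℕ
  | (_, none) => 0
  | (a, some c) => 128 + size o a.mask - a.β - agree pre a.mask x c

/-- The test that prunes the search tree: a counter in `W` has fallen so far that the distance to
some word is less than `b`, or two distances for the same averager are less than `β`. Here `H`
has the high bits of all proper digits, `D` adds the differences `β - b`, and adding `K` subtracts
one from each block, borrowing from its separator. -/
noncomputable def dead (H D K W : ℕ) : Bool :=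
  Bool.rec (motive := fun _ => Bool)
    (Bool.rec (motive := fun _ => Bool) true
      (Bool.rec (motive := fun _ => Bool) true false (Nat.beq (Nat.land (Nat.add W D) H) H))
      (Nat.beq (Nat.land (Nat.sub H (Nat.land W H)) (Nat.add (Nat.sub H (Nat.land W H)) K)) 0))
    false (Nat.beq (Nat.land W H) H)

theorem dead_eq_cond (H D K W : ℕ) : dead H D K W =
    cond (Nat.beq (Nat.land W H) H) false
      (cond (Nat.beq (Nat.land (Nat.sub H (Nat.land W H))
          (Nat.add (Nat.sub H (Nat.land W H)) K)) 0)
        (cond (Nat.beq (Nat.land (Nat.add W D) H) H) false true) true) := by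
  unfold dead
  cases Nat.beq (Nat.land W H) H <;> cases Nat.beq (Nat.land (Nat.add W D) H) H <;>
    cases Nat.beq (Nat.land (Nat.sub H (Nat.land W H)) (Nat.add (Nat.sub H (Nat.land W H)) K)) 0 <;>
    rfl

/-- The packed constants `v a` over the proper cells of the averagers. -/
def packConst (v : Averager → ℕ) : List Averager → ℕ
  | [] => 0
  | a :: as => v a * ones (2 ^ a.gens.length) + 256 ^ (2 ^ a.gens.length + 1) * packConst v as

/-- In each block, the separator is one and one is subtracted. -/
def borrow : List Averager → ℕ
  | [] => 0
  | a :: as => (256 ^ 2 ^ a.gens.length - 1) + 256 ^ (2 ^ a.gens.length + 1) * borrow as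

theorem packL_cells_cons (a : Averager) (as : List Averager) (f : Averager × Option ℕ → ℕ)
    (h0 : f (a, none) = 0) :
    packL ((cells (a :: as)).map f) = packL ((coset a.gens 0).map fun c => f (a, some c)) +
      256 ^ (2 ^ a.gens.length + 1) * packL ((cells as).map f) := by
  rw [cells, List.flatMap_cons, List.append_assoc, List.map_append, packL_append, List.length_map,
    List.length_map, length_coset, List.map_map, List.singleton_append, List.map_cons, packL, h0,
    pow_succ, Nat.zero_add, mul_assoc]
  rfl

theorem packConst_eq (v : Averager → ℕ) (as : List Averager) :
    packConst v as = packL ((cells as).map (proper v)) := by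
  induction as with
  | nil => rfl
  | cons a as ih =>
    rw [packL_cells_cons _ _ _ rfl, ← ih, packConst]
    exact congrArg₂ _ (by
      rw [← length_coset a.gens 0]
      exact (packL_const (coset a.gens 0) (v a)).symm) rfl

theorem mem_cells {as : List Averager} {p : Averager × Option ℕ} (hp : p ∈ cells as) :
    p.1 ∈ as ∧ ∀ c, p.2 = some c → c ∈ coset p.1.gens 0 := by
  obtain ⟨a, ha, hp⟩ := List.mem_flatMap.1 hp
  rcases List.mem_append.1 hp with hp | hp
  · obtain ⟨c, hc, rfl⟩ := List.mem_map.1 hp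
    exact ⟨ha, by rintro d ⟨⟩; exact hc⟩
  · obtain rfl := List.mem_singleton.1 hp
    exact ⟨ha, by simp⟩

theorem mem_cells_of_mem {as : List Averager} {a : Averager} (ha : a ∈ as) {c : ℕ}
    (hc : c ∈ coset a.gens 0) : (a, some c) ∈ cells as :=
  List.mem_flatMap.2 ⟨a, ha, by simp [hc]⟩

theorem and_add_borrow (as : List Averager) (f : Averager × Option ℕ → ℕ)
    (h0 : ∀ a, f (a, none) = 0) (h : ∀ p ∈ cells as, f p = 0 ∨ f p = 128)
    (h1 : ∀ a ∈ as, ((coset a.gens 0).map fun c => f (a, some c)).countP (fun a => a != 0) ≤ 1) :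
    packL ((cells as).map f) &&& (packL ((cells as).map f) + borrow as) = 0 := by
  induction as with
  | nil => simp [cells, packL]
  | cons a as ih =>
    have h' : ∀ p ∈ (coset a.gens 0).map (fun c => f (a, some c)), p = 0 ∨ p = 128 := by
      intro p hp
      obtain ⟨c, hc, rfl⟩ := List.mem_map.1 hp
      exact h _ (mem_cells_of_mem (by simp) hc)
    have hlt : packL ((coset a.gens 0).map fun c => f (a, some c)) < 256 ^ 2 ^ a.gens.length := by
      have := packL_lt (l := (coset a.gens 0).map fun c => f (a, some c))
        fun p hp => by rcases h' p hp with h | h <;> omega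
      rwa [List.length_map, length_coset] at this
    have h2 := packL_eq_zero_or_two_pow h' (h1 a (by simp))
    have h3 := ih (fun p hp => h p (by
      simp only [cells, List.flatMap_cons, List.mem_append] at hp ⊢; exact Or.inr hp))
      fun b hb => h1 b (by simp [hb])
    rw [packL_cells_cons _ _ _ (h0 a), borrow]
    have e0 : 256 ^ (2 ^ a.gens.length + 1) = 2 ^ (8 * (2 ^ a.gens.length + 1)) := by
      rw [pow_mul]; norm_num
    have e1 : 256 ^ 2 ^ a.gens.length = 2 ^ (8 * 2 ^ a.gens.length) := by
      rw [pow_mul]; norm_num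
    have e2 : 256 ^ (2 ^ a.gens.length + 1) = 256 ^ 2 ^ a.gens.length * 256 := pow_succ _ _
    rw [show ∀ u S v T w : ℕ, u + S * v + (T + S * w) = (u + T) + S * (v + w) by intros; ring, e0,
      and_add_two_pow_mul _ _ (by omega) (by omega), h3]
    rcases h2 with h2 | ⟨k, h2⟩
    · simp [h2]
    · rw [h2] at hlt ⊢
      rw [e1] at hlt ⊢
      have hk : k < 8 * 2 ^ a.gens.length := (Nat.pow_lt_pow_iff_right (by norm_num)).1 hlt
      have hpos : 0 < 2 ^ k := by positivity
      rw [Nat.mul_zero, Nat.add_zero, Nat.two_pow_and,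
        show 2 ^ k + (2 ^ (8 * 2 ^ a.gens.length) - 1) =
          2 ^ (8 * 2 ^ a.gens.length) * 1 + (2 ^ k - 1) by omega,
        Nat.testBit_two_pow_mul_add _ (by omega), if_pos hk,
        Nat.testBit_lt_two_pow (by omega)]
      rfl

theorem countP_le_one_of_pairwise {α : Type*} {l : List α} {p : α → Bool}
    (h : l.Pairwise fun a b => ¬ (p a ∧ p b)) : l.countP p ≤ 1 := by
  induction h with
  | nil => simp
  | @cons a l ha _ ih =>
    rw [List.countP_cons]
    split
    · next hpa =>
      have : l.countP p = 0 := List.countP_eq_zero.2 fun b hb hpb => ha b hb ⟨hpa, hpb⟩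
      omega
    · omega

theorem dead_eq_false {as : List Averager} {o pre : List ℕ} {x : ℕ → Bool}
    (h : ∀ a ∈ as, a.Holds o x)
    (hpre : ∀ M c, agree pre M x c ≤ agree o M x c) :
    dead (packConst (fun _ => 128) as) (packConst (fun a => a.β - a.b) as) (borrow as)
      (packL ((cells as).map (counter o pre x))) = false := by
  have hlow : ∀ a ∈ as, ∀ c,
      128 + dist o a.mask x c ≤ counter o pre x (a, some c) + a.β := by
    intro a ha c
    have h1 := agree_add_dist o a.mask x c
    have h2 := hpre a.mask c
    have h3 := (h a ha).β_le
    simp only [counter]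
    omega
  have hup : ∀ p ∈ cells as, counter o pre x p + proper (fun a => a.β - a.b) p < 256 := by
    rintro ⟨a, c⟩ hp
    have h1 : a.Holds o x := h _ (mem_cells hp).1
    have h2 := h1.small
    have h3 := h1.b_le
    have h4 := h1.β_le
    cases c <;> simp only [counter, proper] <;> omega
  have hH : ∀ p, proper (fun _ => 128) p < 256 := by
    rintro ⟨a, _ | c⟩ <;> simp [proper]
  rw [dead_eq_cond]
  have hD : Nat.beq (Nat.land (Nat.add (packL ((cells as).map (counter o pre x)))
      (packConst (fun a => a.β - a.b) as)) (packConst (fun _ => 128) as))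
      (packConst (fun _ => 128) as) = true := by
    rw [Nat.beq_eq]
    change (packL ((cells as).map (counter o pre x)) + packConst (fun a => a.β - a.b) as) &&& _ = _
    rw [packConst_eq, packConst_eq, packL_map_add, packL_map_and _ _ _ hup fun p _ => hH p]
    congr 1
    refine List.map_congr_left ?_
    rintro ⟨a, _ | c⟩ hp
    · simp [counter, proper]
    · have h1 := hlow a (mem_cells hp).1 c
      have h2 := (h _ (mem_cells hp).1).le _ ((mem_cells hp).2 c rfl)
      have h3 := (h _ (mem_cells hp).1).b_le
      have h4 := hup _ hp
      simp only [proper] at h1 h2 h3 h4 ⊢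
      exact and_128_of_ge (by omega) h4
  rw [hD]
  have hv : Nat.sub (packConst (fun _ => 128) as)
      (Nat.land (packL ((cells as).map (counter o pre x))) (packConst (fun _ => 128) as)) =
      packL ((cells as).map fun p => proper (fun _ => 128) p -
        (counter o pre x p &&& proper (fun _ => 128) p)) := by
    change packConst (fun _ => 128) as - (packL ((cells as).map (counter o pre x)) &&&
      packConst (fun _ => 128) as) = _
    rw [packConst_eq, packL_map_and _ _ _ (fun p hp => by have := hup p hp; omega)
      fun p _ => hH p, packL_map_sub]
    exact fun _ _ => Nat.and_le_right
  have hK := and_add_borrow as (fun p => proper (fun _ => 128) p -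
    (counter o pre x p &&& proper (fun _ => 128) p)) (fun a => by simp [proper]) ?_ ?_
  · rw [hv]
    change cond _ false (cond (Nat.beq (_ &&& (_ + _)) 0) (cond true false true) true) = false
    rw [hK]
    cases Nat.beq (Nat.land (packL ((cells as).map (counter o pre x)))
      (packConst (fun _ => 128) as)) (packConst (fun _ => 128) as) <;> rfl
  · rintro ⟨a, _ | c⟩ hp
    · simp [counter, proper]
    · by_cases h1 : counter o pre x (a, some c) < 128
      · right; simp only [proper]; rw [and_128_of_lt h1]
      · left; simp only [proper]
        rw [and_128_of_ge (by omega) (by have := hup _ hp; omega)]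
  · intro a ha
    rw [List.countP_map]
    apply countP_le_one_of_pairwise
    refine (h a ha).pairwise.imp_of_mem ?_
    have near : ∀ c ∈ coset a.gens 0, ¬ dist o a.mask x c < a.β →
        128 - (counter o pre x (a, some c) &&& 128) = 0 := by
      intro c hc h4
      have h3 := hlow a ha c
      have h5 := hup _ (mem_cells_of_mem ha hc)
      rw [and_128_of_ge (by omega) (by omega)]
    rintro c d hc hd hcd ⟨h1, h2⟩
    refine hcd ⟨?_, ?_⟩
    · by_contra h4
      simp [proper, near c hc h4] at h1
    · by_contra h4
      simp [proper, near d hd h4] at h2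

theorem Averager.Holds.agree_le {a : Averager} {o pre : List ℕ} {x : ℕ → Bool} (h : a.Holds o x)
    (hp : pre.Subperm o) (c : ℕ) : agree pre a.mask x c ≤ 128 + size o a.mask - a.β := by
  have h1 : agree pre a.mask x c ≤ agree o a.mask x c := hp.countP_le _
  have h2 := agree_add_dist o a.mask x c
  have h3 := h.β_le
  omega

/-- For a coordinate `i`, the packed indicators over the code generated by `rs` of the words with a
one, respectively a zero, at `i`. -/
def bitMasks : List ℕ → ℕ → ℕ × ℕ
  | [], _ => (0, 1)
  | r :: rs, i =>
    let p := bitMasks rs i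
    let s := 256 ^ 2 ^ rs.length
    cond (bitAt r i) (p.1 + s * p.2, p.2 + s * p.1) (p.1 + s * p.1, p.2 + s * p.2)

theorem bitMasks_spec (rs : List ℕ) (i w : ℕ) :
    packL ((coset rs w).map fun c => (c.testBit i).toNat) =
      (if w.testBit i then (bitMasks rs i).2 else (bitMasks rs i).1) ∧
    packL ((coset rs w).map fun c => (!c.testBit i).toNat) =
      (if w.testBit i then (bitMasks rs i).1 else (bitMasks rs i).2) := by
  induction rs generalizing w with
  | nil => cases h : w.testBit i <;> simp [coset, packL, bitMasks, h]
  | cons r rs ih =>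
    have h1 := ih w
    have h2 := ih (w ^^^ r)
    simp only [coset, List.map_append, packL_append, List.length_map, length_coset, bitMasks,
      h1.1, h1.2, h2.1, h2.2, Nat.testBit_xor, bitAt_eq]
    cases w.testBit i <;> cases r.testBit i <;> simp

/-- Whether the word of a cell has the value `b` at the coordinate `i` of its averager. -/
def agreeAt (i : ℕ) (b : Bool) : Averager × Option ℕ → ℕ
  | (_, none) => 0
  | (a, some c) => (a.mask.testBit i && (b == c.testBit i)).toNat

/-- The packed indicators over all cells of the averagers of the words with the value `b` at the
coordinate `i`, for those averagers whose mask contains `i`. -/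
def agreeMask (i : ℕ) (b : Bool) : List Averager → ℕ
  | [] => 0
  | a :: as =>
    cond (bitAt a.mask i) (cond b (bitMasks a.gens i).1 (bitMasks a.gens i).2) 0 +
      256 ^ (2 ^ a.gens.length + 1) * agreeMask i b as

theorem agreeMask_eq (i : ℕ) (b : Bool) (as : List Averager) :
    agreeMask i b as =
      packL ((cells as).map (agreeAt i b)) := by
  induction as with
  | nil => rfl
  | cons a as ih =>
    rw [packL_cells_cons _ _ _ rfl, ← ih, agreeMask, bitAt_eq]
    simp only [agreeAt]
    congr 1
    have h := bitMasks_spec a.gens i 0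
    cases hm : a.mask.testBit i
    · have h0 := packL_const (coset a.gens 0) 0
      simp only [Bool.false_and, Bool.toNat_false, h0]
      simp
    · cases b
      · simpa [hm] using h.2.symm
      · simpa [hm] using h.1.symm

theorem counter_cons {as : List Averager} {o pre : List ℕ} {x : ℕ → Bool} {i : ℕ}
    (h : ∀ a ∈ as, a.Holds o x) (hp : (i :: pre).Subperm o) :
    Nat.sub (packL ((cells as).map (counter o pre x))) (agreeMask i (x i) as) =
      packL ((cells as).map (counter o (i :: pre) x)) := by
  have hcons : ∀ (a : Averager) (c : ℕ), agree (i :: pre) a.mask x c =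
      agree pre a.mask x c + (a.mask.testBit i && (x i == c.testBit i)).toNat := by
    intro a c
    rw [agree, List.countP_cons, agree]
    cases a.mask.testBit i && (x i == c.testBit i) <;> rfl
  change packL ((cells as).map (counter o pre x)) - agreeMask i (x i) as = _
  rw [agreeMask_eq, packL_map_sub]
  · congr 1
    refine List.map_congr_left ?_
    rintro ⟨a, _ | c⟩ _
    · rfl
    · rw [counter, counter, hcons, agreeAt]
      omega
  · rintro ⟨a, _ | c⟩ hpc
    · exact le_rfl
    · have h1 := (h a (mem_cells hpc).1).agree_le hp c
      have h2 := hcons a c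
      simp only [counter, agreeAt]
      omega

/-- The packed initial counters, reduced by the known bits at the coordinates `pre`. -/
noncomputable def start (o : List ℕ) (as : List Averager) (pre : List ℕ) : List Bool → ℕ :=
  List.rec (fun _ => packConst (fun a => 128 + size o a.mask - a.β) as)
    (fun i _ ih bits => List.casesOn bits 0 fun b bs =>
      Nat.sub (ih bs) (cond b (agreeMask i true as) (agreeMask i false as))) pre

theorem cond_agreeMask (i : ℕ) (b : Bool) (as : List Averager) :
    cond b (agreeMask i true as) (agreeMask i false as) = agreeMask i b as := by
  cases b <;> rfl

theorem start_eq {as : List Averager} {o pre : List ℕ} {x : ℕ → Bool}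
    (h : ∀ a ∈ as, a.Holds o x) (hp : pre.Subperm o) :
    start o as pre (pre.map x) = packL ((cells as).map (counter o pre x)) := by
  induction pre with
  | nil => exact packConst_eq _ as
  | cons i pre ih =>
    change Nat.sub (start o as pre (pre.map x)) (cond (x i) _ _) = _
    rw [ih ((List.sublist_cons_self i pre).subperm.trans hp), cond_agreeMask, counter_cons h hp]

/-- The search through all values at the coordinates of `steps`, a step being the flag that the
value is known to be zero and the two packed masks. Pruned branches count as successful. -/
noncomputable def tree (H D K : ℕ) (leaf : List Bool → Bool)
    (steps : List (Bool × ℕ × ℕ)) : ℕ → List Bool → Bool :=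
  List.rec (fun _ bits => leaf bits) (fun s _ ih W bits =>
    Bool.rec (motive := fun _ => Bool) false
      (Bool.rec (motive := fun _ => Bool)
        (Bool.rec (motive := fun _ => Bool) (ih (Nat.sub W s.2.2) (true :: bits)) true
          (dead H D K (Nat.sub W s.2.2)))
        true s.1)
      (Bool.rec (motive := fun _ => Bool) (ih (Nat.sub W s.2.1) (false :: bits)) true
        (dead H D K (Nat.sub W s.2.1)))) steps

theorem tree_cons (H D K : ℕ) (leaf : List Bool → Bool) (s : Bool × ℕ × ℕ)
    (steps : List (Bool × ℕ × ℕ)) (W : ℕ) (bits : List Bool) :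
    tree H D K leaf (s :: steps) W bits =
      ((dead H D K (Nat.sub W s.2.1) || tree H D K leaf steps (Nat.sub W s.2.1) (false :: bits)) &&
        (s.1 || (dead H D K (Nat.sub W s.2.2) ||
          tree H D K leaf steps (Nat.sub W s.2.2) (true :: bits)))) := by
  change Bool.rec (motive := fun _ => Bool) false
    (Bool.rec (motive := fun _ => Bool)
      (Bool.rec (motive := fun _ => Bool)
        (tree H D K leaf steps (Nat.sub W s.2.2) (true :: bits))
        true (dead H D K (Nat.sub W s.2.2)))
      true s.1)
    (Bool.rec (motive := fun _ => Bool)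
      (tree H D K leaf steps (Nat.sub W s.2.1) (false :: bits))
      true (dead H D K (Nat.sub W s.2.1))) = _
  cases dead H D K (Nat.sub W s.2.1) <;> cases dead H D K (Nat.sub W s.2.2) <;> cases s.1 <;>
    cases tree H D K leaf steps (Nat.sub W s.2.1) (false :: bits) <;> rfl

/-- The search in several stages. A stage consists of averagers and coordinates. -/
noncomputable def run (o : List ℕ) (fix : ℕ → Bool) (leaf : List Bool → Bool)
    (stages : List (List Averager × List ℕ)) : List ℕ → List Bool → Bool :=
  List.rec (fun _ bits => leaf bits) (fun s _ ih pre bits =>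
    tree (packConst (fun _ => 128) s.1) (packConst (fun a => a.β - a.b) s.1)
      (borrow s.1) (ih (s.2.reverse ++ pre))
      (s.2.map fun i => (fix i, agreeMask i false s.1, agreeMask i true s.1))
      (start o s.1 pre bits) bits) stages

theorem tree_sound {as : List Averager} {o : List ℕ} {x : ℕ → Bool} {fix : ℕ → Bool}
    (h : ∀ a ∈ as, a.Holds o x) (hfix : ∀ i, fix i → x i = false)
    {leaf : List Bool → Bool} (cs : List ℕ) {pre : List ℕ} (hp : (cs.reverse ++ pre).Subperm o)
    (ht : tree (packConst (fun _ => 128) as) (packConst (fun a => a.β - a.b) as)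
      (borrow as) leaf
      (cs.map fun i => (fix i, agreeMask i false as, agreeMask i true as))
      (packL ((cells as).map (counter o pre x))) (pre.map x) = true) :
    leaf ((cs.reverse ++ pre).map x) = true := by
  induction cs generalizing pre with
  | nil => exact ht
  | cons i cs ih =>
    rw [List.reverse_cons, List.append_assoc, List.singleton_append] at hp ⊢
    have hp' : (i :: pre).Subperm o := (List.sublist_append_right _ _).subperm.trans hp
    have hd := dead_eq_false h (pre := i :: pre) fun M c => hp'.countP_le _
    apply ih hp
    rw [List.map_cons, tree_cons, Bool.and_eq_true] at ht
    dsimp only at ht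
    rw [← counter_cons h hp'] at hd ⊢
    cases hx : x i
    · rw [hx] at hd
      have ht := ht.1
      rw [hd] at ht
      simpa [hx] using ht
    · rw [hx] at hd
      have ht := ht.2
      rw [hd] at ht
      have hf : fix i = false := by
        by_contra hf
        simp [hfix i (by simpa using hf)] at hx
      rw [hf] at ht
      simpa [hx] using ht

theorem run_sound {o : List ℕ} {x : ℕ → Bool} {fix : ℕ → Bool} (hfix : ∀ i, fix i → x i = false)
    {leaf : List Bool → Bool} (stages : List (List Averager × List ℕ))
    (h : ∀ s ∈ stages, ∀ a ∈ s.1, a.Holds o x) {pre : List ℕ}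
    (hp : ((stages.flatMap Prod.snd).reverse ++ pre).Subperm o)
    (ht : run o fix leaf stages pre (pre.map x) = true) :
    leaf (((stages.flatMap Prod.snd).reverse ++ pre).map x) = true := by
  induction stages generalizing pre with
  | nil => exact ht
  | cons s stages ih =>
    rw [List.flatMap_cons, List.reverse_append, List.append_assoc] at hp ⊢
    apply ih (fun t ht => h t (by simp [ht])) hp
    have hs := h s (by simp)
    have hp' : (s.2.reverse ++ pre).Subperm o :=
      (List.sublist_append_right _ _).subperm.trans hp
    refine tree_sound (leaf := run o fix leaf stages (s.2.reverse ++ pre)) hs hfix s.2 hp' ?_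
    rw [← start_eq hs ((List.sublist_append_right _ _).subperm.trans hp')]
    exact ht

/-! ### Shifts by codewords and messages -/

/-- The sum of a word and a codeword. -/
def shift (x : ℕ → Bool) (c : ℕ) : ℕ → Bool := fun i => x i ^^ c.testBit i

theorem dist_shift (o : List ℕ) (M : ℕ) (x : ℕ → Bool) (c d : ℕ) :
    dist o M (shift x c) d = dist o M x (c ^^^ d) := by
  unfold dist shift
  congr 1
  funext i
  rw [Nat.testBit_xor]
  cases M.testBit i <;> cases x i <;> cases c.testBit i <;> cases d.testBit i <;> rfl

theorem Regular.shift {C : Set ℕ} (hC : IsLinear C) {o : List ℕ} {M β b : ℕ} {x : ℕ → Bool}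
    (h : Regular C o M β b x) {c : ℕ} (hc : c ∈ C) : Regular C o M β b (shift x c) := by
  refine ⟨fun d hd => ?_, fun d hd e he h1 h2 i hi hM => ?_⟩
  · rw [dist_shift]
    exact h.le _ (hC.xor hc hd)
  · rw [dist_shift] at h1 h2
    simpa using h.agree _ (hC.xor hc hd) _ (hC.xor hc he) h1 h2 i hi hM

theorem Regular.perm {C : Set ℕ} {o o' : List ℕ} (ho : o.Perm o') {M β b : ℕ} {x : ℕ → Bool}
    (h : Regular C o M β b x) : Regular C o' M β b x := by
  have hd : ∀ c, dist o' M x c = dist o M x c := fun c => (ho.countP_eq _).symm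
  refine ⟨fun c hc => hd c ▸ h.le c hc, fun c hc d hd' h1 h2 i hi => ?_⟩
  rw [hd] at h1 h2
  exact h.agree c hc d hd' h1 h2 i (ho.mem_iff.2 hi)

/-- The codeword with the given message: bit `j` of the message is the coefficient of the `j`-th
generator. -/
def encode : List ℕ → ℕ → ℕ
  | [], _ => 0
  | r :: rs, m =>
    cond (bitAt m 0) (Nat.xor (encode rs (Nat.div m 2)) r) (encode rs (Nat.div m 2))

theorem encode_cons (r : ℕ) (rs : List ℕ) (m : ℕ) : encode (r :: rs) m =
    if m.testBit 0 then encode rs (m / 2) ^^^ r else encode rs (m / 2) := by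
  rw [encode, bitAt_eq]
  cases m.testBit 0 <;> rfl

theorem encode_mem (rs : List ℕ) (m : ℕ) : encode rs m ∈ coset rs 0 := by
  induction rs generalizing m with
  | nil => simp [encode, coset]
  | cons r rs ih =>
    have h : encode rs (m / 2) ^^^ r ∈ coset rs (0 ^^^ r) :=
      xor_mem_coset (ih _) (v := r) (self_mem_coset rs r)
    simp only [encode_cons, coset, List.mem_append]
    split
    · exact Or.inr h
    · exact Or.inl (ih _)

/-- Whether the word of each pair is one at the coordinate of the pair, and the words of the later
pairs are zero there. -/
def isEchelon : List (ℕ × ℕ) → Bool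
  | [] => true
  | p :: ps => p.2.testBit p.1 && ps.all (fun q => !q.2.testBit p.1) && isEchelon ps

/-- Every coset has a representative that vanishes at the pivots. -/
theorem exists_shift_eq_zero {C : Set ℕ} (hC : IsLinear C) (ps : List (ℕ × ℕ))
    (hmem : ∀ p ∈ ps, p.2 ∈ C) (hps : isEchelon ps) (x : ℕ → Bool) :
    ∃ c ∈ C, (∀ p ∈ ps, shift x c p.1 = false) ∧
      ∀ j, (∀ p ∈ ps, p.2.testBit j = false) → c.testBit j = false := by
  induction ps generalizing x with
  | nil => exact ⟨0, hC.zero, by simp, by simp⟩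
  | cons p ps ih =>
    simp only [isEchelon, Bool.and_eq_true, List.all_eq_true, Bool.not_eq_true'] at hps
    obtain ⟨⟨h1, h2⟩, h3⟩ := hps
    have hex : ∃ e ∈ C, shift x e p.1 = false ∧
        ∀ j, p.2.testBit j = false → e.testBit j = false := by
      cases hx : x p.1
      · exact ⟨0, hC.zero, by simp [shift, hx], by simp⟩
      · exact ⟨p.2, hmem p (by simp), by simp [shift, hx, h1], fun j hj => hj⟩
    obtain ⟨e, he, he1, he2⟩ := hex
    obtain ⟨c, hc, hc1, hc2⟩ := ih (fun q hq => hmem q (by simp [hq])) h3 (shift x e)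
    have hsh : ∀ i, shift x (e ^^^ c) i = shift (shift x e) c i := by
      intro i
      simp only [shift, Nat.testBit_xor]
      cases x i <;> cases e.testBit i <;> cases c.testBit i <;> rfl
    refine ⟨e ^^^ c, hC.xor he hc, ?_, ?_⟩
    · intro q hq
      rw [hsh]
      rcases List.mem_cons.1 hq with rfl | hq
      · have := hc2 q.1 fun r hr => h2 r hr
        simpa [shift, this] using he1
      · exact hc1 q hq
    · intro j hj
      simp [he2 j (hj p (by simp)), hc2 j fun r hr => hj r (by simp [hr])]

/-- The bits of `v`, from bit `0` to bit `k - 1`. -/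
def bitsOf (k v : ℕ) : List Bool := (List.range k).map v.testBit

/-- The number with the given bits. -/
def ofBits : List Bool → ℕ
  | [] => 0
  | b :: l => b.toNat + 2 * ofBits l

theorem testBit_ofBits (l : List Bool) (j : ℕ) : (ofBits l).testBit j = l.getD j false := by
  induction l generalizing j with
  | nil => simp [ofBits]
  | cons b l ih =>
    cases j with
    | zero => cases b <;> simp [ofBits, Nat.testBit_zero]
    | succ j =>
      have h : (b.toNat + 2 * ofBits l) / 2 = ofBits l := by cases b <;> simp; omega
      rw [ofBits, Nat.testBit_succ, h, ih]
      simp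

/-- The data of a tree search for a regular word of the code of length `n` generated by `rows`: the
order of the coordinates, the bounds of regularity, the coordinates `pre` whose bits are given (the
last one first), the stages with their averagers (as lists of messages) and coordinates, and pairs
of a coordinate and a message, at which coordinates the word may be assumed to vanish. -/
structure Search where
  n : ℕ
  rows : List ℕ
  order : List ℕ
  β : ℕ
  b : ℕ
  pre : List ℕ
  stages : List (List (List ℕ) × List ℕ)
  fix : List (ℕ × ℕ)

namespace Search

variable (s : Search)

/-- The pivot coordinates with the corresponding codewords. -/
def fixes : List (ℕ × ℕ) := s.fix.map fun p => (p.1, encode s.rows p.2)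

/-- The coordinates that are known after the search, the last one first. -/
def coords : List ℕ := (s.stages.flatMap Prod.snd).reverse ++ s.pre

/-- The set of all coordinates. -/
def full : ℕ := 2 ^ s.n - 1

/-- The conditions for the search to be correct. -/
def ok : Bool :=
  decide (s.order.length = s.n) && (List.range s.n).all (s.order.contains ·) &&
  s.coords.Nodup && s.coords.all (s.order.contains ·) &&
  decide (s.n < 128) && decide (s.b ≤ s.β) && decide (s.β ≤ 128) &&
  isEchelon s.fixes && s.fixes.all (fun p => s.pre.all fun i => !p.2.testBit i) &&
  s.stages.all fun t => t.1.all fun ms => cutsProper s.order s.full (ms.map (encode s.rows))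

/-- The search from the given bits at the coordinates `s.pre`. -/
noncomputable def exec (leaf : List Bool → Bool) (bits : List Bool) : Bool :=
  run s.order (fun i => s.fix.any fun p => p.1 == i) leaf
    (s.stages.map fun t => (t.1.map fun ms =>
      averager s.order s.rows s.full s.β s.b (ms.map (encode s.rows)), t.2)) s.pre bits

/-- No regular word has the bits of `v` at the coordinates `s.pre`. -/
def Excludes (v : ℕ) : Prop :=
  ∀ x, Regular {c | c ∈ coset s.rows 0} (List.range s.n) s.full s.β s.b x →
    ¬ ∀ j (h : j < s.pre.length), x s.pre[j] = v.testBit j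

variable {s}

theorem perm_of_ok {n : ℕ} {l : List ℕ} (h1 : l.length = n)
    (h2 : ∀ i ∈ List.range n, i ∈ l) : (List.range n).Perm l :=
  (List.subperm_of_subset List.nodup_range h2).perm_of_length_le (by simp [h1])

theorem excludes_of_exec (hs : s.ok) {leaf : List Bool → Bool} {v : ℕ}
    (hv : s.exec leaf (bitsOf s.pre.length v))
    (hleaf : ∀ w x, Regular {c | c ∈ coset s.rows 0} (List.range s.n) s.full s.β s.b x →
      (∀ j (h : j < s.coords.length), x s.coords[j] = w.testBit j) →
      leaf (bitsOf s.coords.length w) = false) : s.Excludes v := by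
  intro x hx hxv
  simp only [ok, Bool.and_eq_true, decide_eq_true_eq, List.all_eq_true, List.contains_iff_mem,
    Bool.not_eq_true'] at hs
  obtain ⟨⟨⟨⟨⟨⟨⟨⟨⟨h1, h2⟩, h3⟩, h4⟩, h5⟩, h6⟩, h7⟩, h8⟩, h9⟩, h10⟩ := hs
  have hC := isLinear_coset s.rows
  have hperm := perm_of_ok h1 h2
  have hmem : ∀ p ∈ s.fixes, p.2 ∈ coset s.rows 0 := by
    intro p hp
    obtain ⟨q, -, rfl⟩ := List.mem_map.1 hp
    exact encode_mem _ _
  obtain ⟨c, hc, hc1, hc2⟩ := exists_shift_eq_zero hC s.fixes hmem h8 x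
  have hy := hx.shift hC hc
  have hpre : s.pre.map (shift x c) = bitsOf s.pre.length v := by
    apply List.ext_getElem (by simp [bitsOf])
    intro j hj hj'
    have hj0 : j < s.pre.length := by simpa using hj
    have := hc2 s.pre[j] fun p hp => h9 p hp _ (List.getElem_mem _)
    simp [bitsOf, shift, this, hxv j hj0]
  have hrun := run_sound (o := s.order) (x := shift x c)
    (fix := fun i => s.fix.any fun p => p.1 == i) (leaf := leaf) (pre := s.pre)
    (stages := s.stages.map fun t => (t.1.map fun ms =>
      averager s.order s.rows s.full s.β s.b (ms.map (encode s.rows)), t.2)) ?_ ?_ ?_ ?_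
  · have he : (s.stages.map fun t => (t.1.map fun ms =>
        averager s.order s.rows s.full s.β s.b (ms.map (encode s.rows)), t.2)).flatMap Prod.snd =
        s.stages.flatMap Prod.snd := by
      rw [List.flatMap_map]
    rw [he] at hrun
    have hl := hleaf (ofBits (s.coords.map (shift x c))) (shift x c) hy ?_
    · have hb : bitsOf s.coords.length (ofBits (s.coords.map (shift x c))) =
          s.coords.map (shift x c) := by
        apply List.ext_getElem (by simp [bitsOf])
        intro j hj hj'
        have hj0 : j < s.coords.length := by simpa using hj'
        simp [bitsOf, testBit_ofBits, hj0]
      rw [hb] at hl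
      rw [show (s.stages.flatMap Prod.snd).reverse ++ s.pre = s.coords from rfl, hl] at hrun
      exact Bool.false_ne_true hrun
    · intro j hj
      simp [testBit_ofBits, hj]
  · intro i hi
    obtain ⟨p, hp, hpi⟩ := List.any_eq_true.1 hi
    have := hc1 (p.1, encode s.rows p.2) (List.mem_map.2 ⟨p, hp, rfl⟩)
    rwa [show p.1 = i by simpa using hpi] at this
  · intro t ht a ha
    obtain ⟨t', ht', rfl⟩ := List.mem_map.1 ht
    obtain ⟨ms, hms, rfl⟩ := List.mem_map.1 ha
    refine (hy.perm hperm).averager_holds hC (fun r hr => mem_coset_of_mem hr) (by omega) h6 h7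
      ?_ (h10 t' ht' ms hms)
    intro d hd
    obtain ⟨m, -, rfl⟩ := List.mem_map.1 hd
    exact encode_mem _ _
  · have he : (s.stages.map fun t => (t.1.map fun ms =>
        averager s.order s.rows s.full s.β s.b (ms.map (encode s.rows)), t.2)).flatMap Prod.snd =
        s.stages.flatMap Prod.snd := by
      rw [List.flatMap_map]
    rw [he]
    exact List.subperm_of_subset h3 h4
  · rw [hpre]
    exact hv

/-- An exhausted search tree. -/
theorem excludes_of_exec_false (hs : s.ok) {v : ℕ}
    (hv : s.exec (fun _ => false) (bitsOf s.pre.length v)) : s.Excludes v :=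
  excludes_of_exec hs hv fun _ _ _ _ => rfl

end Search

/-! ### Automorphisms -/

/-- Mutually inverse permutations `σ` and `τ` of the coordinates that preserve the code. -/
structure IsAut (C : Set ℕ) (n : ℕ) (σ τ : ℕ → ℕ) : Prop where
  lt : ∀ i < n, σ i < n
  lt' : ∀ i < n, τ i < n
  left : ∀ i < n, τ (σ i) = i
  right : ∀ i < n, σ (τ i) = i
  map : ∀ c ∈ C, ∃ d ∈ C, ∀ i < n, d.testBit i = c.testBit (σ i)
  map' : ∀ c ∈ C, ∃ d ∈ C, ∀ i < n, d.testBit i = c.testBit (τ i)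

theorem IsAut.perm {C : Set ℕ} {n : ℕ} {σ τ : ℕ → ℕ} (h : IsAut C n σ τ) :
    ((List.range n).map σ).Perm (List.range n) := by
  refine ((List.subperm_of_subset List.nodup_range ?_).perm_of_length_le (by simp)).symm
  intro i hi
  rw [List.mem_range] at hi
  exact List.mem_map.2 ⟨τ i, List.mem_range.2 (h.lt' i hi), h.right i hi⟩

theorem IsAut.dist_comp {C : Set ℕ} {n : ℕ} {σ τ : ℕ → ℕ} (h : IsAut C n σ τ) {c d : ℕ}
    (hd : ∀ i < n, d.testBit i = c.testBit (τ i)) (x : ℕ → Bool) :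
    dist (List.range n) (2 ^ n - 1) (x ∘ σ) c = dist (List.range n) (2 ^ n - 1) x d := by
  unfold dist
  rw [← h.perm.countP_eq (fun i => Nat.testBit (2 ^ n - 1) i && (x i != d.testBit i)),
    List.countP_map]
  refine List.countP_congr fun i hi => ?_
  rw [List.mem_range] at hi
  simp [hi, h.lt i hi, hd _ (h.lt i hi), h.left i hi]

theorem Regular.comp {C : Set ℕ} {n β b : ℕ} {x : ℕ → Bool}
    (hx : Regular C (List.range n) (2 ^ n - 1) β b x) {σ τ : ℕ → ℕ} (h : IsAut C n σ τ) :
    Regular C (List.range n) (2 ^ n - 1) β b (x ∘ σ) := by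
  refine ⟨fun c hc => ?_, fun c hc d hd h1 h2 i hi hM => ?_⟩
  · obtain ⟨c', hc', h'⟩ := h.map' c hc
    rw [h.dist_comp h']
    exact hx.le c' hc'
  · obtain ⟨c', hc', hcc⟩ := h.map' c hc
    obtain ⟨d', hd', hdd⟩ := h.map' d hd
    rw [h.dist_comp hcc] at h1
    rw [h.dist_comp hdd] at h2
    rw [List.mem_range] at hi
    have := hx.agree c' hc' d' hd' h1 h2 (σ i) (List.mem_range.2 (h.lt i hi))
      (by simp [h.lt i hi])
    rwa [hcc _ (h.lt i hi), hdd _ (h.lt i hi), h.left i hi] at this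

/-- The codeword whose bit `j` is the bit of `c` at the `j`-th entry of the list. -/
def permute (l : List ℕ) (c : ℕ) : ℕ := ofBits (l.map c.testBit)

theorem testBit_permute (l : List ℕ) (c : ℕ) {j : ℕ} (hj : j < l.length) :
    (permute l c).testBit j = c.testBit l[j] := by
  simp [permute, testBit_ofBits, hj]

theorem permute_xor (l : List ℕ) (a b : ℕ) :
    permute l (a ^^^ b) = permute l a ^^^ permute l b := by
  apply Nat.eq_of_testBit_eq
  intro j
  rw [Nat.testBit_xor]
  by_cases hj : j < l.length
  · simp [testBit_permute, hj]
  · simp [permute, testBit_ofBits, hj]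

/-- Whether the permutation of coordinates given by the list maps the generators into the code. The
first coordinates being information positions, a codeword is determined by its residue. -/
def preserves (rows l : List ℕ) : Bool :=
  rows.all fun r => encode rows (permute l r % 2 ^ rows.length) == permute l r

theorem permute_mem {rows l : List ℕ} (h : preserves rows l) {c : ℕ} (hc : c ∈ coset rows 0) :
    permute l c ∈ coset rows 0 := by
  have hC := isLinear_coset rows
  have h0 : permute l 0 = 0 := by simpa using permute_xor l 0 0
  refine IsLinear.coset_subset (C := {c | permute l c ∈ coset rows 0})
    ⟨by simpa [h0] using self_mem_coset rows 0, fun ha hb => ?_⟩ ?_ ?_ hc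
  · simp only [Set.mem_ofPred_eq, permute_xor] at ha hb ⊢
    exact hC.xor ha hb
  · intro r hr
    have := List.all_eq_true.1 h r hr
    rw [beq_iff_eq] at this
    rw [Set.mem_ofPred_eq, ← this]
    exact encode_mem _ _
  · simpa [h0] using self_mem_coset rows 0

/-- Whether two lists describe mutually inverse automorphisms of the code. -/
def autOk (rows : List ℕ) (n : ℕ) (g : List ℕ × List ℕ) : Bool :=
  decide (g.1.length = n) && decide (g.2.length = n) &&
  (List.range n).all (fun i => decide (g.1.getD i n < n) && decide (g.2.getD i n < n) &&
    g.2.getD (g.1.getD i n) n == i && g.1.getD (g.2.getD i n) n == i) &&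
  preserves rows g.1 && preserves rows g.2

theorem isAut_of_autOk {rows : List ℕ} {n : ℕ} {g : List ℕ × List ℕ} (h : autOk rows n g) :
    IsAut {c | c ∈ coset rows 0} n (fun i => g.1.getD i n) fun i => g.2.getD i n := by
  simp only [autOk, Bool.and_eq_true, decide_eq_true_eq, List.all_eq_true, List.mem_range,
    beq_iff_eq] at h
  obtain ⟨⟨⟨⟨h1, h2⟩, h3⟩, h4⟩, h5⟩ := h
  refine ⟨fun i hi => (h3 i hi).1.1.1, fun i hi => (h3 i hi).1.1.2, fun i hi => (h3 i hi).1.2,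
    fun i hi => (h3 i hi).2, fun c hc => ⟨_, permute_mem h4 hc, fun i hi => ?_⟩,
    fun c hc => ⟨_, permute_mem h5 hc, fun i hi => ?_⟩⟩
  · rw [testBit_permute _ _ (by omega)]
    simp [h1, hi]
  · rw [testBit_permute _ _ (by omega)]
    simp [h2, hi]

namespace Search

variable {s : Search}

/-- Excluding all continuations of `v` at further coordinates. -/
theorem excludes_of_split {s' : Search} (hs : s.ok) (h1 : s'.n = s.n) (h2 : s'.rows = s.rows)
    (h3 : s'.β = s.β) (h4 : s'.b = s.b) (h5 : s'.pre = s.coords) (p : ℕ → Bool)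
    (hp : ∀ w, p w → s'.Excludes w) {v : ℕ}
    (hv : s.exec (fun bits => p (ofBits bits)) (bitsOf s.pre.length v)) : s.Excludes v := by
  refine excludes_of_exec hs hv fun w x hx hw => ?_
  by_contra hne
  refine hp _ (by simpa using hne) x (by rw [h1, h2, h3, h4, full, h1]; exact hx) fun j hj => ?_
  have hj' : j < s.coords.length := by rwa [h5] at hj
  simp only [h5]
  rw [hw j hj', testBit_ofBits]
  simp [bitsOf, hj']

/-- Adding a codeword to the pattern `v` if the pattern is non-zero at the given position. -/
def reduce (s : Search) (fs : List (ℕ × ℕ)) (v : ℕ) : ℕ :=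
  fs.foldl (fun v p => if v.testBit p.1 then v ^^^ permute s.pre (encode s.rows p.2) else v) v

theorem Excludes.of_xor {v m : ℕ}
    (h : s.Excludes (v ^^^ permute s.pre (encode s.rows m))) : s.Excludes v := by
  intro x hx hv
  refine h _ (hx.shift (isLinear_coset s.rows) (encode_mem s.rows m)) fun j hj => ?_
  rw [shift, hv j hj, Nat.testBit_xor, testBit_permute _ _ hj]

theorem Excludes.of_reduce {fs : List (ℕ × ℕ)} {v : ℕ} (h : s.Excludes (s.reduce fs v)) :
    s.Excludes v := by
  induction fs generalizing v with
  | nil => exact h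
  | cons p fs ih =>
    rw [reduce, List.foldl_cons] at h
    have h' := ih h
    split at h'
    · exact h'.of_xor
    · exact h'

theorem Excludes.of_aut {g : List ℕ × List ℕ} (hg : autOk s.rows s.n g) {π : List ℕ}
    (hπ : (s.pre.map fun i => g.1.getD i s.n) = π.map fun j => s.pre.getD j s.n)
    (hlt : ∀ j ∈ π, j < s.pre.length) {v : ℕ} (h : s.Excludes (permute π v)) : s.Excludes v := by
  intro x hx hv
  refine h _ (hx.comp (isAut_of_autOk hg)) fun j hj => ?_
  have hlen : π.length = s.pre.length := by simpa using (congrArg List.length hπ).symm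
  have hj' : j < π.length := by omega
  rw [testBit_permute _ _ hj']
  have h1 : (s.pre.map fun i => g.1.getD i s.n)[j]'(by simpa) =
      (π.map fun j => s.pre.getD j s.n)[j]'(by simpa) := by simp only [hπ]
  have h2 := hlt π[j] (List.getElem_mem _)
  rw [List.getElem_map, List.getElem_map] at h1
  rw [Function.comp_apply, h1, ← hv _ h2]
  simp [h2]

/-- The set of the given numbers, as a mask. -/
def maskOf (l : List ℕ) : ℕ := l.foldr (fun v a => a ||| 2 ^ v) 0

theorem testBit_maskOf (l : List ℕ) (v : ℕ) : (maskOf l).testBit v ↔ v ∈ l := by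
  induction l with
  | nil => simp [maskOf]
  | cons w l ih =>
    rw [maskOf, List.foldr_cons, Nat.testBit_or, Bool.or_eq_true, Nat.testBit_two_pow,
      List.mem_cons]
    rw [maskOf] at ih
    rw [ih, decide_eq_true_eq]
    tauto

/-- Whether each pattern of the list is mapped by some automorphism, followed by the addition of
codewords, to a pattern in `acc` or to an earlier one. -/
def reaches (s : Search) (fs : List (ℕ × ℕ)) (πs : List (List ℕ)) : ℕ → List ℕ → Bool
  | _, [] => true
  | acc, v :: l => πs.any (fun π => acc.testBit (s.reduce fs (permute π v))) &&
    reaches s fs πs (acc ||| 2 ^ v) l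

theorem excludes_of_reaches {fs : List (ℕ × ℕ)} {πs : List (List ℕ)}
    (hπ : ∀ π ∈ πs, ∀ v, s.Excludes (permute π v) → s.Excludes v) {acc : ℕ} {l : List ℕ}
    (hacc : ∀ v, acc.testBit v → s.Excludes v) (h : s.reaches fs πs acc l) :
    ∀ v ∈ l, s.Excludes v := by
  induction l generalizing acc with
  | nil => simp
  | cons v l ih =>
    rw [reaches, Bool.and_eq_true, List.any_eq_true] at h
    obtain ⟨⟨π, hmem, hv⟩, h⟩ := h
    have hv := hπ π hmem v (hacc _ hv).of_reduce
    refine List.forall_mem_cons.2 ⟨hv, ih (fun w hw => ?_) h⟩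
    rw [Nat.testBit_or, Bool.or_eq_true, Nat.testBit_two_pow, decide_eq_true_eq] at hw
    rcases hw with hw | rfl
    · exact hacc w hw
    · exact hv

/-- Whether the positions `π` describe how the automorphism acts on the coordinates `s.pre`. -/
def actsBy (s : Search) (g : List ℕ × List ℕ) (π : List ℕ) : Bool :=
  autOk s.rows s.n g && π.all (fun j => decide (j < s.pre.length)) &&
  (s.pre.map fun i => g.1.getD i s.n) == π.map fun j => s.pre.getD j s.n

theorem Excludes.of_actsBy {g : List ℕ × List ℕ} {π : List ℕ} (h : s.actsBy g π) {v : ℕ}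
    (hv : s.Excludes (permute π v)) : s.Excludes v := by
  simp only [actsBy, Bool.and_eq_true, List.all_eq_true, decide_eq_true_eq, beq_iff_eq] at h
  exact hv.of_aut h.1.1 h.2 h.1.2

/-- The search through the values at the first `k` coordinates only, without pruning. -/
def head (s : Search) (k : ℕ) : Search :=
  { s with stages := [([], ((s.stages.headD ([], [])).2.take k))] }

/-- The search from given values at the first `k` further coordinates. -/
def tail (s : Search) (k : ℕ) : Search :=
  let t := s.stages.headD ([], [])
  let pre := (t.2.take k).reverse ++ s.pre
  { s with
    pre := pre
    stages := (t.1, t.2.drop k) :: s.stages.tail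
    fix := s.fix.filter fun p => !pre.contains p.1 }

/-- Whether the searches from all patterns in the list are exhausted. -/
noncomputable def exhausts (s : Search) (l : List ℕ) : Bool :=
  l.all fun v => s.exec (fun _ => false) (bitsOf s.pre.length v)

theorem excludes_of_exhausts (hs : s.ok) {l : List ℕ} (h : s.exhausts l) : ∀ v ∈ l, s.Excludes v :=
  fun v hv => excludes_of_exec_false hs (List.all_eq_true.1 h v hv)

/-- The search can be split after `k` coordinates, `l` being the patterns that occur there. -/
theorem excludes_of_head_tail {k : ℕ} (hs : (s.head k).ok) {l : List ℕ}
    (hl : ∀ w ∈ l, (s.tail k).Excludes w) {v : ℕ}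
    (hv : (s.head k).exec (fun bits => l.contains (ofBits bits)) (bitsOf s.pre.length v)) :
    s.Excludes v := by
  refine excludes_of_split (s := s.head k) (s' := s.tail k) hs rfl rfl rfl rfl ?_ l.contains ?_ hv
  · simp [head, tail, coords]
  · intro w hw
    exact hl w (by simpa using hw)

/-- Without given coordinates, excluding all patterns of the search means that there is no regular
word. -/
theorem not_regular_of_excludes (h : s.Excludes 0) (hpre : s.pre = []) {x : ℕ → Bool} :
    ¬ Regular {c | c ∈ coset s.rows 0} (List.range s.n) s.full s.β s.b x := fun hx =>
  h x hx fun j hj => by simp [hpre] at hj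

end Search

/-! ### The `[65, 12]` code has no regular words -/

/-- Generators of the `[65, 12]` code, the last row of its generator matrix first. The columns are
read from right to left, so that the first twelve bits are information positions. -/
def rows65 : List ℕ := [
  0x7fffff001,
  0x3fff80ffff002,
  0x1fc0078f00ff004,
  0x3e3c079bf0f3f008,
  0xe5cf8a80f303010,
  0x31fc1f111154c020,
  0x53bd60b037244040,
  0xd60c688651e17080,
  0x1e87681ad0b821100,
  0x84e3026983ef1200,
  0x148c1234df9063400,
  0x10806c8e9ea2f2800]

/-- The search for regular words of the `[65, 12]` code. -/
def search65 : Search where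
  n := 65
  rows := rows65
  order :=
    [46, 35, 26, 12, 56, 32, 14, 57, 11, 36, 1, 33, 3, 24, 25, 13, 29, 23, 49, 53, 0, 7, 63,
    55, 64, 34, 18, 61, 22, 9, 8, 39, 21, 40, 41, 45, 10, 28, 54, 5, 42, 2, 43, 20, 37, 60,
    44, 47, 52, 38, 58, 50, 31, 16, 59, 62, 48, 27, 19, 4, 15, 30, 51, 6, 17]
  β := 27
  b := 15
  pre := []
  stages := [
    (
      [[368, 1280, 1989, 225, 1060], [84, 181, 768, 1060]],
      [46, 35, 26, 12, 56, 32, 14, 57, 11, 36, 1, 33, 3, 24, 25, 13, 29, 23, 49, 53]),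
    (
      [[84, 768, 1060], [84, 181, 1828], [84, 1828]],
      [0, 7, 63, 55, 64, 34, 18, 61, 22]),
    (
      [[84, 181, 1060], [84, 1060], [84, 949], [84, 181]],
      [9, 8, 39, 21, 40, 41, 45, 10, 28]),
    (
      [[84], [225, 768, 1136], [768, 1136], [949, 1221], [225, 1904], [1904], []],
      [54, 5, 42, 2, 43, 20, 37, 60, 44, 47, 52, 38, 58, 50, 31, 16, 59, 62, 48, 27, 19, 4,
      15, 30, 51, 6, 17])]
  fix :=
    [(46, 2), (35, 4), (26, 1), (56, 12), (14, 18), (11, 2051), (1, 62), (25, 292), (0, 181),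
    (55, 768), (9, 1828), (2, 84)]

theorem not_regular65 (x : ℕ → Bool) :
    ¬ Regular {c | c ∈ coset rows65 0} (List.range 65) (2 ^ 65 - 1) 27 15 x := by
  have hok : search65.ok := by decide +kernel
  have h : search65.exhausts [0] := by decide +kernel
  exact Search.not_regular_of_excludes (Search.excludes_of_exhausts hok h 0 (by simp)) rfl

/-! ### The `[64, 12]` code has no regular words -/

/-- Generators of the `[64, 12]` code, the last row of its generator matrix first. The columns are
read from right to left, so that the first twelve bits are information positions. -/
def rows64 : List ℕ := [
  0x7fffff001,
  0x3ffff800fff002,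
  0x7c1fff83f03f004,
  0xbc6007bc33c3008,
  0x34c83f9fdf4dc010,
  0x57d0479cc482c020,
  0x109f9a54d555040,
  0x700ad8c606f33080,
  0xf80c0a4f436e8100,
  0xac4ac80bf032b200,
  0xbc2640c43d3b8400,
  0xc6e1248d86de800]

/-- The search for regular words of the `[64, 12]` code. -/
def search64 : Search where
  n := 64
  rows := rows64
  order :=
    [48, 45, 37, 4, 3, 40, 5, 6, 42, 36, 57, 55, 2, 56, 52, 1, 9, 11, 54, 16, 26, 20, 63, 59,
    50, 22, 33, 25, 39, 46, 49, 14, 31, 0, 43, 62, 51, 15, 19, 24, 13, 12, 23, 10, 58, 53, 21,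
    34, 17, 8, 41, 35, 28, 27, 29, 47, 7, 44, 18, 30, 32, 60, 61, 38]
  β := 26
  b := 14
  pre := [1, 52, 56, 2, 55, 57, 36, 42, 6, 5, 40, 3, 4, 37, 45, 48]
  stages := [
    (
      [[129, 1281], [256, 1152], [66, 1408], [1408]],
      [9, 11, 54, 16, 26, 20, 63, 59, 50, 22, 33, 25, 39, 46, 49, 14, 31, 0, 43, 62, 51, 15,
      19, 24]),
    (
      [[129, 256], [129], [36, 192]],
      [13, 12, 23, 10, 58, 53, 21, 34, 17, 8, 41, 35]),
    (
      [[20, 1672], [656, 1036], [20, 1422], [85, 182], [1484], [168, 1036], [413, 1036],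
      [256], [1025], []],
      [28, 27, 29, 47, 7, 44, 18, 30, 32, 60, 61, 38])]
  fix :=
    [(9, 512), (11, 2048), (16, 1), (63, 256), (39, 129), (13, 1408)]

/-- An automorphism that preserves `search64.pre`, with its inverse. -/
def aut64a : List ℕ × List ℕ := (
    [63, 57, 2, 52, 40, 4, 3, 35, 32, 29, 0, 46, 31, 16, 62, 26, 13, 18, 12, 47, 54, 21, 22,
    53, 10, 15, 27, 25, 61, 8, 39, 17, 9, 41, 59, 43, 56, 1, 49, 30, 48, 34, 37, 58, 38, 45,
    50, 19, 5, 51, 60, 44, 55, 20, 23, 6, 36, 42, 7, 33, 11, 28, 14, 24],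
    [10, 37, 2, 6, 5, 48, 55, 58, 29, 32, 24, 60, 18, 16, 62, 25, 13, 31, 17, 47, 53, 21, 22,
    54, 63, 27, 15, 26, 61, 9, 39, 12, 8, 59, 41, 7, 56, 42, 44, 30, 4, 33, 57, 35, 51, 45,
    11, 19, 40, 38, 46, 49, 3, 23, 20, 52, 36, 1, 43, 34, 50, 28, 14, 0])

/-- An automorphism that preserves `search64.pre`, with its inverse. -/
def aut64b : List ℕ × List ℕ := (
    [39, 36, 2, 48, 40, 1, 56, 12, 61, 33, 35, 44, 60, 50, 53, 32, 34, 41, 51, 7, 49, 62, 18,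
    29, 11, 25, 19, 63, 26, 27, 14, 21, 23, 9, 13, 16, 3, 4, 20, 22, 52, 59, 37, 46, 31, 5,
    54, 8, 45, 47, 10, 58, 55, 43, 30, 42, 57, 6, 0, 17, 28, 38, 24, 15],
    [58, 5, 2, 36, 37, 45, 57, 19, 47, 33, 50, 24, 7, 34, 30, 63, 35, 59, 22, 26, 38, 31, 39,
    32, 62, 25, 28, 29, 60, 23, 54, 44, 15, 9, 16, 10, 1, 42, 61, 0, 4, 17, 55, 53, 11, 48,
    43, 49, 3, 20, 13, 18, 40, 14, 46, 52, 6, 56, 51, 41, 12, 8, 21, 27])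

/-- Patterns at the coordinates `search64.pre` that represent all patterns up to automorphisms and
the addition of codewords. -/
def reps64 : List ℕ :=
    [0, 6232, 8, 2625, 6738, 2690, 6224, 522, 4826, 6805, 4753, 212, 2642, 6721, 6786, 2698,
    6857, 6813, 2591, 730, 4618, 4767, 6874, 594] ++ [4738, 2709, 4182, 6855] ++ [6796, 6868]
    ++ [2778, 6666] ++ [4748, 2583] ++ [6860] ++ [6852]

set_option maxHeartbeats 0 in
theorem excludes_reps64 : ∀ v ∈ reps64, search64.Excludes v := by
  have hok : search64.ok := by decide +kernel
  have h1 : search64.exhausts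
      [0, 6232, 8, 2625, 6738, 2690, 6224, 522, 4826, 6805, 4753, 212, 2642, 6721, 6786,
      2698, 6857, 6813, 2591, 730, 4618, 4767, 6874, 594] := by decide +kernel
  have h2 : search64.exhausts
      [4738, 2709, 4182, 6855] := by decide +kernel
  have h3 : search64.exhausts
      [6796, 6868] := by decide +kernel
  have h4 : search64.exhausts
      [2778, 6666] := by decide +kernel
  have h5 : search64.exhausts
      [4748, 2583] := by decide +kernel
  have h6 : search64.exhausts
      [6860] := by decide +kernel
  have hhead : (search64.head 9).ok := by decide +kernel
  have htail : (search64.tail 9).ok := by decide +kernel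
  have e1 : search64.Excludes 6852 := by
    have h1 : (search64.tail 9).exhausts
        [3508224, 3508225, 3508226, 3508227, 3508232, 3508233, 3508234, 3508235, 3508240,
        3508241, 3508242, 3508243, 3508248, 3508249, 3508250, 3508251] := by decide +kernel
    have h2 : (search64.tail 9).exhausts
        [3508288, 3508289, 3508290, 3508291, 3508296, 3508297, 3508298, 3508299, 3508304,
        3508305, 3508306, 3508307, 3508312] := by decide +kernel
    have h3 : (search64.tail 9).exhausts
        [3508313] := by decide +kernel
    have h4 : (search64.tail 9).exhausts
        [3508314, 3508315] := by decide +kernel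
    refine Search.excludes_of_head_tail hhead (l :=
      [3508224, 3508225, 3508226, 3508227, 3508232, 3508233, 3508234, 3508235, 3508240,
      3508241, 3508242, 3508243, 3508248, 3508249, 3508250, 3508251] ++ [3508288, 3508289,
      3508290, 3508291, 3508296, 3508297, 3508298, 3508299, 3508304, 3508305, 3508306,
      3508307, 3508312] ++ [3508313] ++ [3508314, 3508315]) ?_ (by decide +kernel)
    intro w hw
    simp only [List.mem_append, or_assoc] at hw
    rcases hw with hw | hw | hw | hw
    · exact Search.excludes_of_exhausts htail h1 w hw
    · exact Search.excludes_of_exhausts htail h2 w hw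
    · exact Search.excludes_of_exhausts htail h3 w hw
    · exact Search.excludes_of_exhausts htail h4 w hw
  intro v hv
  simp only [reps64, List.mem_append, or_assoc] at hv
  rcases hv with hv | hv | hv | hv | hv | hv | hv
  · exact Search.excludes_of_exhausts hok h1 v hv
  · exact Search.excludes_of_exhausts hok h2 v hv
  · exact Search.excludes_of_exhausts hok h3 v hv
  · exact Search.excludes_of_exhausts hok h4 v hv
  · exact Search.excludes_of_exhausts hok h5 v hv
  · exact Search.excludes_of_exhausts hok h6 v hv
  · simp only [List.mem_cons, List.not_mem_nil, or_false] at hv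
    exact hv ▸ e1

/-- The other patterns that are reduced with respect to the information positions among the
coordinates `search64.pre`, each following one to which it is equivalent. -/
def patterns64 : List ℕ :=
    [25, 200, 208, 210, 219, 512, 520, 539, 602, 720, 2119, 2184, 2191, 2193, 2200, 2201,
    2248, 2627, 2628, 2630, 2707, 2708, 4096, 4098, 4104, 4105, 4106, 4119, 4120, 4121, 4123,
    4166, 4180, 4226, 4234, 4237, 4251, 4288, 4290, 4297, 4301, 4305, 4307, 4315, 4608, 4612,
    4620, 4625, 4632, 4633, 4737, 4745, 4809, 4811, 4812, 4816, 4817, 4819, 6171, 6225, 6233,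
    6273, 6280, 6282, 6288, 6290, 6294, 6302, 6350, 6353, 6658, 6659, 6672, 6680, 6682, 6723,
    6724, 6729, 6734, 6745, 6746, 6747, 6750, 6784, 6785, 6792, 6800, 6801, 6802, 6803, 6804,
    6815, 6848, 6856, 6858, 6859, 6862, 6867, 6875, 6876, 6877, 1, 9, 23, 31, 64, 67, 72, 73,
    128, 136, 147, 199, 202, 203, 207, 217, 513, 515, 518, 521, 523, 529, 535, 537, 543, 576,
    577, 578, 579, 586, 595, 641, 642, 658, 660, 669, 705, 712, 713, 714, 715, 721, 725, 727,
    729, 731, 734, 735, 2048, 2049, 2056, 2058, 2062, 2065, 2073, 2113, 2115, 2117, 2120,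
    2123, 2128, 2129, 2135, 2138, 2179, 2182, 2203, 2205, 2207, 2249, 2257, 2261, 2265, 2266,
    2626, 2631, 2638, 2646, 2647, 2650, 2652, 2654, 2694, 2696, 2705, 2706, 2710, 2712, 2714,
    2719, 2755, 2758, 2763, 2769, 2773, 2780, 4100, 4103, 4107, 4111, 4116, 4118, 4122, 4124,
    4125, 4127, 4163, 4169, 4176, 4190, 4224, 4232, 4233, 4238, 4241, 4246, 4247, 4248, 4249,
    4250, 4253, 4289, 4292, 4299, 4300, 4302, 4304, 4306, 4308, 4309, 4310, 4312, 4313, 4318,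
    4614, 4616, 4619, 4623, 4624, 4628, 4631, 4635, 4636, 4639, 4673, 4676, 4678, 4680, 4681,
    4682, 4683, 4686, 4688, 4689, 4693, 4696, 4697, 4698, 4699, 4701, 4749, 4750, 4751, 4757,
    4759, 4761, 4762, 4763, 4765, 4800, 4801, 4802, 4804, 4805, 4810, 4814, 4818, 4821, 4824,
    4827, 6168, 6169, 6173, 6208, 6209, 6210, 6215, 6216, 6218, 6228, 6231, 6235, 6239, 6277,
    6278, 6283, 6287, 6289, 6293, 6295, 6296, 6300, 6303, 6338, 6343, 6345, 6348, 6349, 6351,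
    6352, 6354, 6355, 6357, 6359, 6363, 6366, 6656, 6661, 6663, 6664, 6667, 6668, 6674, 6676,
    6677, 6681, 6686, 6722, 6726, 6727, 6728, 6730, 6732, 6735, 6737, 6743, 6744, 6749, 6787,
    6788, 6790, 6791, 6797, 6799, 6806, 6808, 6809, 6812, 6814, 6851, 6853, 6854, 6861, 6863,
    6864, 6869, 6871, 6873, 6878, 6879, 2, 4, 10, 11, 12, 14, 16, 18, 19, 24, 26, 29, 65, 66,
    81, 82, 83, 88, 89, 90, 130, 131, 133, 138, 141, 142, 144, 146, 149, 152, 193, 198, 201,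
    204, 205, 206, 211, 215, 218, 220, 222, 223, 514, 516, 517, 519, 525, 526, 527, 528, 530,
    531, 534, 541, 542, 582, 583, 584, 585, 590, 591, 593, 598, 599, 601, 603, 604, 605, 606,
    607, 640, 643, 644, 645, 646, 649, 654, 655, 656, 657, 659, 661, 667, 668, 704, 706, 707,
    711, 718, 719, 726, 732, 2050, 2054, 2055, 2057, 2061, 2064, 2067, 2068, 2069, 2071, 2072,
    2074, 2075, 2076, 2079, 2112, 2116, 2118, 2121, 2122, 2124, 2125, 2126, 2131, 2133, 2136,
    2139, 2180, 2183, 2185, 2186, 2188, 2190, 2192, 2194, 2196, 2197, 2198, 2202, 2204, 2206,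
    2240, 2241, 2243, 2246, 2247, 2250, 2251, 2254, 2255, 2256, 2259, 2262, 2267, 2269, 2270,
    2560, 2561, 2568, 2570, 2572, 2573, 2575, 2576, 2577, 2578, 2581, 2584, 2585, 2586, 2587,
    2588, 2590, 2624, 2632, 2633, 2634, 2635, 2636, 2637, 2639, 2640, 2641, 2643, 2644, 2645,
    2648, 2651, 2653, 2688, 2689, 2692, 2693, 2695, 2704, 2713, 2752, 2756, 2759, 2762, 2764,
    2766, 2767, 2768, 2771, 2772, 2775, 2782, 2783, 4097, 4102, 4108, 4109, 4110, 4112, 4113,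
    4114, 4115, 4126, 4160, 4161, 4165, 4167, 4170, 4171, 4173, 4174, 4175, 4177, 4178, 4181,
    4183, 4184, 4185, 4187, 4188, 4189, 4191, 4225, 4227, 4228, 4230, 4231, 4235, 4236, 4240,
    4242, 4243, 4244, 4252, 4254, 4255, 4293, 4294, 4295, 4296, 4311, 4314, 4316, 4317, 4610,
    4613, 4617, 4621, 4622, 4626, 4627, 4629, 4634, 4637, 4638, 4679, 4684, 4685, 4690, 4691,
    4692, 4694, 4700, 4702, 4703, 4736, 4739, 4740, 4741, 4743, 4744, 4747, 4756, 4758, 4760,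
    4764, 4766, 4803, 4807, 4820, 4823, 4825, 4830, 4831, 6144, 6146, 6149, 6150, 6152, 6153,
    6154, 6155, 6156, 6157, 6158, 6159, 6160, 6162, 6163, 6164, 6165, 6166, 6167, 6172, 6174,
    6211, 6212, 6217, 6219, 6221, 6222, 6223, 6227, 6229, 6230, 6236, 6237, 6272, 6275, 6279,
    6284, 6285, 6286, 6291, 6292, 6297, 6336, 6337, 6339, 6340, 6341, 6346, 6347, 6360, 6361,
    6365, 6657, 6660, 6662, 6669, 6670, 6671, 6673, 6675, 6678, 6679, 6683, 6684, 6685, 6687,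
    6720, 6733, 6736, 6740, 6742, 6748, 6751, 6789, 6793, 6794, 6795, 6807, 6810, 6850, 6870,
    3, 5, 6, 7, 13, 15, 17, 20, 21, 27, 28, 30, 68, 70, 71, 74, 75, 76, 77, 78, 79, 80, 84,
    85, 86, 87, 92, 94, 95, 129, 132, 134, 135, 139, 140, 143, 145, 151, 154, 155, 156, 158,
    159, 192, 194, 195, 197, 209, 214, 216, 221, 524, 533, 536, 538, 540, 580, 581, 587, 588,
    589, 592, 596, 597, 600, 648, 650, 652, 653, 663, 664, 665, 666, 670, 671, 710, 716, 717,
    722, 723, 728, 733, 2051, 2052, 2059, 2060, 2063, 2070, 2077, 2078, 2114, 2127, 2130,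
    2132, 2134, 2137, 2140, 2141, 2142, 2143, 2176, 2177, 2178, 2181, 2187, 2189, 2195, 2199,
    2242, 2244, 2252, 2253, 2258, 2260, 2264, 2268, 2271, 2562, 2564, 2565, 2566, 2567, 2569,
    2571, 2574, 2580, 2582, 2589, 2629, 2649, 2655, 2691, 2697, 2699, 2701, 2702, 2703, 2715,
    2716, 2717, 2718, 2754, 2760, 2761, 2765, 2770, 2774, 2776, 2777, 2779, 4099, 4101, 4117,
    4162, 4164, 4168, 4172, 4179, 4186, 4229, 4239, 4245, 4291, 4298, 4303, 4319, 4609, 4611,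
    4615, 4630, 4672, 4674, 4675, 4677, 4687, 4695, 4742, 4746, 4752, 4754, 4755, 4806, 4813,
    4815, 4822, 4829, 6145, 6147, 6148, 6151, 6161, 6170, 6175, 6213, 6214, 6234, 6238, 6274,
    6276, 6281, 6298, 6299, 6301, 6342, 6356, 6358, 6362, 6367, 6665, 6725, 6741, 6798, 6849,
    6865, 6866, 6872, 22, 69, 91, 93, 137, 148, 150, 153, 157, 196, 532, 647, 651, 662, 708,
    709, 724, 2053, 2066, 2245, 2263, 2563, 2579, 2700, 2711, 2753, 2757, 2781, 4828, 6220,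
    6226, 6344, 6364, 6731, 6739, 6811, 213, 4808]

theorem excludes_patterns64 : ∀ v ∈ patterns64, search64.Excludes v := by
  refine Search.excludes_of_reaches (acc := Search.maskOf reps64)
    (fs :=
      [(15, 2), (14, 16), (13, 8), (10, 32), (8, 66), (5, 6)])
    (πs := [
      [5, 4, 6, 3, 8, 7, 2, 13, 11, 12, 15, 1, 10, 0, 14, 9],
      [6, 4, 5, 3, 7, 8, 11, 13, 2, 0, 1, 15, 10, 12, 9, 14]]) ?_
    (fun v hv => excludes_reps64 v ((Search.testBit_maskOf _ _).1 hv)) (by decide +kernel)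
  intro π hπ v hv
  simp only [List.mem_cons, List.not_mem_nil, or_false] at hπ
  rcases hπ with rfl | rfl
  · exact hv.of_actsBy (g := aut64a) (by decide +kernel)
  · exact hv.of_actsBy (g := aut64b) (by decide +kernel)

/-- The search through the patterns at the coordinates that `search64` starts from. -/
def prefix64 : Search :=
  { search64 with
    pre := []
    stages := [([], search64.pre.reverse)]
    fix := [(48, 2), (45, 16), (37, 8), (40, 32), (6, 66), (57, 6)] }

theorem not_regular64 (x : ℕ → Bool) :
    ¬ Regular {c | c ∈ coset rows64 0} (List.range 64) (2 ^ 64 - 1) 26 14 x := by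
  refine Search.not_regular_of_excludes (s := prefix64) ?_ rfl
  refine Search.excludes_of_split (s := prefix64) (s' := search64) (v := 0)
    (by decide +kernel) rfl rfl rfl rfl (by rfl)
    (Search.maskOf (reps64 ++ patterns64)).testBit (fun w hw => ?_) (by decide +kernel)
  rw [Search.testBit_maskOf, List.mem_append] at hw
  exact hw.elim (excludes_reps64 w) (excludes_patterns64 w)

/-! ### The `[63, 12]` code has no regular words -/

/-- Generators of the `[63, 12]` code, the last row of its generator matrix first. The columns are
read from right to left, so that the first twelve bits are information positions. -/
def rows63 : List ℕ := [
  0x7fffff001,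
  0x3fff8000ff002,
  0x7c1ff803f03004,
  0xf8c6018fc30f008,
  0x11bd87e00cc3c010,
  0x278fa8691ddff020,
  0xc6f1a7722f0040,
  0x6382e7b0e4614080,
  0x23fe661322341100,
  0x9dc7b90861b4200,
  0x53f81ba1346c0400,
  0x18703e87f2521800]

/-- The search for regular words of the `[63, 12]` code. -/
def search63 : Search where
  n := 63
  rows := rows63
  order :=
    [54, 38, 31, 21, 29, 14, 42, 39, 20, 40, 28, 61, 48, 2, 11, 10, 19, 22, 60, 4, 17, 51, 8,
    30, 25, 0, 53, 23, 7, 62, 16, 24, 44, 5, 36, 56, 26, 1, 59, 6, 18, 45, 52, 27, 33, 50, 9,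
    41, 34, 58, 43, 35, 37, 47, 57, 3, 12, 15, 55, 46, 49, 13, 32]
  β := 25
  b := 13
  pre := [11, 2, 48, 61, 28, 40, 20, 39, 42, 14, 29, 21, 31, 38, 54]
  stages := [
    (
      [[170, 584], [363, 584], [74, 514], [107, 547], [330, 584], [584]],
      [10, 19, 22, 60, 4, 17, 51, 8, 30, 25, 0, 53, 23, 7, 62, 16, 24, 44, 5, 36, 56, 26, 1,
      59]),
    (
      [[170, 803], [15, 38], [170]],
      [6, 18, 45, 52, 27, 33, 50, 9, 41, 34, 58, 43]),
    (
      [[65, 2233], [65, 2060], [99, 2105], [41, 839], [1065], [3016], [803], [449], [1385],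
      []],
      [35, 37, 47, 57, 3, 12, 15, 55, 46, 49, 13, 32])]
  fix :=
    [(10, 1088), (19, 9), (60, 27), (51, 363), (23, 170), (6, 584)]

/-- An automorphism that preserves `search63.pre`, with its inverse. -/
def aut63a : List ℕ × List ℕ := (
    [60, 49, 28, 56, 1, 6, 44, 47, 7, 34, 50, 40, 23, 19, 14, 59, 25, 32, 3, 30, 42, 31, 18,
    15, 27, 58, 24, 45, 2, 38, 46, 21, 51, 10, 62, 17, 9, 0, 29, 39, 11, 4, 20, 5, 43, 26, 13,
    52, 61, 41, 53, 35, 8, 33, 54, 16, 22, 37, 55, 12, 57, 48, 36],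
    [37, 4, 28, 18, 41, 43, 5, 8, 52, 36, 33, 40, 59, 46, 14, 23, 55, 35, 22, 13, 42, 31, 56,
    12, 26, 16, 45, 24, 2, 38, 19, 21, 17, 53, 9, 51, 62, 57, 29, 39, 11, 49, 20, 44, 6, 27,
    30, 7, 61, 1, 10, 32, 47, 50, 54, 58, 3, 60, 25, 15, 0, 48, 34])

/-- An automorphism that preserves `search63.pre`, with its inverse. -/
def aut63b : List ℕ × List ℕ := (
    [4, 22, 11, 7, 19, 10, 6, 41, 9, 49, 12, 54, 32, 24, 48, 44, 47, 5, 46, 58, 38, 28, 36,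
    17, 60, 37, 57, 16, 14, 20, 1, 61, 15, 53, 52, 23, 34, 13, 40, 31, 21, 30, 2, 51, 50, 25,
    0, 8, 39, 18, 33, 35, 45, 59, 29, 55, 56, 27, 62, 43, 3, 42, 26],
    [46, 30, 42, 60, 0, 17, 6, 3, 47, 8, 5, 2, 10, 37, 28, 32, 27, 23, 49, 4, 29, 40, 1, 35,
    13, 45, 62, 57, 21, 54, 41, 39, 12, 50, 36, 51, 22, 25, 20, 48, 38, 7, 61, 59, 15, 52, 18,
    16, 14, 9, 44, 43, 34, 33, 11, 55, 56, 26, 19, 53, 24, 31, 58])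

/-- Patterns at the coordinates `search63.pre` that represent all patterns up to automorphisms and
the addition of codewords. -/
def reps63 : List ℕ :=
    [0, 2630, 735, 2074, 131, 524, 2060] ++ [221] ++ [2179] ++ [2771] ++ [2783] ++ [2130] ++
    [2572, 2259, 2131, 2125]

set_option maxHeartbeats 0 in
theorem excludes_reps63 : ∀ v ∈ reps63, search63.Excludes v := by
  have hok : search63.ok := by decide +kernel
  have h1 : search63.exhausts
      [0, 2630, 735, 2074, 131, 524, 2060] := by decide +kernel
  have h2 : search63.exhausts
      [221] := by decide +kernel
  have h3 : search63.exhausts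
      [2179] := by decide +kernel
  have h4 : search63.exhausts
      [2771] := by decide +kernel
  have h5 : search63.exhausts
      [2783] := by decide +kernel
  have h6 : search63.exhausts
      [2130] := by decide +kernel
  have hhead : (search63.head 9).ok := by decide +kernel
  have htail : (search63.tail 9).ok := by decide +kernel
  have e1 : search63.Excludes 2572 := by
    have h1 : (search63.tail 9).exhausts
        [1316864, 1316865, 1316866, 1316867, 1316872, 1316873, 1316874, 1316875, 1316880,
        1316881, 1316882, 1316883, 1316888, 1316889, 1316890, 1316891, 1316928, 1316929,
        1316930, 1316931, 1316936, 1316937, 1316938, 1316939, 1316944] := by decide +kernel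
    have h2 : (search63.tail 9).exhausts
        [1316945, 1316946, 1316947, 1316952, 1316953, 1316954, 1316955] := by decide +kernel
    refine Search.excludes_of_head_tail hhead (l :=
      [1316864, 1316865, 1316866, 1316867, 1316872, 1316873, 1316874, 1316875, 1316880,
      1316881, 1316882, 1316883, 1316888, 1316889, 1316890, 1316891, 1316928, 1316929,
      1316930, 1316931, 1316936, 1316937, 1316938, 1316939, 1316944] ++ [1316945, 1316946,
      1316947, 1316952, 1316953, 1316954, 1316955]) ?_ (by decide +kernel)
    intro w hw
    rw [List.mem_append] at hw
    rcases hw with hw | hw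
    · exact Search.excludes_of_exhausts htail h1 w hw
    · exact Search.excludes_of_exhausts htail h2 w hw
  have e2 : search63.Excludes 2259 := by
    have h1 : (search63.tail 9).exhausts
        [1156608, 1156609, 1156610, 1156611, 1156616, 1156617] := by decide +kernel
    have h2 : (search63.tail 9).exhausts
        [1156618, 1156619, 1156624, 1156625, 1156626, 1156627, 1156632] := by decide +kernel
    have h3 : (search63.tail 9).exhausts
        [1156633, 1156634, 1156635, 1156672, 1156673, 1156674, 1156675, 1156680, 1156681,
        1156682] := by decide +kernel
    have h4 : (search63.tail 9).exhausts
        [1156683, 1156688, 1156689, 1156690, 1156691, 1156696, 1156697, 1156698, 1156699] :=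
      by decide +kernel
    refine Search.excludes_of_head_tail hhead (l :=
      [1156608, 1156609, 1156610, 1156611, 1156616, 1156617] ++ [1156618, 1156619, 1156624,
      1156625, 1156626, 1156627, 1156632] ++ [1156633, 1156634, 1156635, 1156672, 1156673,
      1156674, 1156675, 1156680, 1156681, 1156682] ++ [1156683, 1156688, 1156689, 1156690,
      1156691, 1156696, 1156697, 1156698, 1156699]) ?_ (by decide +kernel)
    intro w hw
    simp only [List.mem_append, or_assoc] at hw
    rcases hw with hw | hw | hw | hw
    · exact Search.excludes_of_exhausts htail h1 w hw
    · exact Search.excludes_of_exhausts htail h2 w hw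
    · exact Search.excludes_of_exhausts htail h3 w hw
    · exact Search.excludes_of_exhausts htail h4 w hw
  have e3 : search63.Excludes 2131 := by
    have h1 : (search63.tail 9).exhausts
        [1091072, 1091073, 1091074, 1091075, 1091080] := by decide +kernel
    have h2 : (search63.tail 9).exhausts
        [1091081] := by decide +kernel
    have h3 : (search63.tail 9).exhausts
        [1091082] := by decide +kernel
    have h4 : (search63.tail 9).exhausts
        [1091083, 1091088, 1091089, 1091090] := by decide +kernel
    have h5 : (search63.tail 9).exhausts
        [1091091, 1091096, 1091097] := by decide +kernel
    have h6 : (search63.tail 9).exhausts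
        [1091098] := by decide +kernel
    have h7 : (search63.tail 9).exhausts
        [1091099, 1091136, 1091137, 1091138] := by decide +kernel
    have h8 : (search63.tail 9).exhausts
        [1091139, 1091144] := by decide +kernel
    have h9 : (search63.tail 9).exhausts
        [1091145] := by decide +kernel
    have h10 : (search63.tail 9).exhausts
        [1091146, 1091147, 1091152, 1091153] := by decide +kernel
    have h11 : (search63.tail 9).exhausts
        [1091154, 1091155, 1091160] := by decide +kernel
    have h12 : (search63.tail 9).exhausts
        [1091161] := by decide +kernel
    have h13 : (search63.tail 9).exhausts
        [1091162, 1091163] := by decide +kernel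
    refine Search.excludes_of_head_tail hhead (l :=
      [1091072, 1091073, 1091074, 1091075, 1091080] ++ [1091081] ++ [1091082] ++ [1091083,
      1091088, 1091089, 1091090] ++ [1091091, 1091096, 1091097] ++ [1091098] ++ [1091099,
      1091136, 1091137, 1091138] ++ [1091139, 1091144] ++ [1091145] ++ [1091146, 1091147,
      1091152, 1091153] ++ [1091154, 1091155, 1091160] ++ [1091161] ++ [1091162, 1091163]) ?_
      (by decide +kernel)
    intro w hw
    simp only [List.mem_append, or_assoc] at hw
    rcases hw with hw | hw | hw | hw | hw | hw | hw | hw | hw | hw | hw | hw | hw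
    · exact Search.excludes_of_exhausts htail h1 w hw
    · exact Search.excludes_of_exhausts htail h2 w hw
    · exact Search.excludes_of_exhausts htail h3 w hw
    · exact Search.excludes_of_exhausts htail h4 w hw
    · exact Search.excludes_of_exhausts htail h5 w hw
    · exact Search.excludes_of_exhausts htail h6 w hw
    · exact Search.excludes_of_exhausts htail h7 w hw
    · exact Search.excludes_of_exhausts htail h8 w hw
    · exact Search.excludes_of_exhausts htail h9 w hw
    · exact Search.excludes_of_exhausts htail h10 w hw
    · exact Search.excludes_of_exhausts htail h11 w hw
    · exact Search.excludes_of_exhausts htail h12 w hw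
    · exact Search.excludes_of_exhausts htail h13 w hw
  have e4 : search63.Excludes 2125 := by
    have h1 : (search63.tail 9).exhausts
        [1088000, 1088001, 1088002, 1088003, 1088008] := by decide +kernel
    have h2 : (search63.tail 9).exhausts
        [1088009] := by decide +kernel
    have h3 : (search63.tail 9).exhausts
        [1088010] := by decide +kernel
    have h4 : (search63.tail 9).exhausts
        [1088011, 1088016, 1088017, 1088018] := by decide +kernel
    have h5 : (search63.tail 9).exhausts
        [1088019, 1088024] := by decide +kernel
    have h6 : (search63.tail 9).exhausts
        [1088025] := by decide +kernel
    have h7 : (search63.tail 9).exhausts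
        [1088026] := by decide +kernel
    have h8 : (search63.tail 9).exhausts
        [1088027, 1088064] := by decide +kernel
    have h9 : (search63.tail 9).exhausts
        [1088065] := by decide +kernel
    have h10 : (search63.tail 9).exhausts
        [1088066, 1088067, 1088072] := by decide +kernel
    have h11 : (search63.tail 9).exhausts
        [1088073] := by decide +kernel
    have h12 : (search63.tail 9).exhausts
        [1088074, 1088075, 1088080] := by decide +kernel
    have h13 : (search63.tail 9).exhausts
        [1088081, 1088082, 1088083, 1088088] := by decide +kernel
    have h14 : (search63.tail 9).exhausts
        [1088089] := by decide +kernel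
    have h15 : (search63.tail 9).exhausts
        [1088090, 1088091] := by decide +kernel
    refine Search.excludes_of_head_tail hhead (l :=
      [1088000, 1088001, 1088002, 1088003, 1088008] ++ [1088009] ++ [1088010] ++ [1088011,
      1088016, 1088017, 1088018] ++ [1088019, 1088024] ++ [1088025] ++ [1088026] ++
      [1088027, 1088064] ++ [1088065] ++ [1088066, 1088067, 1088072] ++ [1088073] ++
      [1088074, 1088075, 1088080] ++ [1088081, 1088082, 1088083, 1088088] ++ [1088089] ++
      [1088090, 1088091]) ?_ (by decide +kernel)
    intro w hw
    simp only [List.mem_append, or_assoc] at hw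
    rcases hw with hw | hw | hw | hw | hw | hw | hw | hw | hw | hw | hw | hw | hw | hw | hw
    · exact Search.excludes_of_exhausts htail h1 w hw
    · exact Search.excludes_of_exhausts htail h2 w hw
    · exact Search.excludes_of_exhausts htail h3 w hw
    · exact Search.excludes_of_exhausts htail h4 w hw
    · exact Search.excludes_of_exhausts htail h5 w hw
    · exact Search.excludes_of_exhausts htail h6 w hw
    · exact Search.excludes_of_exhausts htail h7 w hw
    · exact Search.excludes_of_exhausts htail h8 w hw
    · exact Search.excludes_of_exhausts htail h9 w hw
    · exact Search.excludes_of_exhausts htail h10 w hw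
    · exact Search.excludes_of_exhausts htail h11 w hw
    · exact Search.excludes_of_exhausts htail h12 w hw
    · exact Search.excludes_of_exhausts htail h13 w hw
    · exact Search.excludes_of_exhausts htail h14 w hw
    · exact Search.excludes_of_exhausts htail h15 w hw
  intro v hv
  simp only [reps63, List.mem_append, or_assoc] at hv
  rcases hv with hv | hv | hv | hv | hv | hv | hv
  · exact Search.excludes_of_exhausts hok h1 v hv
  · exact Search.excludes_of_exhausts hok h2 v hv
  · exact Search.excludes_of_exhausts hok h3 v hv
  · exact Search.excludes_of_exhausts hok h4 v hv
  · exact Search.excludes_of_exhausts hok h5 v hv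
  · exact Search.excludes_of_exhausts hok h6 v hv
  · simp only [List.mem_cons, List.not_mem_nil, or_false] at hv
    rcases hv with rfl | rfl | rfl | rfl
    · exact e1
    · exact e2
    · exact e3
    · exact e4

/-- The other patterns that are reduced with respect to the information positions among the
coordinates `search63.pre`, each following one to which it is equivalent. -/
def patterns63 : List ℕ :=
    [67, 77, 83, 86, 87, 143, 194, 200, 202, 212, 582, 658, 662, 665, 666, 705, 708, 713, 718,
    721, 726, 729, 734, 2070, 2075, 2112, 2117, 2121, 2124, 2141, 2142, 2183, 2186, 2191,
    2192, 2197, 2253, 2562, 2563, 2571, 2587, 2588, 2625, 2637, 2643, 2651, 2695, 2697, 2704,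
    2706, 2708, 2709, 2710, 2711, 2715, 2716, 2756, 2760, 2762, 2774, 2778, 10, 13, 19, 20,
    21, 28, 64, 74, 75, 79, 135, 196, 198, 199, 204, 211, 523, 576, 583, 586, 588, 590, 591,
    595, 600, 601, 602, 603, 604, 605, 606, 640, 642, 647, 649, 656, 657, 667, 669, 670, 704,
    711, 714, 715, 723, 731, 2061, 2062, 2071, 2078, 2119, 2127, 2128, 2136, 2137, 2140, 2181,
    2187, 2196, 2204, 2205, 2207, 2246, 2263, 2267, 2268, 2561, 2567, 2569, 2573, 2575, 2576,
    2577, 2579, 2580, 2581, 2582, 2583, 2590, 2591, 2628, 2629, 2633, 2641, 2642, 2644, 2646,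
    2647, 2649, 2690, 2691, 2692, 2694, 2698, 2700, 2701, 2703, 2707, 2712, 2714, 2717, 2718,
    2753, 2761, 2763, 2765, 2766, 2773, 2776, 2777, 2779, 2, 6, 11, 14, 16, 24, 29, 30, 31,
    65, 70, 73, 76, 80, 81, 92, 95, 129, 136, 137, 139, 140, 151, 155, 156, 158, 159, 197,
    201, 203, 208, 216, 218, 219, 220, 223, 512, 521, 530, 532, 535, 536, 537, 539, 540, 542,
    543, 577, 578, 579, 581, 592, 593, 594, 597, 598, 644, 646, 648, 652, 653, 659, 660, 661,
    664, 668, 707, 709, 712, 720, 722, 725, 727, 728, 730, 733, 2048, 2049, 2050, 2051, 2052,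
    2054, 2055, 2056, 2066, 2067, 2068, 2072, 2076, 2077, 2079, 2123, 2133, 2135, 2138, 2139,
    2177, 2178, 2180, 2182, 2184, 2185, 2188, 2190, 2193, 2194, 2195, 2198, 2199, 2200, 2201,
    2206, 2240, 2241, 2243, 2245, 2249, 2250, 2252, 2254, 2255, 2256, 2257, 2258, 2260, 2261,
    2266, 2269, 2270, 2566, 2568, 2570, 2574, 2586, 2589, 2627, 2631, 2634, 2635, 2636, 2638,
    2645, 2650, 2652, 2688, 2689, 2693, 2696, 2699, 2702, 2754, 2757, 2759, 2764, 2767, 2768,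
    2770, 2775, 2780, 2781, 2782, 1, 3, 4, 7, 8, 15, 17, 22, 23, 25, 26, 27, 68, 69, 78, 82,
    84, 88, 89, 91, 93, 94, 128, 132, 133, 134, 138, 142, 144, 145, 146, 147, 148, 149, 152,
    153, 157, 193, 205, 206, 207, 209, 210, 213, 214, 215, 217, 222, 513, 514, 515, 517, 518,
    519, 520, 522, 525, 526, 527, 528, 529, 531, 534, 538, 541, 580, 584, 587, 599, 607, 641,
    643, 645, 650, 654, 655, 663, 671, 706, 710, 716, 719, 724, 732, 2053, 2057, 2059, 2063,
    2064, 2065, 2069, 2073, 2113, 2114, 2115, 2116, 2118, 2120, 2122, 2126, 2129, 2134, 2143,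
    2176, 2189, 2202, 2203, 2242, 2244, 2247, 2248, 2251, 2262, 2264, 2265, 2271, 2560, 2564,
    2565, 2578, 2585, 2624, 2626, 2632, 2639, 2640, 2648, 2653, 2654, 2705, 2713, 2719, 2752,
    2755, 2769, 2772, 5, 9, 12, 18, 66, 71, 72, 85, 90, 130, 141, 150, 154, 192, 195, 516,
    533, 585, 589, 596, 651, 717, 2058, 2132, 2584, 2655, 2758]

theorem excludes_patterns63 : ∀ v ∈ patterns63, search63.Excludes v := by
  refine Search.excludes_of_reaches (acc := Search.maskOf reps63)
    (fs :=
      [(14, 4), (13, 2), (12, 1), (10, 70), (8, 34), (5, 2085)])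
    (πs := [
      [5, 4, 3, 2, 1, 0, 8, 7, 6, 9, 13, 12, 11, 10, 14],
      [14, 0, 7, 8, 9, 11, 13, 12, 1, 2, 6, 4, 3, 5, 10]]) ?_
    (fun v hv => excludes_reps63 v ((Search.testBit_maskOf _ _).1 hv)) (by decide +kernel)
  intro π hπ v hv
  simp only [List.mem_cons, List.not_mem_nil, or_false] at hπ
  rcases hπ with rfl | rfl
  · exact hv.of_actsBy (g := aut63a) (by decide +kernel)
  · exact hv.of_actsBy (g := aut63b) (by decide +kernel)

/-- The search through the patterns at the coordinates that `search63` starts from. -/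
def prefix63 : Search :=
  { search63 with
    pre := []
    stages := [([], search63.pre.reverse)]
    fix := [(54, 4), (38, 2), (31, 1), (29, 70), (42, 34), (40, 2085)] }

theorem not_regular63 (x : ℕ → Bool) :
    ¬ Regular {c | c ∈ coset rows63 0} (List.range 63) (2 ^ 63 - 1) 25 13 x := by
  refine Search.not_regular_of_excludes (s := prefix63) ?_ rfl
  refine Search.excludes_of_split (s := prefix63) (s' := search63) (v := 0)
    (by decide +kernel) rfl rfl rfl rfl (by rfl)
    (Search.maskOf (reps63 ++ patterns63)).testBit (fun w hw => ?_) (by decide +kernel)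
  rw [Search.testBit_maskOf, List.mem_append] at hw
  exact hw.elim (excludes_reps63 w) (excludes_patterns63 w)

/-! ### Words close to two codewords -/

/-- The distance between `x` and `c` on the first `n` coordinates. -/
def wdist (n : ℕ) (x : ℕ → Bool) (c : ℕ) : ℕ :=
  (List.range n).countP fun i => x i != c.testBit i

/-- The number of ones among the first `n` bits. -/
def weight (n c : ℕ) : ℕ := (List.range n).countP c.testBit

/-- The weights of the words in the coset of `x`, when increased by `t`, are `16` or at least
`28`. -/
def Valid (C : Set ℕ) (n t : ℕ) (x : ℕ → Bool) : Prop :=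
  ∀ c ∈ C, wdist n x c + t = 16 ∨ 28 ≤ wdist n x c + t

theorem wdist_eq_dist (n : ℕ) (x : ℕ → Bool) (c : ℕ) :
    wdist n x c = dist (List.range n) (2 ^ n - 1) x c := by
  refine List.countP_congr fun i hi => ?_
  rw [List.mem_range] at hi
  simp [hi]

theorem wdist_shift (n : ℕ) (x : ℕ → Bool) (c d : ℕ) :
    wdist n (shift x c) d = wdist n x (c ^^^ d) := by
  rw [wdist_eq_dist, dist_shift, ← wdist_eq_dist]

theorem Valid.shift {C : Set ℕ} (hC : IsLinear C) {n t : ℕ} {x : ℕ → Bool} (h : Valid C n t x)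
    {c : ℕ} (hc : c ∈ C) : Valid C n t (shift x c) := fun d hd => by
  rw [wdist_shift]
  exact h _ (hC.xor hc hd)

theorem Valid.comp {C : Set ℕ} {n t : ℕ} {x : ℕ → Bool} (h : Valid C n t x) {σ τ : ℕ → ℕ}
    (hσ : IsAut C n σ τ) : Valid C n t (x ∘ σ) := fun c hc => by
  obtain ⟨d, hd, hcd⟩ := hσ.map' c hc
  rw [wdist_eq_dist, hσ.dist_comp hcd, ← wdist_eq_dist]
  exact h d hd

/-- A code of length `n` all of whose non-zero words have one of the weights `24`, `32`, `40`. -/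
structure IsThreeWeight (C : Set ℕ) (n : ℕ) : Prop extends IsLinear C where
  weight_mem : ∀ c ∈ C, c = 0 ∨ weight n c = 24 ∨ weight n c = 32 ∨ weight n c = 40

/-- The number of common ones of `x + c` and `x + d`. -/
def overlap (n : ℕ) (x : ℕ → Bool) (c d : ℕ) : ℕ :=
  (List.range n).countP fun i => (x i != c.testBit i) && (x i != d.testBit i)

theorem wdist_add_wdist (n : ℕ) (x : ℕ → Bool) (c d : ℕ) :
    wdist n x c + wdist n x d = weight n (c ^^^ d) + 2 * overlap n x c d := by
  unfold wdist weight overlap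
  induction List.range n with
  | nil => rfl
  | cons i o ih =>
    simp only [List.countP_cons, Nat.testBit_xor]
    cases x i <;> cases c.testBit i <;> cases d.testBit i <;> simp <;> omega

theorem overlap_self (n : ℕ) (x : ℕ → Bool) (c : ℕ) : overlap n x c c = wdist n x c := by
  simp [overlap, wdist]

/-- Two words of weight at most `15` in the same coset differ by a codeword of weight `24`. -/
theorem IsThreeWeight.weight_eq {C : Set ℕ} {n : ℕ} (hC : IsThreeWeight C n) {x : ℕ → Bool}
    {c d m : ℕ} (hc : c ∈ C) (hd : d ∈ C) (hcd : c ≠ d) (hm : m < 16) (h1 : wdist n x c = m)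
    (h2 : wdist n x d = m) : weight n (c ^^^ d) = 24 ∧ overlap n x c d + 12 = m := by
  have h := wdist_add_wdist n x c d
  rcases hC.weight_mem _ (hC.xor hc hd) with h0 | h0 | h0 | h0
  · exact absurd (Nat.xor_eq_zero_iff.1 h0) hcd
  all_goals omega

theorem countP_range_eq_sum (n : ℕ) (p : ℕ → Bool) :
    (List.range n).countP p = ∑ i ∈ Finset.range n, (p i).toNat := by
  induction n with
  | zero => rfl
  | succ k ih =>
    rw [List.range_succ, List.countP_append, Finset.sum_range_succ, ih]
    cases h : p k <;> simp [h]

/-- Counting incidences between coordinates and words of weight `m`: the words have pairwise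
`m - 12` common ones, so that by Cauchy's inequality there are few of them. -/
theorem IsThreeWeight.card_mul_sq_le {C : Set ℕ} {n : ℕ} (hC : IsThreeWeight C n) {x : ℕ → Bool}
    {m : ℕ} (hm : m < 16) (hm' : 12 ≤ m) (Y : Finset ℕ) (hY : ∀ c ∈ Y, c ∈ C ∧ wdist n x c = m) :
    Y.card * (m * m) ≤ n * (12 + Y.card * (m - 12)) := by
  let e : ℕ → ℕ → ℕ := fun c i => (x i != c.testBit i).toNat
  have hcount := countP_range_eq_sum n
  have h1 : ∀ c ∈ Y, ∑ i ∈ Finset.range n, e c i = m := fun c hc => by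
    rw [← (hY c hc).2, wdist, hcount]
  have h2 : ∀ c ∈ Y, ∀ d ∈ Y, ∑ i ∈ Finset.range n, e c i * e d i =
      (if c = d then 12 else 0) + (m - 12) := by
    intro c hc d hd
    have h3 : ∑ i ∈ Finset.range n, e c i * e d i = overlap n x c d := by
      rw [overlap, hcount]
      exact Finset.sum_congr rfl fun i _ => by
        simp only [e]
        cases x i != c.testBit i <;> cases x i != d.testBit i <;> rfl
    rw [h3]
    split
    · next h => rw [← h, overlap_self, (hY c hc).2]; omega
    · next h =>
      have := (hC.weight_eq (hY c hc).1 (hY d hd).1 h hm (hY c hc).2 (hY d hd).2).2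
      omega
  have h3 : ∑ i ∈ Finset.range n, ∑ c ∈ Y, e c i = Y.card * m := by
    rw [Finset.sum_comm, Finset.sum_congr rfl h1, Finset.sum_const, smul_eq_mul]
  have h4 : ∑ i ∈ Finset.range n, (∑ c ∈ Y, e c i) ^ 2 =
      Y.card * (12 + Y.card * (m - 12)) := by
    have h5 : ∀ i, (∑ c ∈ Y, e c i) ^ 2 = ∑ c ∈ Y, ∑ d ∈ Y, e c i * e d i := fun i => by
      rw [sq, Finset.sum_mul_sum]
    simp_rw [h5]
    rw [Finset.sum_comm]
    have h6 : ∀ c ∈ Y, ∑ i ∈ Finset.range n, ∑ d ∈ Y, e c i * e d i =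
        12 + Y.card * (m - 12) := by
      intro c hc
      rw [Finset.sum_comm, Finset.sum_congr rfl (h2 c hc), Finset.sum_add_distrib,
        Finset.sum_ite_eq, if_pos hc, Finset.sum_const, smul_eq_mul]
    rw [Finset.sum_congr rfl h6, Finset.sum_const, smul_eq_mul]
  have h7 := sq_sum_le_card_mul_sum_sq (s := Finset.range n) (f := fun i => ∑ c ∈ Y, e c i)
  rw [h3, h4, Finset.card_range] at h7
  rcases Nat.eq_zero_or_pos Y.card with h0 | h0
  · simp [h0]
  · refine Nat.le_of_mul_le_mul_left (c := Y.card) ?_ h0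
    calc Y.card * (Y.card * (m * m)) = (Y.card * m) ^ 2 := by ring
      _ ≤ n * (Y.card * (12 + Y.card * (m - 12))) := h7
      _ = Y.card * (n * (12 + Y.card * (m - 12))) := by ring

/-- The number of ones of `x` in `d`, inside `c`. -/
def inner (n : ℕ) (x : ℕ → Bool) (c d : ℕ) : ℕ :=
  (List.range n).countP fun i => x i && (c.testBit i && d.testBit i)

/-- The number of ones of `x` in `d`, outside `c`. -/
def outer (n : ℕ) (x : ℕ → Bool) (c d : ℕ) : ℕ :=
  (List.range n).countP fun i => x i && (!c.testBit i && d.testBit i)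

theorem wdist_add_inner (n : ℕ) (x : ℕ → Bool) (c d : ℕ) :
    wdist n x d + 2 * (inner n x c d + outer n x c d) = wdist n x 0 + weight n d := by
  unfold wdist weight inner outer
  induction List.range n with
  | nil => rfl
  | cons i o ih =>
    simp only [List.countP_cons, Nat.zero_testBit, Bool.bne_false] at ih ⊢
    cases x i <;> cases c.testBit i <;> cases d.testBit i <;> simp <;> omega

theorem inner_add_inner_xor (n : ℕ) (x : ℕ → Bool) (c d : ℕ) :
    inner n x c d + inner n x c (d ^^^ c) = inner n x c c ∧
      outer n x c (d ^^^ c) = outer n x c d ∧ outer n x c c = 0 := by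
  unfold inner outer
  induction List.range n with
  | nil => exact ⟨rfl, rfl, rfl⟩
  | cons i o ih =>
    simp only [List.countP_cons, Nat.testBit_xor, Bool.and_self] at ih ⊢
    generalize List.countP _ o = a1 at ih ⊢
    cases x i <;> cases c.testBit i <;> cases d.testBit i <;> simp at ih ⊢ <;> omega

/-- A word `x` such that `x` and `x + c` have weight `16 - t`. -/
structure Pinned (C : Set ℕ) (n t : ℕ) (x : ℕ → Bool) (c : ℕ) : Prop where
  valid : Valid C n t x
  zero : wdist n x 0 + t = 16
  self : wdist n x c + t = 16

theorem Pinned.shift {C : Set ℕ} (hC : IsLinear C) {n t : ℕ} {x : ℕ → Bool} {c : ℕ}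
    (h : Pinned C n t x c) (hc : c ∈ C) : Pinned C n t (shift x c) c :=
  ⟨h.valid.shift hC hc, by rw [wdist_shift]; simpa using h.self,
    by rw [wdist_shift]; simpa using h.zero⟩

theorem Pinned.inner_eq {C : Set ℕ} {n t : ℕ} {x : ℕ → Bool} {c : ℕ} (h : Pinned C n t x c)
    (hc : weight n c = 24) : inner n x c c = 12 := by
  have h1 := wdist_add_inner n x c c
  have h2 := h.zero
  have h3 := h.self
  have h4 := (inner_add_inner_xor n x c 0).2.2
  omega

/-- If `c`, `d` and `c + d` have weight `24`, then the numbers of ones of `x` in `d` inside and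
outside of `c` are strongly restricted. -/
theorem Pinned.inner_mem {C : Set ℕ} (hC : IsLinear C) {n t : ℕ} {x : ℕ → Bool} {c d : ℕ}
    (h : Pinned C n t x c) (hc : weight n c = 24) (hcC : c ∈ C) (hd : weight n d = 24)
    (hdC : d ∈ C) (hdc : weight n (d ^^^ c) = 24) :
    (inner n x c d + outer n x c d = 12 ∧ wdist n x d + t = 16) ∨
    (inner n x c d = outer n x c d ∧ wdist n x (d ^^^ c) + t = 16) ∨
    (inner n x c d = 6 ∧ outer n x c d = 0) := by
  have h1 := wdist_add_inner n x c d
  have h2 := wdist_add_inner n x c (d ^^^ c)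
  have h3 := h.inner_eq hc
  have h4 := inner_add_inner_xor n x c d
  have h5 := h.zero
  rcases h.valid d hdC with h6 | h6 <;> rcases h.valid _ (hC.xor hdC hcC) with h7 | h7 <;> omega

/-- `c` is settled for the property `Q` if all words pinned by `c` have the property. -/
def Settled (C : Set ℕ) (n t : ℕ) (Q : (ℕ → Bool) → Prop) (c : ℕ) : Prop :=
  ∀ x, Pinned C n t x c → Q x

/-- Properties of words that are invariant under the code and its automorphisms. -/
structure Stable (C : Set ℕ) (n : ℕ) (Q : (ℕ → Bool) → Prop) : Prop where
  shift : ∀ x, ∀ c ∈ C, Q (shift x c) → Q x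
  comp : ∀ x σ τ, IsAut C n σ τ → Q (x ∘ σ) → Q x

/-- Codewords `d` such that `c`, `d` and `c + d` have weight `24`, one from each pair `d`, `c + d`:
the one that vanishes at the coordinate `p` of `c`. -/
structure Companions (C : Set ℕ) (n c p : ℕ) (L : List ℕ) : Prop where
  mem_self : c ∈ C
  weight_self : weight n c = 24
  testBit_self : c.testBit p = true
  mem : ∀ d ∈ L, d ∈ C
  weight : ∀ d ∈ L, weight n d = 24
  weight_xor : ∀ d ∈ L, CodeExtension.weight n (d ^^^ c) = 24
  testBit : ∀ d ∈ L, d.testBit p = false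
  nodup : L.Nodup

theorem weight_zero (n : ℕ) : weight n 0 = 0 := by
  simp [weight]

/-- A companion that meets a pinned word outside of `c` gives a further word of least weight. -/
theorem Pinned.near {C : Set ℕ} (hC : IsLinear C) {n t : ℕ} {x : ℕ → Bool} {c p : ℕ}
    (h : Pinned C n t x c) {L : List ℕ} (hL : Companions C n c p L) {d : ℕ}
    (hd : d ∈ L) (ho : 0 < outer n x c d) :
    wdist n x d + t = 16 ∨ wdist n x (d ^^^ c) + t = 16 := by
  have := h.inner_mem hC hL.weight_self hL.mem_self (hL.weight d hd) (hL.mem d hd)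
    (hL.weight_xor d hd)
  omega

/-- Only few companions meet a pinned word outside of `c`. -/
theorem Pinned.countP_le {C : Set ℕ} {n : ℕ} (hC : IsThreeWeight C n) {t T : ℕ}
    {x : ℕ → Bool} {c p : ℕ} (h : Pinned C n t x c) {L : List ℕ} (hL : Companions C n c p L)
    (ht0 : 0 < t) (ht : t < 4)
    (hT : n * (12 + (T + 3) * (16 - t - 12)) < (T + 3) * ((16 - t) * (16 - t))) :
    L.countP (fun d => decide (0 < outer n x c d)) ≤ T := by
  classical
  by_contra! hlt
  set f : ℕ → ℕ := fun d => if wdist n x d + t = 16 then d else d ^^^ c with hf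
  set M := L.filter (fun d => decide (0 < outer n x c d)) with hM
  have hML : ∀ d ∈ M, d ∈ L ∧ 0 < outer n x c d := fun d hd => by simpa [hM] using hd
  have hfcases : ∀ d, f d = d ∨ f d = d ^^^ c := fun d => by
    simp only [hf]; split <;> simp
  have hne0 : ∀ d ∈ L, d ≠ 0 := fun d hd h0 => by
    have := hL.weight d hd
    rw [h0, weight_zero] at this
    omega
  have hnec : ∀ d ∈ L, d ^^^ c ≠ 0 := fun d hd h0 => by
    have := hL.weight_xor d hd
    rw [h0, weight_zero] at this
    omega
  have hc0 : c ≠ 0 := fun h0 => by simpa [h0] using hL.testBit_self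
  have hinj : Set.InjOn f (M.toFinset : Set ℕ) := by
    intro d hd e he hde
    have hd' := (hML d (by simpa using hd)).1
    have he' := (hML e (by simpa using he)).1
    have h1 := hL.testBit d hd'
    have h2 := hL.testBit e he'
    have h3 := hL.testBit_self
    rcases hfcases d with h4 | h4 <;> rcases hfcases e with h5 | h5 <;> rw [h4, h5] at hde
    · exact hde
    · have := congrArg (Nat.testBit · p) hde
      simp [h1, h2, h3] at this
    · have := congrArg (Nat.testBit · p) hde
      simp [h1, h2, h3] at this
    · simpa using hde
  set Y : Finset ℕ := insert 0 (insert c (M.toFinset.image f)) with hY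
  have hcard : T + 3 ≤ Y.card := by
    rw [hY, Finset.card_insert_of_notMem, Finset.card_insert_of_notMem,
      Finset.card_image_of_injOn hinj, List.toFinset_card_of_nodup (hL.nodup.filter _),
      ← List.countP_eq_length_filter]
    · omega
    · intro hmem
      obtain ⟨d, hd, hdc⟩ := Finset.mem_image.1 hmem
      have hd' := (hML d (by simpa using hd)).1
      rcases hfcases d with h4 | h4 <;> rw [h4] at hdc
      · exact hnec d hd' (by simp [hdc])
      · refine hne0 d hd' ?_
        have := congrArg (· ^^^ c) hdc
        simpa [Nat.xor_assoc] using this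
    · intro hmem
      rcases Finset.mem_insert.1 hmem with hmem | hmem
      · exact hc0 hmem.symm
      · obtain ⟨d, hd, hdc⟩ := Finset.mem_image.1 hmem
        have hd' := (hML d (by simpa using hd)).1
        rcases hfcases d with h4 | h4 <;> rw [h4] at hdc
        · exact hne0 d hd' hdc
        · exact hnec d hd' hdc
  have hYm : ∀ d ∈ Y, d ∈ C ∧ wdist n x d = 16 - t := by
    intro d hd
    rcases Finset.mem_insert.1 hd with rfl | hd
    · exact ⟨hC.zero, by have := h.zero; omega⟩
    rcases Finset.mem_insert.1 hd with rfl | hd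
    · exact ⟨hL.mem_self, by have := h.self; omega⟩
    obtain ⟨e, he, rfl⟩ := Finset.mem_image.1 hd
    have he' := hML e (by simpa using he)
    have := h.near hC.toIsLinear hL he'.1 he'.2
    simp only [hf]
    split
    · exact ⟨hL.mem e he'.1, by omega⟩
    · exact ⟨hC.xor (hL.mem e he'.1) hL.mem_self, by omega⟩
  obtain ⟨Z, hZY, hZ⟩ := Finset.exists_subset_card_eq hcard
  have := hC.card_mul_sq_le (m := 16 - t) (by omega) (by omega) Z fun d hd => hYm d (hZY hd)
  rw [hZ] at this
  omega

/-- A pinned word meets no settled companion outside of `c`, unless it has the property. -/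
theorem Pinned.of_settled {C : Set ℕ} (hC : IsLinear C) {n t : ℕ} {x : ℕ → Bool} {c p : ℕ}
    (h : Pinned C n t x c) {L : List ℕ} (hL : Companions C n c p L)
    {Q : (ℕ → Bool) → Prop} (hQ : Stable C n Q) {d : ℕ}
    (hd : d ∈ L) (ho : 0 < outer n x c d)
    (hs : Settled C n t Q d ∨ Settled C n t Q (d ^^^ c)) : Q x := by
  have hy := h.shift hC hL.mem_self
  have e1 : wdist n (CodeExtension.shift x c) (d ^^^ c) = wdist n x d := by
    rw [wdist_shift, Nat.xor_comm d c, ← Nat.xor_assoc, Nat.xor_self, Nat.zero_xor]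
  have e2 : wdist n (CodeExtension.shift x c) d = wdist n x (d ^^^ c) := by
    rw [wdist_shift, Nat.xor_comm]
  rcases h.near hC hL hd ho with h1 | h1 <;> rcases hs with hs | hs
  · exact hs x ⟨h.valid, h.zero, h1⟩
  · exact hQ.shift _ _ hL.mem_self (hs _ ⟨hy.valid, hy.zero, by rw [e1]; exact h1⟩)
  · exact hQ.shift _ _ hL.mem_self (hs _ ⟨hy.valid, hy.zero, by rw [e2]; exact h1⟩)
  · exact hs x ⟨h.valid, h.zero, h1⟩

/-! ### Searching for the pinned words -/

/-- The search through the sets of `k` points, a point being given with the packed indicators of the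
companions that contain it, and `U` being those of the companions met so far. -/
noncomputable def pointTree (bad : ℕ → Bool) (leaf : List ℕ → Bool) (ps : List (ℕ × ℕ)) :
    ℕ → ℕ → List ℕ → Bool :=
  List.rec (fun k _ acc => Nat.casesOn k (leaf acc) fun _ => true)
    (fun p _ ih k U acc => Nat.casesOn k (leaf acc) fun k' =>
      and (or (bad (Nat.lor U p.2)) (ih k' (Nat.lor U p.2) (p.1 :: acc))) (ih k U acc)) ps

theorem pointTree_sound {bad : ℕ → Bool} {leaf : List ℕ → Bool} {P : ℕ → Prop} {x : ℕ → Bool}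
    (hbad : ∀ U, P U → bad U = false) (ps : List (ℕ × ℕ))
    (hps : ∀ p ∈ ps, x p.1 → ∀ U, P U → P (U ||| p.2)) {k U : ℕ} {acc : List ℕ}
    (hk : ps.countP (fun p => x p.1) = k) (hU : P U) (h : pointTree bad leaf ps k U acc) :
    leaf (((ps.filter fun p => x p.1).map Prod.fst).reverse ++ acc) := by
  induction ps generalizing k U acc with
  | nil => subst hk; exact h
  | cons p ps ih =>
    have hps' : ∀ q ∈ ps, x q.1 → ∀ U, P U → P (U ||| q.2) := fun q hq => hps q (by simp [hq])
    cases k with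
    | zero =>
      have h0 : (p :: ps).filter (fun p => x p.1) = [] := by
        rw [← List.length_eq_zero_iff, ← List.countP_eq_length_filter, hk]
      rw [h0]
      exact h
    | succ k =>
      change and (or (bad (U ||| p.2)) (pointTree bad leaf ps k (U ||| p.2) (p.1 :: acc)))
        (pointTree bad leaf ps (k + 1) U acc) = true at h
      rw [Bool.and_eq_true, Bool.or_eq_true] at h
      cases hp : x p.1
      · rw [List.filter_cons_of_neg (by simp [hp])]
        exact ih hps' (by simpa [List.countP_cons, hp] using hk) hU h.2
      · rw [List.filter_cons_of_pos (by simp [hp]), List.map_cons, List.reverse_cons,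
          List.append_assoc, List.singleton_append]
        have hU' := hps p (by simp) hp U hU
        refine ih hps' (by simpa [List.countP_cons, hp] using hk) hU' ?_
        rw [hbad _ hU'] at h
        simpa using h.1

/-- The packed indicators of a property. -/
def packBits {α : Type*} (l : List α) (f : α → Bool) : ℕ := packL (l.map fun a => (f a).toNat)

theorem packBits_or {α : Type*} (l : List α) (f g : α → Bool) :
    packBits l f ||| packBits l g = packBits l fun a => f a || g a := by
  induction l with
  | nil => simp [packBits, packL]
  | cons a l ih =>
    simp only [packBits, List.map_cons, packL] at ih ⊢
    rw [← ih, show 256 = 2 ^ 8 from rfl]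
    apply Nat.eq_of_testBit_eq
    intro i
    rw [add_comm, add_comm (g a).toNat, add_comm (f a || g a).toNat, Nat.testBit_or,
      Nat.testBit_two_pow_mul_add _ (lt_of_le_of_lt (Bool.toNat_le _) (by norm_num)),
      Nat.testBit_two_pow_mul_add _ (lt_of_le_of_lt (Bool.toNat_le _) (by norm_num)),
      Nat.testBit_two_pow_mul_add _ (lt_of_le_of_lt (Bool.toNat_le _) (by norm_num))]
    split
    · cases f a <;> cases g a <;> simp
    · rw [Nat.testBit_or]

theorem packBits_and {α : Type*} (l : List α) (f g : α → Bool) :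
    packBits l f &&& packBits l g = packBits l fun a => f a && g a := by
  rw [packBits, packBits, packL_map_and]
  · refine congrArg packL (List.map_congr_left fun a _ => ?_)
    cases hf : f a <;> cases hg : g a <;> simp [hf, hg]
  all_goals exact fun a _ => lt_of_le_of_lt (Bool.toNat_le _) (by norm_num)

theorem packBits_mod_le {α : Type*} (l : List α) (f : α → Bool) :
    packBits l f % 255 ≤ l.countP f := by
  suffices h : packBits l f % 255 = l.countP f % 255 from h ▸ Nat.mod_le _ _
  induction l with
  | nil => rfl
  | cons a l ih =>
    simp only [packBits, List.map_cons, packL, List.countP_cons] at ih ⊢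
    cases f a <;> simp <;> omega

theorem packBits_eq_zero {α : Type*} {l : List α} {f : α → Bool} (h : ∀ a ∈ l, f a = false) :
    packBits l f = 0 := by
  rw [packBits, List.map_congr_left (g := fun _ => 0) fun a ha => by rw [h a ha]; rfl, packL_const,
    Nat.zero_mul]

/-- Whether more than `T` companions, or one of those in `E`, belong to the set `U`. The number of
elements of a set is the sum of the digits. -/
def crowded (T E U : ℕ) : Bool :=
  cond (Nat.blt T (Nat.mod U 255)) true (cond (Nat.beq (Nat.land U E) 0) false true)

theorem crowded_eq_false {α : Type*} {l : List α} {T : ℕ} {e f : α → Bool} (hT : l.countP f ≤ T)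
    (he : ∀ a ∈ l, f a → e a = false) : crowded T (packBits l e) (packBits l f) = false := by
  have h1 : Nat.blt T (Nat.mod (packBits l f) 255) = false := by
    rw [← Bool.not_eq_true]
    intro h
    have h2 : T < packBits l f % 255 := Nat.le_of_ble_eq_true h
    have h3 := packBits_mod_le l f
    omega
  have h2 : Nat.beq (Nat.land (packBits l f) (packBits l e)) 0 = true := by
    rw [Nat.beq_eq]
    change packBits l f &&& packBits l e = 0
    rw [packBits_and]
    refine packBits_eq_zero fun a ha => ?_
    cases hf : f a
    · rfl
    · rw [he a ha hf, Bool.and_false]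
  rw [crowded, h1, h2]
  rfl

/-- Whether for some digit the first number has the highest bit and the second has not. -/
def clash (H W V : ℕ) : Bool :=
  cond (Nat.beq (Nat.land (Nat.land W H) V) (Nat.land W H)) false true

/-- The search through the values of a word at the coordinates of `steps`, a step being the
coordinate as a mask, and the packed indicators of the words that contain it. -/
noncomputable def wordTree (H : ℕ) (leaf : ℕ → Bool) (steps : List (ℕ × ℕ)) :
    ℕ → ℕ → ℕ → Bool :=
  List.rec (fun _ _ u => leaf u) (fun s _ ih W V u =>
    and (or (clash H (Nat.add W s.2) V) (ih (Nat.add W s.2) V (Nat.lor u s.1)))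
      (or (clash H W (Nat.sub V s.2)) (ih W (Nat.sub V s.2) u))) steps

/-- The number with the digits `f a`. -/
noncomputable def packWith {α : Type*} (f : α → ℕ) (l : List α) : ℕ :=
  List.rec 0 (fun a _ ih => Nat.add (f a) (Nat.mul 256 ih)) l

theorem packWith_eq {α : Type*} (f : α → ℕ) (l : List α) : packWith f l = packL (l.map f) := by
  induction l with
  | nil => rfl
  | cons a l ih =>
    change f a + 256 * packWith f l = _
    rw [ih]
    rfl

/-- The packed indicators of the words of the gaps that contain the coordinate `i`. -/
noncomputable def gapMask (Γ : List (ℕ × ℕ × ℕ)) (i : ℕ) : ℕ :=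
  packWith (fun γ => cond (bitAt γ.1 i) 1 0) Γ

theorem gapMask_eq (Γ : List (ℕ × ℕ × ℕ)) (i : ℕ) :
    gapMask Γ i = packL (Γ.map fun γ => (γ.1.testBit i).toNat) := by
  rw [gapMask, packWith_eq]
  refine congrArg packL (List.map_congr_left fun γ _ => ?_)
  rw [bitAt_eq]
  cases γ.1.testBit i <;> rfl

theorem clash_eq_false {Γ : List (ℕ × ℕ × ℕ)} {A B : ℕ × ℕ × ℕ → ℕ}
    (hA : ∀ γ ∈ Γ, A γ < 256) (hB : ∀ γ ∈ Γ, B γ < 256)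
    (h : ∀ γ ∈ Γ, 128 ≤ A γ → 128 ≤ B γ) :
    clash (packL (Γ.map fun _ => 128)) (packL (Γ.map A)) (packL (Γ.map B)) = false := by
  have h1 : Nat.beq (Nat.land (Nat.land (packL (Γ.map A)) (packL (Γ.map fun _ => 128)))
      (packL (Γ.map B))) (Nat.land (packL (Γ.map A)) (packL (Γ.map fun _ => 128))) = true := by
    rw [Nat.beq_eq]
    change (packL (Γ.map A) &&& packL (Γ.map fun _ => 128)) &&& packL (Γ.map B) =
      packL (Γ.map A) &&& packL (Γ.map fun _ => 128)
    rw [packL_map_and _ _ _ hA (by simp), packL_map_and _ _ _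
      (fun γ hγ => lt_of_le_of_lt Nat.and_le_left (hA γ hγ)) hB]
    congr 1
    refine List.map_congr_left fun γ hγ => ?_
    rcases Nat.lt_or_ge (A γ) 128 with h2 | h2
    · rw [and_128_of_lt h2, Nat.zero_and]
    · rw [and_128_of_ge h2 (hA γ hγ), Nat.and_comm, and_128_of_ge (h γ hγ h2) (hB γ hγ)]
  unfold clash
  rw [h1]
  rfl

/-- The state of the search describes the word `x`: the numbers of ones in the words of the gaps
lie outside of the gaps, and the digits of `W` and `V` are the lower and the upper bounds for these
numbers that follow from the values known so far, both offset so as to reach `128` at the ends of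
the gaps. -/
structure Tracks (x : ℕ → Bool) (N : ℕ × ℕ × ℕ → ℕ) (Γ : List (ℕ × ℕ × ℕ)) (cs : List ℕ)
    (A B : ℕ × ℕ × ℕ → ℕ) : Prop where
  lower : ∀ γ ∈ Γ, A γ + cs.countP (fun i => x i && γ.1.testBit i) = 128 - γ.2.1 + N γ
  upper : ∀ γ ∈ Γ, B γ = 128 - γ.2.2 + cs.countP (fun i => !x i && γ.1.testBit i) + N γ

theorem Tracks.cons_true {x : ℕ → Bool} {N : ℕ × ℕ × ℕ → ℕ} {Γ : List (ℕ × ℕ × ℕ)} {i : ℕ}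
    {cs : List ℕ} {A B : ℕ × ℕ × ℕ → ℕ} (h : Tracks x N Γ (i :: cs) A B) (hi : x i = true) :
    Tracks x N Γ cs (fun γ => A γ + (γ.1.testBit i).toNat) B := by
  refine ⟨fun γ hγ => ?_, fun γ hγ => ?_⟩
  · rw [← h.lower γ hγ]
    cases hb : γ.1.testBit i <;> simp [hi, hb]
    omega
  · rw [h.upper γ hγ]
    simp [hi]

theorem Tracks.cons_false {x : ℕ → Bool} {N : ℕ × ℕ × ℕ → ℕ} {Γ : List (ℕ × ℕ × ℕ)} {i : ℕ}
    {cs : List ℕ} {A B : ℕ × ℕ × ℕ → ℕ} (h : Tracks x N Γ (i :: cs) A B) (hi : x i = false) :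
    Tracks x N Γ cs A (fun γ => B γ - (γ.1.testBit i).toNat) ∧
      ∀ γ ∈ Γ, (γ.1.testBit i).toNat ≤ B γ := by
  refine ⟨⟨fun γ hγ => ?_, fun γ hγ => ?_⟩, fun γ hγ => ?_⟩
  · rw [← h.lower γ hγ]
    simp [hi]
  · rw [h.upper γ hγ]
    cases hb : γ.1.testBit i <;> simp [hi, hb]
    omega
  · rw [h.upper γ hγ]
    cases hb : γ.1.testBit i <;> simp [hi, hb]
    omega

theorem Tracks.clash_eq_false {x : ℕ → Bool} {N : ℕ × ℕ × ℕ → ℕ} {Γ : List (ℕ × ℕ × ℕ)}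
    {cs : List ℕ} {A B : ℕ × ℕ × ℕ → ℕ} (h : Tracks x N Γ cs A B) (hcs : cs.length < 64)
    (hN : ∀ γ ∈ Γ, N γ < 64 ∧ ¬ (γ.2.1 ≤ N γ ∧ N γ < γ.2.2)) :
    clash (packL (Γ.map fun _ => 128)) (packL (Γ.map A)) (packL (Γ.map B)) = false := by
  refine CodeExtension.clash_eq_false (fun γ hγ => ?_) (fun γ hγ => ?_) fun γ hγ h1 => ?_
  · have := h.lower γ hγ
    have := hN γ hγ
    omega
  · rw [h.upper γ hγ]
    have := hN γ hγ
    have : cs.countP (fun i => !x i && γ.1.testBit i) ≤ cs.length := List.countP_le_length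
    omega
  · have := h.lower γ hγ
    have := hN γ hγ
    rw [h.upper γ hγ]
    omega

theorem wordTree_sound {x : ℕ → Bool} {N : ℕ × ℕ × ℕ → ℕ} {Γ : List (ℕ × ℕ × ℕ)} {n : ℕ}
    {leaf : ℕ → Bool} (hN : ∀ γ ∈ Γ, N γ < 64 ∧ ¬ (γ.2.1 ≤ N γ ∧ N γ < γ.2.2)) (cs : List ℕ)
    (hcs : cs.length < 64) {A B : ℕ × ℕ × ℕ → ℕ} (h : Tracks x N Γ cs A B) {u : ℕ}
    (hu : ∀ j < n, j ∉ cs → u.testBit j = x j) (hu' : ∀ j ∈ cs, u.testBit j = false)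
    (hnd : cs.Nodup)
    (ht : wordTree (packL (Γ.map fun _ => 128)) leaf (cs.map fun i => (2 ^ i, gapMask Γ i))
      (packL (Γ.map A)) (packL (Γ.map B)) u) :
    ∃ u, leaf u ∧ ∀ j < n, u.testBit j = x j := by
  induction cs generalizing A B u with
  | nil => exact ⟨u, ht, fun j hj => hu j hj (by simp)⟩
  | cons i cs ih =>
    have hlen : cs.length < 64 := by rw [List.length_cons] at hcs; omega
    rw [List.nodup_cons] at hnd
    change and (or (clash _ (packL (Γ.map A) + gapMask Γ i) _)
        (wordTree _ leaf (cs.map _) (packL (Γ.map A) + gapMask Γ i) _ (u ||| 2 ^ i)))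
      (or (clash _ _ (packL (Γ.map B) - gapMask Γ i))
        (wordTree _ leaf (cs.map _) _ (packL (Γ.map B) - gapMask Γ i) u)) = true at ht
    rw [Bool.and_eq_true, Bool.or_eq_true, Bool.or_eq_true] at ht
    cases hi : x i
    · obtain ⟨h1, h2⟩ := h.cons_false hi
      have ht := ht.2
      rw [gapMask_eq, packL_map_sub _ _ _ h2, h1.clash_eq_false hlen hN] at ht
      refine ih hlen h1 (fun j hj hj' => ?_) (fun j hj => hu' j (by simp [hj])) hnd.2
        (by simpa using ht)
      by_cases hji : j = i
      · rw [hji, hi, hu' i (by simp)]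
      · exact hu j hj (by simp [hji, hj'])
    · have h1 := h.cons_true hi
      have ht := ht.1
      rw [gapMask_eq, packL_map_add, h1.clash_eq_false hlen hN] at ht
      refine ih hlen h1 (fun j hj hj' => ?_) (fun j hj => ?_) hnd.2 (by simpa using ht)
      · rw [Nat.testBit_or, Nat.testBit_two_pow]
        by_cases hji : j = i
        · simp [hji, hi]
        · rw [hu j hj (by simp [hji, hj'])]
          simp [Ne.symm hji]
      · rw [Nat.testBit_or, Nat.testBit_two_pow, hu' j (by simp [hj])]
        have : i ≠ j := fun hij => hnd.1 (hij ▸ hj)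
        simp [this]

/-- The coordinates below `n` outside of `c`. -/
def outside (n c : ℕ) : List ℕ := (List.range n).filter fun i => !c.testBit i

/-- The coordinates below `n` inside of `c`. -/
def inside (n c : ℕ) : List ℕ := (List.range n).filter fun i => c.testBit i

/-- The numbers of ones inside of `c` that a pinned word cannot have in a companion `d`, if it has
`a` ones in `d` outside of `c`. -/
def gapsAt (d a : ℕ) : List (ℕ × ℕ × ℕ) :=
  if a = 0 then [(d, 1, 6), (d, 7, 12)] else [(d, 0, a), (d, a + 1, 12 - a), (d, 13 - a, 128)]

/-- The gaps for all companions, if a pinned word has the ones `P` outside of `c`. -/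
def gaps (c : ℕ) (L P : List ℕ) : List (ℕ × ℕ × ℕ) :=
  (c, 0, 12) :: (c, 13, 128) :: L.flatMap fun d => gapsAt d (P.countP fun i => bitAt d i)

/-- The given coordinates, sorted lexicographically by the words in `L`. -/
def sortBy (L cs : List ℕ) : List ℕ :=
  L.foldr (fun d l => l.filter (fun i => bitAt d i) ++ l.filter (fun i => !bitAt d i)) cs

theorem sortBy_perm (L cs : List ℕ) : (sortBy L cs).Perm cs := by
  induction L with
  | nil => exact List.Perm.refl _
  | cons d L ih =>
    exact (List.filter_append_perm _ _).trans ih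

/-- The coordinates inside of `c`, in the order in which the search treats them: sorted by some of
the companions that are met by `P`. -/
def searchOrder (n c : ℕ) (L P : List ℕ) : List ℕ :=
  sortBy ((L.filter fun d => P.any fun i => bitAt d i).take 6) (inside n c)

/-- The search for the words pinned by `c` with the ones `P` outside of `c`. The companions have
`12` coordinates in common with `c`. -/
noncomputable def extend (n c : ℕ) (L : List ℕ) (leaf : ℕ → Bool) (P : List ℕ) : Bool :=
  match searchOrder n c L P with
  | [] => false
  | i :: cs =>
    wordTree (packWith (fun _ => 128) (gaps c L P)) leaf
      (cs.map fun i => (2 ^ i, gapMask (gaps c L P) i))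
      (packWith (fun γ => Nat.sub 128 γ.2.1) (gaps c L P))
      (Nat.sub (packWith
        (fun γ => Nat.add (Nat.sub 128 γ.2.2) (cond (Nat.beq γ.1 c) 24 12)) (gaps c L P))
        (gapMask (gaps c L P) i))
      (Search.maskOf P)

theorem countP_inside (n : ℕ) (x : ℕ → Bool) (c d : ℕ) :
    (inside n c).countP (fun i => x i && d.testBit i) = inner n x c d := by
  rw [inside, List.countP_filter]
  refine List.countP_congr fun i _ => ?_
  cases x i <;> cases c.testBit i <;> simp

theorem countP_outside (n : ℕ) (x : ℕ → Bool) (c d : ℕ) :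
    ((outside n c).filter x).countP d.testBit = outer n x c d := by
  rw [outside, List.filter_filter, List.countP_filter]
  refine List.countP_congr fun i _ => ?_
  cases x i <;> cases c.testBit i <;> simp

theorem length_inside (n c : ℕ) : (inside n c).length = weight n c := by
  rw [inside, ← List.countP_eq_length_filter, weight]

theorem weight_add_weight (n c d : ℕ) :
    weight n c + weight n d = weight n (d ^^^ c) + 2 * (inside n c).countP d.testBit := by
  rw [inside, List.countP_filter, weight, weight, weight]
  induction List.range n with
  | nil => rfl
  | cons i o ih =>
    simp only [List.countP_cons, Nat.testBit_xor] at ih ⊢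
    cases c.testBit i <;> cases d.testBit i <;> simp <;> omega

theorem Companions.countP_gap {C : Set ℕ} {n c p : ℕ} {L : List ℕ} (hL : Companions C n c p L)
    {P : List ℕ} {γ : ℕ × ℕ × ℕ} (hγ : γ ∈ gaps c L P) :
    (inside n c).countP γ.1.testBit = cond (Nat.beq γ.1 c) 24 12 := by
  have h := weight_add_weight n c γ.1
  have hγ1 : γ.1 = c ∨ γ.1 ∈ L := by
    rw [gaps, List.mem_cons, List.mem_cons, List.mem_flatMap] at hγ
    rcases hγ with rfl | rfl | ⟨d, hd, hγ⟩
    · exact Or.inl rfl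
    · exact Or.inl rfl
    · right
      rw [gapsAt] at hγ
      split at hγ <;> simp only [List.mem_cons, List.not_mem_nil, or_false] at hγ
      · rcases hγ with rfl | rfl <;> exact hd
      · rcases hγ with rfl | rfl | rfl <;> exact hd
  have h1 := hL.weight_self
  by_cases hc : γ.1 = c
  · rw [hc, Nat.xor_self, weight_zero, h1] at h
    rw [hc, Nat.beq_refl, cond_true]
    omega
  · have hb : Nat.beq γ.1 c = false := by
      rw [← Bool.not_eq_true, Nat.beq_eq]
      exact hc
    have hd := hγ1.resolve_left hc
    rw [hL.weight_xor _ hd, hL.weight _ hd, h1] at h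
    rw [hb, cond_false]
    omega

theorem Pinned.length_outside {C : Set ℕ} {n t : ℕ} {x : ℕ → Bool} {c : ℕ}
    (h : Pinned C n t x c) (hc : weight n c = 24) :
    ((outside n c).filter x).length + t = 4 := by
  have h1 : ((outside n c).filter x).length + inner n x c c = wdist n x 0 := by
    rw [outside, List.filter_filter, ← List.countP_eq_length_filter, inner, wdist]
    induction List.range n with
    | nil => rfl
    | cons i o ih =>
      simp only [List.countP_cons, Nat.zero_testBit, Bool.bne_false, Bool.and_self] at ih ⊢
      cases x i <;> cases c.testBit i <;> simp <;> omega
  have h2 := h.inner_eq hc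
  have h3 := h.zero
  omega

theorem Pinned.not_mem_gap {C : Set ℕ} (hC : IsLinear C) {n t : ℕ} {x : ℕ → Bool} {c p : ℕ}
    (h : Pinned C n t x c) {L : List ℕ} (hL : Companions C n c p L) {P : List ℕ}
    (hP : P.Perm ((outside n c).filter x)) {γ : ℕ × ℕ × ℕ} (hγ : γ ∈ gaps c L P) :
    inner n x c γ.1 < 64 ∧ ¬ (γ.2.1 ≤ inner n x c γ.1 ∧ inner n x c γ.1 < γ.2.2) := by
  have hlt : inner n x c γ.1 < 64 := by
    rw [← countP_inside]
    have h1 : (inside n c).countP (fun i => x i && γ.1.testBit i) ≤ (inside n c).length :=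
      List.countP_le_length
    rw [length_inside, hL.weight_self] at h1
    omega
  refine ⟨hlt, ?_⟩
  have hcc := h.inner_eq hL.weight_self
  rw [gaps, List.mem_cons, List.mem_cons, List.mem_flatMap] at hγ
  rcases hγ with rfl | rfl | ⟨d, hd, hγ⟩
  · simp only
    omega
  · simp only
    omega
  · have h1 := h.inner_mem hC hL.weight_self hL.mem_self (hL.weight d hd) (hL.mem d hd)
      (hL.weight_xor d hd)
    have h2 : outer n x c d ≤ ((outside n c).filter x).length := by
      rw [← countP_outside]
      exact List.countP_le_length
    have h3 := h.length_outside hL.weight_self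
    simp only [bitAt_eq] at hγ
    rw [hP.countP_eq, countP_outside, gapsAt] at hγ
    split at hγ
    · simp only [List.mem_cons, List.not_mem_nil, or_false] at hγ
      rcases hγ with rfl | rfl <;> simp only at hlt ⊢ <;> omega
    · simp only [List.mem_cons, List.not_mem_nil, or_false] at hγ
      rcases hγ with rfl | rfl | rfl <;> simp only at hlt ⊢ <;> omega

theorem searchOrder_perm (n c : ℕ) (L P : List ℕ) : (searchOrder n c L P).Perm (inside n c) :=
  sortBy_perm _ _

theorem Pinned.of_extend_of_head {C : Set ℕ} (hC : IsLinear C) {n t : ℕ} {x : ℕ → Bool}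
    {c p : ℕ} (h : Pinned C n t x c) {L : List ℕ} (hL : Companions C n c p L) {P : List ℕ}
    (hP : P.Perm ((outside n c).filter x)) {Q : (ℕ → Bool) → Prop} {leaf : ℕ → Bool}
    (hleaf : ∀ u, leaf u → (∀ j < n, u.testBit j = x j) → Q x) {i : ℕ} {cs : List ℕ}
    (hcs : searchOrder n c L P = i :: cs) (hi : x i = false) (he : extend n c L leaf P) : Q x := by
  have hperm := searchOrder_perm n c L P
  have hnd : (i :: cs).Nodup := by
    rw [← hcs]
    exact hperm.nodup_iff.2 (List.nodup_range.filter _)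
  have hlen : (i :: cs).length = 24 := by
    rw [← hcs, hperm.length_eq, length_inside, hL.weight_self]
  rw [hcs] at hperm
  rw [extend, hcs] at he
  have hN := fun γ hγ => h.not_mem_gap hC hL hP (γ := γ) hγ
  have ht : Tracks x (fun γ => inner n x c γ.1) (gaps c L P) (i :: cs)
      (fun γ => 128 - γ.2.1)
      (fun γ => 128 - γ.2.2 + cond (Nat.beq γ.1 c) 24 12) := by
    refine ⟨fun γ _ => ?_, fun γ hγ => ?_⟩
    · rw [hperm.countP_eq, countP_inside]
    · rw [← countP_inside n x, ← hperm.countP_eq (fun i => x i && γ.1.testBit i), add_assoc,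
        ← hL.countP_gap hγ, ← hperm.countP_eq]
      congr 1
      induction i :: cs with
      | nil => rfl
      | cons j l ih =>
        simp only [List.countP_cons, ih]
        cases x j <;> simp <;> omega
  obtain ⟨h1, h2⟩ := ht.cons_false hi
  have hmem : ∀ j, j ∈ P ↔ j < n ∧ c.testBit j = false ∧ x j = true := by
    intro j
    rw [hP.mem_iff, outside]
    simp only [List.mem_filter, List.mem_range, Bool.not_eq_true']
    tauto
  have hmem' : ∀ j, j ∈ i :: cs ↔ j < n ∧ c.testBit j = true := by
    intro j
    rw [hperm.mem_iff, inside]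
    simp
  change wordTree _ leaf _ _ (packWith (fun γ => 128 - γ.2.2 + cond (Nat.beq γ.1 c) 24 12)
    (gaps c L P) - gapMask (gaps c L P) i) _ = true at he
  rw [gapMask_eq, packWith_eq, packWith_eq, packWith_eq, packL_map_sub _ _ _ h2] at he
  have hu1 : ∀ j < n, j ∉ cs → (Search.maskOf P).testBit j = x j := by
    intro j hj hjcs
    rw [Bool.eq_iff_iff, Search.testBit_maskOf, hmem]
    constructor
    · exact fun h => h.2.2
    · intro hxj
      refine ⟨hj, ?_, hxj⟩
      by_contra hcj
      have := (hmem' j).2 ⟨hj, by simpa using hcj⟩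
      rcases List.mem_cons.1 this with rfl | h3
      · simp [hi] at hxj
      · exact hjcs h3
  have hu2 : ∀ j ∈ cs, (Search.maskOf P).testBit j = false := by
    intro j hj
    have h3 := ((hmem' j).1 (List.mem_cons_of_mem _ hj)).2
    rw [← Bool.not_eq_true, Search.testBit_maskOf, hmem]
    simp [h3]
  obtain ⟨u, hu, hux⟩ := wordTree_sound hN cs (by rw [List.length_cons] at hlen; omega) h1
    hu1 hu2 (List.nodup_cons.1 hnd).2 he
  exact hleaf u hu hux

/-- Since `c` may be added to a pinned word, its value at one coordinate of `c` is free. -/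
theorem Pinned.of_extend {C : Set ℕ} (hC : IsLinear C) {n t : ℕ} {x : ℕ → Bool}
    {c p : ℕ} (h : Pinned C n t x c) {L : List ℕ} (hL : Companions C n c p L) {P : List ℕ}
    (hP : P.Perm ((outside n c).filter x)) {Q : (ℕ → Bool) → Prop} (hQ : Stable C n Q)
    {leaf : ℕ → Bool} (hleaf : ∀ u x, leaf u → (∀ j < n, u.testBit j = x j) → Q x)
    (he : extend n c L leaf P) : Q x := by
  cases hcs : searchOrder n c L P with
  | nil =>
    rw [extend, hcs] at he
    exact absurd he (by simp)
  | cons i cs =>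
    have hci : c.testBit i = true := by
      have := (searchOrder_perm n c L P).mem_iff (a := i)
      rw [hcs] at this
      have := this.1 (by simp)
      simpa [inside] using (List.mem_filter.1 this).2
    cases hi : x i
    · exact h.of_extend_of_head hC hL hP (fun u => hleaf u x) hcs hi he
    · refine hQ.shift x c hL.mem_self ?_
      refine (h.shift hC hL.mem_self).of_extend_of_head hC hL (P := P) ?_ (fun u => hleaf u _) hcs
        (by simp [CodeExtension.shift, hi, hci]) he
      refine hP.trans (List.Perm.of_eq (List.filter_congr fun j hj => ?_))
      have hj' : c.testBit j = false := by simpa [outside] using (List.mem_filter.1 hj).2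
      simp [CodeExtension.shift, hj']

/-! ### Settling the codewords -/

/-- A codeword of weight `24`, given by its message and one of its coordinates, with the messages of
its companions. -/
structure Pin where
  message : ℕ
  coord : ℕ
  companions : List ℕ

/-- Whether the companions are as required, and more than `T` companions cannot be met. -/
def Pin.ok (n t T : ℕ) (rows : List ℕ) (π : Pin) : Bool :=
  let c := encode rows π.message
  decide (0 < t) && decide (t < 4) &&
  decide (n * (12 + (T + 3) * (16 - t - 12)) < (T + 3) * ((16 - t) * (16 - t))) &&
  decide (weight n c = 24) && c.testBit π.coord &&
  decide (π.companions.map (encode rows)).Nodup &&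
  (π.companions.map (encode rows)).all fun d =>
    decide (weight n d = 24) && decide (weight n (d ^^^ c) = 24) && !d.testBit π.coord

theorem Pin.companions_of_ok {n t T : ℕ} {rows : List ℕ} {π : Pin} (h : π.ok n t T rows) :
    Companions {c | c ∈ coset rows 0} n (encode rows π.message) π.coord
      (π.companions.map (encode rows)) := by
  simp only [Pin.ok, Bool.and_eq_true, decide_eq_true_eq, List.all_eq_true,
    Bool.not_eq_true'] at h
  obtain ⟨⟨⟨⟨_, h4⟩, h5⟩, h6⟩, h7⟩ := h
  refine ⟨encode_mem _ _, h4, h5, fun d hd => ?_, fun d hd => (h7 d hd).1.1,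
    fun d hd => (h7 d hd).1.2, fun d hd => (h7 d hd).2, h6⟩
  obtain ⟨m, -, rfl⟩ := List.mem_map.1 hd
  exact encode_mem _ _

theorem encode_map (rows : List ℕ) {f : ℕ → ℕ} (hf : ∀ a b, f (a ^^^ b) = f a ^^^ f b) (m : ℕ) :
    encode (rows.map f) m = f (encode rows m) := by
  have h0 : f 0 = 0 := by simpa using hf 0 0
  induction rows generalizing m with
  | nil => simp [encode, h0]
  | cons r rows ih =>
    simp only [List.map_cons, encode_cons, ih]
    split
    · rw [hf]
    · rfl

theorem encode_xor (rows : List ℕ) (a b : ℕ) :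
    encode rows (a ^^^ b) = encode rows a ^^^ encode rows b := by
  induction rows generalizing a b with
  | nil => simp [encode]
  | cons r rows ih =>
    have h : (a ^^^ b) / 2 = a / 2 ^^^ b / 2 := Nat.xor_div_two
    simp only [encode_cons, Nat.testBit_xor, h, ih]
    generalize encode rows (a / 2) = u
    generalize encode rows (b / 2) = v
    apply Nat.eq_of_testBit_eq
    intro i
    cases a.testBit 0 <;> cases b.testBit 0 <;> simp only [Nat.testBit_xor, Bool.xor_false,
      Bool.xor_true, Bool.not_true, Bool.not_false, Bool.false_eq_true, if_true, if_false] <;>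
      cases u.testBit i <;> cases v.testBit i <;> cases r.testBit i <;> rfl

/-- Whether each generator is the codeword with its residue as message. -/
def isSystematic (rows : List ℕ) : Bool :=
  rows.all fun r => encode rows (r % 2 ^ rows.length) == r

theorem encode_mod {rows : List ℕ} (h : isSystematic rows) {c : ℕ} (hc : c ∈ coset rows 0) :
    encode rows (c % 2 ^ rows.length) = c := by
  have h0 : encode rows 0 = 0 := by simpa using encode_xor rows 0 0
  refine IsLinear.coset_subset (C := {c | encode rows (c % 2 ^ rows.length) = c})
    ⟨by simp [h0], fun {a b} ha hb => ?_⟩ (rs := rows) (w := 0) ?_ (by simp [h0]) hc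
  · simp only [Set.mem_ofPred_eq] at ha hb ⊢
    rw [Nat.xor_mod_two_pow, encode_xor, ha, hb]
  · intro r hr
    simpa using List.all_eq_true.1 h r hr

/-- Whether all words pinned by the codeword have the property checked by `leaf`; the codewords
with messages in `acc` are known to be settled. -/
noncomputable def Pin.run (n t T : ℕ) (rows : List ℕ) (leaf : ℕ → Bool) (acc : ℕ) (π : Pin) :
    Bool :=
  let c := encode rows π.message
  let L := π.companions.map (encode rows)
  let E := packBits π.companions fun m => acc.testBit m || acc.testBit (m ^^^ π.message)
  pointTree (crowded T E) (extend n c L leaf)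
    ((outside n c).map fun p => (p, packBits π.companions fun m => (encode rows m).testBit p))
    (4 - t) 0 []

theorem Pin.settled_of_run {n t T : ℕ} {rows : List ℕ} {π : Pin}
    (hC : IsThreeWeight {c | c ∈ coset rows 0} n) (h : π.ok n t T rows) {Q : (ℕ → Bool) → Prop}
    (hQ : Stable {c | c ∈ coset rows 0} n Q) {leaf : ℕ → Bool}
    (hleaf : ∀ u x, leaf u → (∀ j < n, u.testBit j = x j) → Q x) {acc : ℕ}
    (hacc : ∀ m, acc.testBit m → Settled {c | c ∈ coset rows 0} n t Q (encode rows m))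
    (hrun : π.run n t T rows leaf acc) :
    Settled {c | c ∈ coset rows 0} n t Q (encode rows π.message) := by
  intro x hx
  by_contra hne
  have hL := Pin.companions_of_ok h
  simp only [Pin.ok, Bool.and_eq_true, decide_eq_true_eq] at h
  obtain ⟨⟨⟨⟨⟨⟨h1, h2⟩, h3⟩, _⟩, _⟩, _⟩, _⟩ := h
  set c := encode rows π.message with hc
  set L := π.companions.map (encode rows) with hLdef
  set met : ℕ → Prop := fun U => ∃ f : ℕ → Bool, U = packBits π.companions f ∧
    ∀ m, f m → 0 < outer n x c (encode rows m) with hmet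
  have hP : ∀ p ∈ (outside n c).map fun p =>
      (p, packBits π.companions fun m => (encode rows m).testBit p),
      x p.1 → ∀ U, met U → met (U ||| p.2) := by
    rintro p hp hxp U ⟨f, rfl, hf⟩
    obtain ⟨q, hq, rfl⟩ := List.mem_map.1 hp
    refine ⟨_, packBits_or _ _ _, fun m hm => ?_⟩
    rw [Bool.or_eq_true] at hm
    rcases hm with hm | hm
    · exact hf m hm
    · rw [← countP_outside, List.countP_pos_iff]
      exact ⟨q, by simpa using ⟨hq, hxp⟩, hm⟩
  have hbad : ∀ U, met U → crowded T (packBits π.companions fun m =>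
      acc.testBit m || acc.testBit (m ^^^ π.message)) U = false := by
    rintro U ⟨f, rfl, hf⟩
    refine crowded_eq_false ?_ fun m hm hfm => ?_
    · refine le_trans ?_ (hx.countP_le hC hL h1 h2 h3)
      rw [hLdef, List.countP_map]
      exact List.countP_mono_left fun m _ hm => by simpa using hf m hm
    · rw [← Bool.not_eq_true, Bool.or_eq_true]
      intro hm2
      refine hne (hx.of_settled hC.toIsLinear hL hQ (List.mem_map.2 ⟨m, hm, rfl⟩) (hf m hfm) ?_)
      rw [hc, ← encode_xor]
      exact hm2.imp (hacc _) (hacc _)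
  have hcount : ((outside n c).map fun p =>
      (p, packBits π.companions fun m => (encode rows m).testBit p)).countP
      (fun p => x p.1) = 4 - t := by
    have := hx.length_outside hL.weight_self
    rw [List.countP_map]
    change (outside n c).countP x = _
    rw [List.countP_eq_length_filter]
    omega
  have hl := pointTree_sound hbad _ hP hcount
    ⟨fun _ => false, (packBits_eq_zero fun _ _ => rfl).symm, by simp⟩ hrun
  refine hne (hx.of_extend hC.toIsLinear hL ?_ hQ hleaf hl)
  rw [List.append_nil, List.filter_map, List.map_map]
  refine (List.reverse_perm _).trans (List.Perm.of_eq ?_)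
  change (List.filter x _).map id = _
  rw [List.map_id]

theorem Settled.of_aut {rows : List ℕ} {n t : ℕ} {Q : (ℕ → Bool) → Prop}
    (hQ : Stable {c | c ∈ coset rows 0} n Q) {g : List ℕ × List ℕ} (hg : autOk rows n g) {c : ℕ}
    (h : Settled {c | c ∈ coset rows 0} n t Q (permute g.1 c)) :
    Settled {c | c ∈ coset rows 0} n t Q c := by
  intro x hx
  have hσ := isAut_of_autOk hg
  refine hQ.comp x _ _ hσ (h _ ⟨hx.valid.comp hσ, ?_, ?_⟩)
  · have := hσ.dist_comp (c := 0) (d := 0) (by simp) x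
    rw [wdist_eq_dist, this, ← wdist_eq_dist]
    exact hx.zero
  · have := hσ.dist_comp (c := permute g.1 c) (d := c) (fun i hi => ?_) x
    · rw [wdist_eq_dist, this, ← wdist_eq_dist]
      exact hx.self
    · have hlen : g.1.length = n := by
        simp only [autOk, Bool.and_eq_true, decide_eq_true_eq] at hg
        exact hg.1.1.1.1
      have h1 := hσ.lt' i hi
      have h2 := hσ.right i hi
      rw [testBit_permute _ _ (by omega), ← List.getD_eq_getElem (d := n), h2]

/-- The images of the messages of the generators under a permutation of the coordinates. -/
def images (rows l : List ℕ) : List ℕ := rows.map fun r => permute l r % 2 ^ rows.length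

/-- The digits of a number in base `256`. -/
noncomputable def unpack (k : ℕ) : ℕ → List ℕ :=
  Nat.rec (fun _ => []) (fun _ ih w => Nat.mod w 256 :: ih (Nat.div w 256)) k

theorem unpack_packL {l : List ℕ} (h : ∀ a ∈ l, a < 256) : unpack l.length (packL l) = l := by
  induction l with
  | nil => rfl
  | cons a l ih =>
    have h1 := h a (by simp)
    change (a + 256 * packL l) % 256 :: unpack l.length ((a + 256 * packL l) / 256) = a :: l
    rw [show (a + 256 * packL l) % 256 = a by omega,
      show (a + 256 * packL l) / 256 = packL l by omega, ih fun b hb => h b (by simp [hb])]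

/-- The packed numbers of ones at the given coordinates of the words of the coset of `u`. -/
noncomputable def packedWeights (rows : List ℕ) (u : ℕ) (o : List ℕ) : ℕ :=
  List.rec 0 (fun i _ ih =>
    Nat.add (cond (u.testBit i) (bitMasks rows i).2 (bitMasks rows i).1) ih) o

theorem packedWeights_eq (rows : List ℕ) (u : ℕ) (o : List ℕ) :
    packedWeights rows u o = packL ((coset rows u).map fun c => o.countP c.testBit) := by
  induction o with
  | nil =>
    rw [show packedWeights rows u [] = 0 from rfl]
    simpa using (packL_const (coset rows u) 0).symm
  | cons i o ih =>
    change cond (u.testBit i) (bitMasks rows i).2 (bitMasks rows i).1 + packedWeights rows u o = _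
    have h := (bitMasks_spec rows i u).1
    have h' : cond (u.testBit i) (bitMasks rows i).2 (bitMasks rows i).1 =
        packL ((coset rows u).map fun c => (c.testBit i).toNat) := by
      rw [h]
      cases u.testBit i <;> rfl
    rw [h', ih, packL_map_add]
    congr 1
    refine List.map_congr_left fun c _ => ?_
    rw [List.countP_cons, add_comm]
    cases c.testBit i <;> rfl

/-- The weights of the words of the coset of `u`. -/
noncomputable def cosetWeights (n : ℕ) (rows : List ℕ) (u : ℕ) : List ℕ :=
  unpack (2 ^ rows.length) (packedWeights rows u (List.range n))

theorem cosetWeights_eq {n : ℕ} (hn : n < 128) (rows : List ℕ) (u : ℕ) :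
    cosetWeights n rows u = (coset rows u).map (weight n) := by
  rw [cosetWeights, packedWeights_eq]
  have h := unpack_packL (l := (coset rows u).map (weight n)) fun a ha => by
    obtain ⟨c, -, rfl⟩ := List.mem_map.1 ha
    have : weight n c ≤ (List.range n).length := List.countP_le_length
    rw [List.length_range] at this
    omega
  rw [List.length_map, length_coset] at h
  exact h

/-- The codewords with their weights. -/
noncomputable def weighted (n : ℕ) (rows : List ℕ) : List (ℕ × ℕ) :=
  (coset rows 0).zip (cosetWeights n rows 0)

theorem weighted_eq {n : ℕ} (hn : n < 128) (rows : List ℕ) :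
    weighted n rows = (coset rows 0).map fun c => (c, weight n c) := by
  rw [weighted, cosetWeights_eq hn]
  induction coset rows 0 with
  | nil => rfl
  | cons c l ih => simp [ih]

/-- The messages of the codewords of weight `24`. -/
noncomputable def lightMessages (n : ℕ) (rows : List ℕ) : List ℕ :=
  ((weighted n rows).filter fun q => Nat.beq q.2 24).map fun q => Nat.mod q.1 (2 ^ rows.length)

/-- Running through the list `l` of messages, those that are mapped into `acc` by one of the linear
maps are added to `acc`. The result is passed on to `next`. -/
noncomputable def growThen (maps : List (List ℕ)) (next : ℕ → Bool) (l : List ℕ) : ℕ → Bool :=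
  List.rec next (fun m _ ih acc =>
    cond (maps.any fun im => bitAt acc (encode im m)) (ih (Nat.lor acc (Nat.pow 2 m))) (ih acc)) l

/-- Whether all codewords of weight `24` become settled, by settling the pins successively and
adding images under automorphisms in `k` rounds. -/
noncomputable def settles (n t T : ℕ) (rows : List ℕ) (leaf : ℕ → Bool) (maps : List (List ℕ))
    (k : ℕ) : List Pin → ℕ → Bool
  | [], acc => (lightMessages n rows).all (bitAt acc)
  | π :: πs, acc => π.run n t T rows leaf acc &&
    growThen maps (settles n t T rows leaf maps k πs)
      (List.replicate k (lightMessages n rows)).flatten (acc ||| 2 ^ π.message)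

section settle

variable {n t T : ℕ} {rows : List ℕ} {Q : (ℕ → Bool) → Prop}

theorem exists_of_growThen (hQ : Stable {c | c ∈ coset rows 0} n Q) (hsys : isSystematic rows)
    {gs : List (List ℕ × List ℕ)} (hgs : gs.all (autOk rows n)) {next : ℕ → Bool} {l : List ℕ}
    {acc : ℕ}
    (hacc : ∀ m, acc.testBit m → Settled {c | c ∈ coset rows 0} n t Q (encode rows m))
    (h : growThen (gs.map fun g => images rows g.1) next l acc) :
    ∃ acc : ℕ, (∀ m, acc.testBit m → Settled {c | c ∈ coset rows 0} n t Q (encode rows m)) ∧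
      next acc := by
  induction l generalizing acc with
  | nil => exact ⟨acc, hacc, h⟩
  | cons v l ih =>
    change cond ((gs.map fun g => images rows g.1).any fun im => bitAt acc (encode im v))
      (growThen _ next l (acc ||| 2 ^ v)) (growThen _ next l acc) = true at h
    cases hv : (gs.map fun g => images rows g.1).any fun im => bitAt acc (encode im v)
    · rw [hv] at h
      exact ih hacc h
    · rw [hv] at h
      refine ih (fun m hm => ?_) h
      rw [Nat.testBit_or, Bool.or_eq_true, Nat.testBit_two_pow, decide_eq_true_eq] at hm
      rcases hm with hm | rfl
      · exact hacc m hm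
      · obtain ⟨im, him, hv⟩ := List.any_eq_true.1 hv
        obtain ⟨g, hg, rfl⟩ := List.mem_map.1 him
        have hg' := List.all_eq_true.1 hgs g hg
        have h1 := hacc _ (bitAt_eq _ _ ▸ hv)
        have hp : preserves rows g.1 := by
          simp only [autOk, Bool.and_eq_true] at hg'
          exact hg'.1.2
        rw [images, encode_map rows (f := fun r => permute g.1 r % 2 ^ rows.length)
          (fun a b => by rw [permute_xor, Nat.xor_mod_two_pow]),
          encode_mod hsys (permute_mem hp (encode_mem _ _))] at h1
        exact h1.of_aut hQ hg'

theorem settled_of_settles (hn : n < 128) (hC : IsThreeWeight {c | c ∈ coset rows 0} n)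
    (hQ : Stable {c | c ∈ coset rows 0} n Q) (hsys : isSystematic rows)
    {leaf : ℕ → Bool} (hleaf : ∀ u x, leaf u → (∀ j < n, u.testBit j = x j) → Q x)
    {gs : List (List ℕ × List ℕ)} (hgs : gs.all (autOk rows n)) {k : ℕ} {πs : List Pin}
    (hπs : πs.all (Pin.ok n t T rows))
    (h : settles n t T rows leaf (gs.map fun g => images rows g.1) k πs 0) :
    ∀ c ∈ coset rows 0, weight n c = 24 → Settled {c | c ∈ coset rows 0} n t Q c := by
  suffices key : ∀ πs acc, (∀ π ∈ πs, Pin.ok n t T rows π) →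
      (∀ m, acc.testBit m → Settled {c | c ∈ coset rows 0} n t Q (encode rows m)) →
      settles n t T rows leaf (gs.map fun g => images rows g.1) k πs acc →
      ∀ m ∈ lightMessages n rows, Settled {c | c ∈ coset rows 0} n t Q (encode rows m) by
    intro c hc hw
    rw [← encode_mod hsys hc]
    refine key πs 0 (List.all_eq_true.1 hπs) (by simp) h _ ?_
    rw [lightMessages, weighted_eq hn]
    exact List.mem_map.2 ⟨(c, weight n c), List.mem_filter.2
      ⟨List.mem_map.2 ⟨c, hc, rfl⟩, by simp [hw]⟩, rfl⟩
  intro πs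
  induction πs with
  | nil => exact fun acc _ hacc h m hm => hacc m (bitAt_eq _ _ ▸ List.all_eq_true.1 h m hm)
  | cons π πs ih =>
    intro acc hok hacc h
    rw [settles, Bool.and_eq_true] at h
    have hacc1 : ∀ m, (acc ||| 2 ^ π.message).testBit m →
        Settled {c | c ∈ coset rows 0} n t Q (encode rows m) := by
      intro m hm
      rw [Nat.testBit_or, Bool.or_eq_true, Nat.testBit_two_pow, decide_eq_true_eq] at hm
      rcases hm with hm | rfl
      · exact hacc m hm
      · exact Pin.settled_of_run hC (hok π (by simp)) hQ hleaf hacc h.1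
    obtain ⟨acc', hacc', h'⟩ := exists_of_growThen hQ hsys hgs hacc1 h.2
    exact ih acc' (fun π' hπ' => hok π' (by simp [hπ'])) hacc' h'

end settle

/-- Two words of least weight in a coset differ by a codeword that pins a word of the coset;
if there are no two such words, then the coset is regular. -/
theorem Valid.of_settled {C : Set ℕ} {n t : ℕ} {Q : (ℕ → Bool) → Prop} (hC : IsThreeWeight C n)
    (hQ : Stable C n Q) (hall : ∀ c ∈ C, weight n c = 24 → Settled C n t Q c) {x : ℕ → Bool}
    (hx : Valid C n t x) (ht : 0 < t) {β b : ℕ} (hβ : β + t ≤ 28) (hb : b + t ≤ 16)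
    (hreg : ¬ Regular C (List.range n) (2 ^ n - 1) β b x) : Q x := by
  by_contra hne
  have huniq : ∀ c ∈ C, ∀ d ∈ C, wdist n x c + t = 16 → wdist n x d + t = 16 → c = d := by
    intro c hc d hd h1 h2
    by_contra hcd
    refine hne (hQ.shift x c hc (hall _ (hC.xor hc hd) ?_ _ ⟨hx.shift hC.toIsLinear hc, ?_, ?_⟩))
    · exact (hC.weight_eq (x := x) (m := 16 - t) hc hd hcd (by omega) (by omega) (by omega)).1
    · rwa [wdist_shift, Nat.xor_zero]
    · rwa [wdist_shift, ← Nat.xor_assoc, Nat.xor_self, Nat.zero_xor]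
  refine hreg ⟨fun c hc => ?_, fun c hc d hd h1 h2 i _ _ => ?_⟩
  · rw [← wdist_eq_dist]
    have := hx c hc
    omega
  · rw [← wdist_eq_dist] at h1 h2
    have h3 := hx c hc
    have h4 := hx d hd
    rw [huniq c hc d hd (by omega) (by omega)]

theorem isThreeWeight_of_all {rows : List ℕ} {n : ℕ} (hn : n < 128)
    (h : (weighted n rows).all fun q => Nat.beq q.1 0 || Nat.beq q.2 24 || Nat.beq q.2 32 ||
      Nat.beq q.2 40) :
    IsThreeWeight {c | c ∈ coset rows 0} n := by
  rw [weighted_eq hn] at h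
  refine ⟨isLinear_coset rows, fun c hc => ?_⟩
  have := List.all_eq_true.1 h (c, weight n c) (List.mem_map.2 ⟨c, hc, rfl⟩)
  simp only [Bool.or_eq_true, Nat.beq_eq] at this
  tauto

theorem stable_false (C : Set ℕ) (n : ℕ) : Stable C n fun _ => False :=
  ⟨fun _ _ _ h => h, fun _ _ _ _ h => h⟩

/-! ### Pinned words of the `[65, 12]` code -/

/-- An automorphism of the code, with its inverse. Together with `generator65b` it generates a group
under which codewords of weight `24` with equally many companions are equivalent. -/
def generator65a : List ℕ × List ℕ := (
    [34, 2, 35, 15, 28, 20, 17, 62, 60, 1, 5, 47, 25, 22, 6, 16, 55, 53, 13, 23, 52, 58, 26,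
    7, 37, 12, 18, 43, 56, 30, 48, 63, 29, 36, 33, 9, 0, 64, 41, 24, 57, 44, 4, 11, 45, 38,
    54, 27, 32, 50, 46, 61, 10, 14, 49, 3, 42, 31, 8, 59, 21, 51, 19, 40, 39],
    [36, 9, 1, 55, 42, 10, 14, 23, 58, 35, 52, 43, 25, 18, 53, 3, 15, 6, 26, 62, 5, 60, 13,
    19, 39, 12, 22, 47, 4, 32, 29, 57, 48, 34, 0, 2, 33, 24, 45, 64, 63, 38, 56, 27, 41, 44,
    50, 11, 30, 54, 49, 61, 20, 17, 46, 16, 28, 40, 21, 59, 8, 51, 7, 31, 37])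

/-- An automorphism of the code, with its inverse. -/
def generator65b : List ℕ × List ℕ := (
    [3, 35, 8, 12, 32, 26, 45, 59, 25, 62, 0, 37, 40, 14, 4, 39, 19, 29, 10, 7, 24, 51, 1, 49,
    54, 61, 28, 20, 17, 47, 57, 11, 9, 16, 48, 53, 64, 5, 33, 18, 63, 27, 46, 41, 56, 50, 22,
    44, 31, 21, 42, 15, 55, 30, 60, 6, 34, 52, 36, 43, 38, 13, 58, 23, 2],
    [10, 22, 64, 0, 14, 37, 55, 19, 2, 32, 18, 31, 3, 61, 13, 51, 33, 28, 39, 16, 27, 49, 46,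
    63, 20, 8, 5, 41, 26, 17, 53, 48, 4, 38, 56, 1, 58, 11, 60, 15, 12, 43, 50, 59, 47, 6, 42,
    29, 34, 23, 45, 21, 57, 35, 24, 52, 44, 30, 62, 7, 54, 25, 9, 40, 36])

/-- Representatives of the codewords of weight `24` up to automorphisms, those with more companions
first. -/
def pins65 : List Pin := [
  ⟨1, 0,
    [4, 26, 36, 38, 40, 56, 60, 68, 94, 98, 120, 128, 144, 192, 196, 334, 394, 400, 512, 516,
    534, 538, 674, 704, 708, 880, 1024, 1092, 1096, 1314, 1418, 1536, 1792, 1808, 2048, 2050,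
    2064, 2304, 2440, 2484, 2888, 3074, 3078, 3168, 3464, 3712]⟩,
  ⟨3, 0,
    [22, 26, 36, 38, 62, 70, 74, 96, 136, 214, 392, 436, 514, 552, 574, 594, 644, 704, 842,
    1024, 1064, 1104, 1122, 1170, 1280, 1472, 1674, 1828, 2048, 2050, 2330, 2402, 2442, 2450,
    2464, 2582, 2816, 3072, 3140, 3584]⟩]

/-- The largest of the numbers `wdist n x c + 1` is `m`. -/
def HasCoveringWeight (C : Set ℕ) (n m : ℕ) (x : ℕ → Bool) : Prop :=
  (∀ c ∈ C, wdist n x c + 1 ≤ m) ∧ ∃ c ∈ C, wdist n x c + 1 = m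

theorem stable_hasCoveringWeight {C : Set ℕ} (hC : IsLinear C) (n m : ℕ) :
    Stable C n (HasCoveringWeight C n m) := by
  refine ⟨fun x c hc h => ⟨fun d hd => ?_, ?_⟩, fun x σ τ hσ h => ⟨fun d hd => ?_, ?_⟩⟩
  · have := h.1 _ (hC.xor hc hd)
    rwa [wdist_shift, ← Nat.xor_assoc, Nat.xor_self, Nat.zero_xor] at this
  · obtain ⟨d, hd, h2⟩ := h.2
    exact ⟨_, hC.xor hc hd, by rwa [wdist_shift] at h2⟩
  · obtain ⟨e, he, hde⟩ := hσ.map d hd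
    have h1 := hσ.dist_comp (c := e) (d := d) (fun i hi => ?_) x
    · rw [wdist_eq_dist, ← h1, ← wdist_eq_dist]
      exact h.1 e he
    · rw [hde _ (hσ.lt' i hi), hσ.right i hi]
  · obtain ⟨d, hd, h2⟩ := h.2
    obtain ⟨e, he, hde⟩ := hσ.map' d hd
    refine ⟨e, he, ?_⟩
    rw [wdist_eq_dist, hσ.dist_comp hde, ← wdist_eq_dist] at h2
    exact h2

/-- Whether the maximal weight in the coset of `u`, increased by one, is `44`. -/
noncomputable def maxIs44 (u : ℕ) : Bool :=
  (cosetWeights 65 rows65 u).all (Nat.ble · 43) && (cosetWeights 65 rows65 u).any (Nat.beq · 43)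

theorem hasCoveringWeight_of_maxIs44 (u : ℕ) (x : ℕ → Bool) (h : maxIs44 u)
    (hux : ∀ j < 65, u.testBit j = x j) :
    HasCoveringWeight {c | c ∈ coset rows65 0} 65 44 x := by
  have hw : ∀ c, wdist 65 x c = weight 65 (u ^^^ c) := fun c =>
    List.countP_congr fun i hi => by
      rw [Nat.testBit_xor, hux i (List.mem_range.1 hi)]
  rw [maxIs44, cosetWeights_eq (by norm_num), Bool.and_eq_true] at h
  refine ⟨fun c hc => ?_, ?_⟩
  · rw [hw]
    have := xor_mem_coset (self_mem_coset rows65 u) hc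
    rw [Nat.xor_zero] at this
    have := Nat.le_of_ble_eq_true (List.all_eq_true.1 h.1 _ (List.mem_map.2 ⟨_, this, rfl⟩))
    omega
  · obtain ⟨w', hw', hw2⟩ := List.any_eq_true.1 h.2
    obtain ⟨w, hwm, rfl⟩ := List.mem_map.1 hw'
    have := xor_mem_coset (self_mem_coset rows65 u) hwm
    rw [Nat.xor_self] at this
    refine ⟨_, this, ?_⟩
    rw [hw, ← Nat.xor_assoc, Nat.xor_self, Nat.zero_xor]
    rw [Nat.eq_of_beq_eq_true hw2]

theorem isThreeWeight65 : IsThreeWeight {c | c ∈ coset rows65 0} 65 :=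
  isThreeWeight_of_all (by norm_num) (by decide +kernel)

theorem isSystematic65 : isSystematic rows65 := by decide +kernel

theorem generators65_ok : [generator65a, generator65b].all (autOk rows65 65) := by
  decide +kernel

theorem settled65_1 : ∀ c ∈ coset rows65 0, weight 65 c = 24 →
    Settled {c | c ∈ coset rows65 0} 65 1 (HasCoveringWeight {c | c ∈ coset rows65 0} 65 44) c :=
  settled_of_settles (T := 24) (by norm_num) isThreeWeight65
    (stable_hasCoveringWeight (isLinear_coset _) 65 44)
    isSystematic65 (leaf := maxIs44) hasCoveringWeight_of_maxIs44 generators65_ok (k := 5)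
    (πs := pins65) (by decide +kernel) (by decide +kernel)

/-- In a coset of the `[65, 12]` code with valid weights the largest weight is `43`. -/
theorem Valid.hasCoveringWeight65 {x : ℕ → Bool} (h : Valid {c | c ∈ coset rows65 0} 65 1 x) :
    HasCoveringWeight {c | c ∈ coset rows65 0} 65 44 x :=
  h.of_settled isThreeWeight65 (stable_hasCoveringWeight (isLinear_coset _) 65 44) settled65_1
    (by norm_num) (β := 27) (b := 15) (by norm_num) (by norm_num) (not_regular65 x)

/-! ### Pinned words of the `[64, 12]` code -/

/-- An automorphism of the code, with its inverse. Together with `generator64b` it generates a group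
under which codewords of weight `24` with equally many companions are equivalent. -/
def generator64a : List ℕ × List ℕ := (
    [60, 36, 2, 57, 52, 3, 45, 27, 43, 54, 25, 8, 33, 12, 39, 16, 41, 62, 63, 20, 9, 7, 30,
    22, 17, 31, 11, 24, 15, 28, 50, 49, 53, 0, 51, 44, 55, 6, 59, 38, 48, 47, 4, 34, 19, 37,
    61, 29, 56, 46, 32, 26, 42, 23, 35, 1, 40, 5, 13, 18, 58, 10, 21, 14],
    [33, 55, 2, 5, 42, 57, 37, 21, 11, 20, 61, 26, 13, 58, 63, 28, 15, 24, 59, 44, 19, 62, 23,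
    53, 27, 10, 51, 7, 29, 47, 22, 25, 50, 12, 43, 54, 1, 45, 39, 14, 56, 16, 52, 8, 35, 6,
    49, 41, 40, 31, 30, 34, 4, 32, 9, 36, 48, 3, 60, 38, 0, 46, 17, 18])

/-- An automorphism of the code, with its inverse. -/
def generator64b : List ℕ × List ℕ := (
    [25, 45, 2, 52, 6, 4, 36, 38, 17, 43, 30, 62, 21, 28, 0, 15, 46, 32, 61, 16, 39, 12, 54,
    27, 19, 51, 63, 35, 44, 41, 10, 33, 60, 11, 23, 34, 5, 37, 7, 20, 55, 29, 1, 22, 53, 57,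
    24, 58, 56, 26, 50, 14, 48, 13, 9, 40, 3, 42, 18, 49, 8, 47, 31, 59],
    [14, 42, 2, 56, 5, 36, 4, 38, 60, 54, 30, 33, 21, 53, 51, 15, 19, 8, 58, 24, 39, 12, 43,
    34, 46, 0, 49, 23, 13, 41, 10, 62, 17, 31, 35, 27, 6, 37, 7, 20, 55, 29, 57, 9, 28, 1, 16,
    61, 52, 59, 50, 25, 3, 44, 22, 40, 48, 45, 47, 63, 32, 18, 11, 26])

/-- Representatives of the codewords of weight `24` up to automorphisms, those with more companions
first. -/
def pins64 : List Pin := [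
  ⟨1, 0,
    [6, 8, 14, 20, 36, 48, 64, 66, 68, 74, 76, 84, 100, 112, 128, 148, 164, 176, 192, 212,
    228, 256, 384, 396, 512, 540, 640, 768, 786, 808, 856, 866, 896, 912, 1024, 1042, 1064,
    1112, 1122, 1152, 1194, 1280, 1318, 1408, 1536, 1664, 1718, 1792, 1850, 2048, 2054, 2056,
    2062, 2114, 2116, 2124, 2304, 2358, 2432, 2560, 2688, 2726, 2816, 2858, 2944, 3072, 3088,
    3200, 3328, 3456, 3484, 3584, 3596, 3712, 3968]⟩,
  ⟨6, 1,
    [1, 8, 9, 21, 28, 48, 68, 69, 76, 77, 100, 148, 164, 176, 212, 229, 324, 513, 520, 532,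
    541, 768, 788, 804, 868, 896, 944, 980, 1024, 1033, 1045, 1052, 1125, 1152, 1280, 1313,
    1328, 1428, 1476, 1537, 1544, 1556, 1572, 1664, 1712, 2048, 2049, 2056, 2057, 2116, 2117,
    2125, 2208, 2305, 2352, 2388, 2432, 2532, 2608, 2688, 2788, 3104, 3269, 3428, 3457]⟩,
  ⟨8, 3,
    [1, 6, 7, 20, 66, 67, 68, 69, 80, 98, 148, 162, 176, 192, 256, 276, 324, 384, 512, 532,
    577, 580, 592, 641, 739, 768, 788, 801, 836, 848, 913, 1025, 1042, 1123, 1158, 1187,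
    1286, 1313, 1426, 1536, 1570, 1600, 1664, 1712, 2048, 2049, 2054, 2055, 2064, 2115, 2116,
    2117, 2194, 2208, 2438, 2945, 3092, 3200, 3328, 3377, 3457, 3476, 3600]⟩,
  ⟨26, 1,
    [9, 20, 21, 28, 32, 48, 80, 88, 112, 152, 176, 184, 200, 232, 304, 344, 360, 472, 513,
    520, 532, 541, 561, 776, 796, 857, 1024, 1033, 1045, 1052, 1112, 1200, 1328, 1408, 1428,
    1496, 1544, 1556, 1565, 1672, 1692, 2057, 2072, 2077, 2104, 2120, 2136, 2152, 2208, 2256,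
    2288, 2352, 2649, 2817, 2837, 2865, 3465, 3485, 3733]⟩]

theorem isThreeWeight64 : IsThreeWeight {c | c ∈ coset rows64 0} 64 :=
  isThreeWeight_of_all (by norm_num) (by decide +kernel)

theorem isSystematic64 : isSystematic rows64 := by decide +kernel

theorem generators64_ok : [generator64a, generator64b].all (autOk rows64 64) := by
  decide +kernel

theorem settled64_1 : ∀ c ∈ coset rows64 0, weight 64 c = 24 →
    Settled {c | c ∈ coset rows64 0} 64 1 (fun _ => False) c :=
  settled_of_settles (T := 21) (by norm_num) isThreeWeight64 (stable_false _ _) isSystematic64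
    (leaf := fun _ => false) (fun _ _ h => absurd h (by simp)) generators64_ok (k := 5)
    (πs := pins64) (by decide +kernel) (by decide +kernel)

theorem settled64_2 : ∀ c ∈ coset rows64 0, weight 64 c = 24 →
    Settled {c | c ∈ coset rows64 0} 64 2 (fun _ => False) c :=
  settled_of_settles (T := 9) (by norm_num) isThreeWeight64 (stable_false _ _) isSystematic64
    (leaf := fun _ => false) (fun _ _ h => absurd h (by simp)) generators64_ok (k := 5)
    (πs := pins64) (by decide +kernel) (by decide +kernel)

theorem not_valid64 {t : ℕ} (ht : 0 < t) (ht' : t ≤ 2) (x : ℕ → Bool) :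
    ¬ Valid {c | c ∈ coset rows64 0} 64 t x := by
  intro h
  have key : ∀ c ∈ coset rows64 0, weight 64 c = 24 →
      Settled {c | c ∈ coset rows64 0} 64 t (fun _ => False) c := by
    interval_cases t
    · exact settled64_1
    · exact settled64_2
  exact h.of_settled isThreeWeight64 (stable_false _ _) key ht (β := 26) (b := 14)
    (by omega) (by omega) (not_regular64 x)

/-! ### Pinned words of the `[63, 12]` code -/

/-- An automorphism of the code, with its inverse. Together with `generator63b` it generates a group
under which codewords of weight `24` with equally many companions are equivalent. -/
def generator63a : List ℕ × List ℕ := (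
    [44, 46, 54, 27, 33, 1, 49, 35, 2, 14, 0, 41, 32, 16, 19, 37, 56, 11, 28, 39, 60, 47, 55,
    34, 8, 29, 57, 51, 3, 5, 24, 50, 23, 38, 48, 22, 43, 10, 21, 12, 26, 30, 17, 61, 6, 52, 7,
    25, 31, 9, 18, 62, 20, 42, 36, 59, 45, 4, 15, 53, 40, 58, 13],
    [10, 5, 8, 28, 57, 29, 44, 46, 24, 49, 37, 17, 39, 62, 9, 58, 13, 42, 50, 14, 52, 38, 35,
    32, 30, 47, 40, 3, 18, 25, 41, 48, 12, 4, 23, 7, 54, 15, 33, 19, 60, 11, 53, 36, 0, 56, 1,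
    21, 34, 6, 31, 27, 45, 59, 2, 22, 16, 26, 61, 55, 20, 43, 51])

/-- An automorphism of the code, with its inverse. -/
def generator63b : List ℕ × List ℕ := (
    [13, 7, 59, 21, 43, 54, 9, 46, 22, 48, 37, 28, 47, 35, 55, 10, 23, 41, 57, 12, 6, 19, 4,
    25, 18, 30, 36, 62, 27, 1, 34, 17, 33, 16, 44, 0, 3, 39, 45, 29, 61, 50, 56, 32, 24, 20,
    11, 58, 49, 14, 5, 40, 38, 2, 60, 53, 52, 8, 31, 42, 26, 15, 51],
    [35, 29, 53, 36, 22, 50, 20, 1, 57, 6, 15, 46, 19, 0, 49, 61, 33, 31, 24, 21, 45, 3, 8,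
    16, 44, 23, 60, 28, 11, 39, 25, 58, 43, 32, 30, 13, 26, 10, 52, 37, 51, 17, 59, 4, 34, 38,
    7, 12, 9, 48, 41, 62, 56, 55, 5, 14, 42, 18, 47, 2, 54, 40, 27])

/-- Representatives of the codewords of weight `24` up to automorphisms, those with more companions
first. -/
def pins63 : List Pin := [
  ⟨1, 0,
    [6, 8, 20, 26, 40, 42, 64, 66, 70, 86, 130, 150, 162, 164, 192, 226, 262, 264, 274, 290,
    292, 312, 324, 336, 354, 356, 384, 388, 390, 400, 448, 454, 466, 516, 520, 524, 530, 546,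
    568, 576, 616, 768, 794, 810, 816, 1028, 1036, 1040, 1094, 1106, 1158, 1170, 1220, 1232,
    1272, 1282, 1344, 1364, 1408, 1428, 1494, 1536, 1544, 1680, 1720, 2048, 2052, 2060, 2074,
    2090, 2096, 2128, 2168, 2312, 2322, 2338, 2360, 2560, 2568, 2576, 2578, 2594, 2616, 2816,
    2864, 3072, 3080, 3200, 3240, 3588, 3776]⟩]

theorem isThreeWeight63 : IsThreeWeight {c | c ∈ coset rows63 0} 63 :=
  isThreeWeight_of_all (by norm_num) (by decide +kernel)

theorem isSystematic63 : isSystematic rows63 := by decide +kernel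

theorem generators63_ok : [generator63a, generator63b].all (autOk rows63 63) := by
  decide +kernel

theorem settled63_1 : ∀ c ∈ coset rows63 0, weight 63 c = 24 →
    Settled {c | c ∈ coset rows63 0} 63 1 (fun _ => False) c :=
  settled_of_settles (T := 19) (by norm_num) isThreeWeight63 (stable_false _ _) isSystematic63
    (leaf := fun _ => false) (fun _ _ h => absurd h (by simp)) generators63_ok (k := 6)
    (πs := pins63) (by decide +kernel) (by decide +kernel)

theorem settled63_2 : ∀ c ∈ coset rows63 0, weight 63 c = 24 →
    Settled {c | c ∈ coset rows63 0} 63 2 (fun _ => False) c :=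
  settled_of_settles (T := 8) (by norm_num) isThreeWeight63 (stable_false _ _) isSystematic63
    (leaf := fun _ => false) (fun _ _ h => absurd h (by simp)) generators63_ok (k := 6)
    (πs := pins63) (by decide +kernel) (by decide +kernel)

theorem settled63_3 : ∀ c ∈ coset rows63 0, weight 63 c = 24 →
    Settled {c | c ∈ coset rows63 0} 63 3 (fun _ => False) c :=
  settled_of_settles (T := 5) (by norm_num) isThreeWeight63 (stable_false _ _) isSystematic63
    (leaf := fun _ => false) (fun _ _ h => absurd h (by simp)) generators63_ok (k := 6)
    (πs := pins63) (by decide +kernel) (by decide +kernel)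

theorem not_valid63 {t : ℕ} (ht : 0 < t) (ht' : t ≤ 3) (x : ℕ → Bool) :
    ¬ Valid {c | c ∈ coset rows63 0} 63 t x := by
  intro h
  have key : ∀ c ∈ coset rows63 0, weight 63 c = 24 →
      Settled {c | c ∈ coset rows63 0} 63 t (fun _ => False) c := by
    interval_cases t
    · exact settled63_1
    · exact settled63_2
    · exact settled63_3
  exact h.of_settled isThreeWeight63 (stable_false _ _) key ht (β := 25) (b := 13)
    (by omega) (by omega) (not_regular63 x)

/-! ### Linear codes over the field with two elements -/

/-- The word of length `n` with the bits of `c`, the most significant one first. -/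
def toWord (n c : ℕ) : Fin n → ZMod 2 := fun j => if c.testBit (n - 1 - (j : ℕ)) then 1 else 0

theorem toWord_xor (n a b : ℕ) : toWord n (a ^^^ b) = toWord n a + toWord n b := by
  funext j
  simp only [toWord, Pi.add_apply, Nat.testBit_xor]
  cases a.testBit (n - 1 - (j : ℕ)) <;> cases b.testBit (n - 1 - (j : ℕ)) <;> decide

theorem mem_rowCode {k n : ℕ} {f : Fin k → ℕ} {rows : List ℕ} (h : List.ofFn f = rows.reverse)
    (w : Fin n → ZMod 2) :
    w ∈ rowCode (bitMatrix n f) ↔ ∃ c ∈ coset rows 0, toWord n c = w := by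
  have hmem : ∀ r, r ∈ rows ↔ ∃ i, f i = r := fun r => by
    rw [← List.mem_reverse, ← h, List.mem_ofFn]
  have hC := isLinear_coset rows
  have h0 : toWord n 0 = 0 := by simpa using toWord_xor n 0 0
  constructor
  · intro hw
    refine Submodule.span_induction (p := fun w _ => ∃ c ∈ coset rows 0, toWord n c = w)
      ?_ ⟨0, hC.zero, h0⟩ ?_ ?_ hw
    · rintro _ ⟨i, rfl⟩
      exact ⟨f i, mem_coset_of_mem ((hmem _).2 ⟨i, rfl⟩), rfl⟩
    · rintro _ _ _ _ ⟨a, ha, rfl⟩ ⟨b, hb, rfl⟩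
      exact ⟨_, hC.xor ha hb, toWord_xor n a b⟩
    · rintro a _ _ ⟨c, hc, rfl⟩
      obtain rfl | rfl : a = 0 ∨ a = 1 := by revert a; decide
      · exact ⟨0, hC.zero, by rw [zero_smul, h0]⟩
      · exact ⟨c, hc, by rw [one_smul]⟩
  · rintro ⟨c, hc, rfl⟩
    refine IsLinear.coset_subset (C := {c | toWord n c ∈ rowCode (bitMatrix n f)})
      ⟨by simp [h0], fun ha hb => ?_⟩ (fun r hr => ?_) (w := 0) (by simp [h0]) hc
    · simp only [Set.mem_ofPred_eq, toWord_xor] at ha hb ⊢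
      exact Submodule.add_mem _ ha hb
    · obtain ⟨i, rfl⟩ := (hmem r).1 hr
      exact Submodule.subset_span ⟨i, rfl⟩

section copy

variable {n N : ℕ} (e : Fin n ↪ Fin N)

/-- The bits of `v` at the coordinates of the copy, in the order of the bits of codewords. -/
def restrict (v : Fin N → ZMod 2) (i : ℕ) : Bool :=
  if h : i < n then decide (v (e (Fin.rev ⟨i, h⟩)) ≠ 0) else false

/-- The coordinates outside of the copy where `v` is non-zero. -/
noncomputable def outerSupport (v : Fin N → ZMod 2) : Finset (Fin N) :=
  open Classical in Finset.univ.filter fun i => i ∉ Set.range e ∧ v i ≠ 0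

/-- The copy of a codeword. -/
noncomputable def copyWord (c : ℕ) : Fin N → ZMod 2 :=
  Function.ExtendByZero.linearMap (ZMod 2) e (toWord n c)

theorem copyWord_apply (c : ℕ) (j : Fin n) : copyWord e c (e j) = toWord n c j := by
  exact e.injective.extend_apply _ _ _

theorem copyWord_of_notMem (c : ℕ) {i : Fin N} (hi : i ∉ Set.range e) : copyWord e c i = 0 := by
  exact Function.extend_apply' _ _ _ (by simpa using hi)

theorem hammingNorm_add_copyWord (v : Fin N → ZMod 2) (c : ℕ) :
    hammingNorm (v + copyWord e c) = wdist n (restrict e v) c + (outerSupport e v).card := by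
  classical
  have h1 : (Finset.univ.filter fun i => (v + copyWord e c) i ≠ 0) =
      (Finset.univ.filter fun j => v (e j) + toWord n c j ≠ 0).map e ∪ outerSupport e v := by
    ext i
    simp only [Finset.mem_filter, Finset.mem_univ, true_and, Finset.mem_union, Finset.mem_map,
      outerSupport, Pi.add_apply]
    by_cases hi : i ∈ Set.range e
    · obtain ⟨j, rfl⟩ := hi
      simp [copyWord_apply]
    · rw [copyWord_of_notMem e c hi, add_zero]
      constructor
      · exact fun h => Or.inr ⟨hi, h⟩
      · rintro (⟨j, -, rfl⟩ | h)
        · exact absurd ⟨j, rfl⟩ hi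
        · exact h.2
  have h2 : (Finset.univ.filter fun j => v (e j) + toWord n c j ≠ 0).card =
      wdist n (restrict e v) c := by
    rw [wdist, countP_range_eq_sum, Finset.sum_range, Finset.card_filter,
      ← Equiv.sum_comp Fin.revPerm]
    refine Finset.sum_congr rfl fun j _ => ?_
    have hj : n - 1 - ((Fin.rev j : Fin n) : ℕ) = j := by
      rw [Fin.val_rev]
      omega
    simp only [Fin.revPerm_apply, toWord, hj, restrict, j.isLt, dif_pos, Fin.eta]
    generalize v (e j.rev) = a
    cases c.testBit j <;> fin_cases a <;> decide
  rw [hammingNorm, h1, Finset.card_union_of_disjoint, Finset.card_map, h2]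
  rw [Finset.disjoint_left]
  intro i hi hi'
  obtain ⟨j, -, rfl⟩ := Finset.mem_map.1 hi
  simp [outerSupport] at hi'

end copy

/-- `K` is the copy along `e` of the code generated by `rows`, which has no zero coordinates. -/
structure IsCopyAlong {n N : ℕ} (e : Fin n ↪ Fin N) (rows : List ℕ)
    (K : Submodule (ZMod 2) (Fin N → ZMod 2)) : Prop where
  mem : ∀ w, w ∈ K ↔ ∃ c ∈ coset rows 0, copyWord e c = w
  bit : ∀ i < n, ∃ r ∈ rows, r.testBit i = true

theorem IsCopyOf.exists_isCopyAlong {k n N : ℕ} {K : Submodule (ZMod 2) (Fin N → ZMod 2)}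
    {f : Fin k → ℕ} (h : IsCopyOf K (rowCode (bitMatrix n f))) {rows : List ℕ}
    (hf : List.ofFn f = rows.reverse)
    (hrows : (List.range n).all fun i => rows.any fun r => r.testBit i) :
    ∃ e : Fin n ↪ Fin N, IsCopyAlong e rows K := by
  obtain ⟨e, rfl⟩ := h
  refine ⟨e, fun w => ?_, fun i hi => ?_⟩
  · rw [Submodule.mem_map]
    constructor
    · rintro ⟨u, hu, rfl⟩
      obtain ⟨c, hc, rfl⟩ := (mem_rowCode hf u).1 hu
      exact ⟨c, hc, rfl⟩
    · rintro ⟨c, hc, rfl⟩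
      exact ⟨_, (mem_rowCode hf _).2 ⟨c, hc, rfl⟩, rfl⟩
  · exact List.any_eq_true.1 (List.all_eq_true.1 hrows i (List.mem_range.2 hi))

section extension

variable {n N : ℕ} {e : Fin n ↪ Fin N} {rows : List ℕ}
  {K K' : Submodule (ZMod 2) (Fin N → ZMod 2)}

theorem IsCopyAlong.support (hK : IsCopyAlong e rows K) :
    {i : Fin N | ∃ c ∈ K, c i ≠ 0} = Set.range e := by
  ext i
  constructor
  · rintro ⟨w, hw, hwi⟩
    obtain ⟨c, -, rfl⟩ := (hK.mem w).1 hw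
    by_contra hi
    exact hwi (copyWord_of_notMem e c hi)
  · rintro ⟨j, rfl⟩
    obtain ⟨r, hr, hrj⟩ := hK.bit (n - 1 - (j : ℕ)) (by omega)
    refine ⟨copyWord e r, (hK.mem _).2 ⟨r, mem_coset_of_mem hr, rfl⟩, ?_⟩
    rw [copyWord_apply, toWord, hrj]
    simp

theorem exists_eq_add_of_finrank (hKK' : K ≤ K')
    (hdim : Module.finrank (ZMod 2) K' = Module.finrank (ZMod 2) K + 1) :
    ∃ v ∈ K', v ∉ K ∧ ∀ w, w ∈ K' ↔ w ∈ K ∨ ∃ u ∈ K, w = v + u := by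
  obtain ⟨v, hv, hvK⟩ : ∃ v ∈ K', v ∉ K := by
    by_contra! h
    have : K' = K := le_antisymm h hKK'
    rw [this] at hdim
    omega
  refine ⟨v, hv, hvK, fun w => ⟨fun hw => ?_, ?_⟩⟩
  · have hle : K ⊔ Submodule.span (ZMod 2) {v} ≤ K' :=
      sup_le hKK' (by simpa using hv)
    have hlt : K < K ⊔ Submodule.span (ZMod 2) {v} := by
      refine lt_of_le_of_ne le_sup_left fun h => hvK ?_
      rw [h]
      exact Submodule.mem_sup_right (Submodule.mem_span_singleton_self v)
    have heq : K ⊔ Submodule.span (ZMod 2) {v} = K' := by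
      refine Submodule.eq_of_le_of_finrank_le hle ?_
      have := Submodule.finrank_lt_finrank_of_lt hlt
      omega
    rw [← heq, Submodule.mem_sup] at hw
    obtain ⟨u, hu, z, hz, rfl⟩ := hw
    obtain ⟨a, rfl⟩ := Submodule.mem_span_singleton.1 hz
    obtain rfl | rfl := (by decide : ∀ a : ZMod 2, a = 0 ∨ a = 1) a
    · left
      simpa using hu
    · right
      exact ⟨u, hu, by rw [one_smul, add_comm]⟩
  · rintro (hw | ⟨u, hu, rfl⟩)
    · exact hKK' hw
    · exact K'.add_mem hv (hKK' hu)

/-- The weights of the new words of the larger code are those of a coset of the smaller one,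
increased by the number `t` of new coordinates. -/
theorem IsCopyAlong.exists_valid (hK : IsCopyAlong e rows K) (hKK' : K ≤ K')
    (hdim : Module.finrank (ZMod 2) K' = Module.finrank (ZMod 2) K + 1)
    (hwt : ∀ c ∈ K', c ∉ K →
      4 ∣ hammingNorm c ∧ 16 ≤ hammingNorm c ∧ hammingNorm c ≠ 20 ∧ hammingNorm c ≠ 24)
    (hlt : effLength K < effLength K') :
    ∃ t x, 0 < t ∧ effLength K' = n + t ∧ Valid {c | c ∈ coset rows 0} n t x ∧
      ∀ m, (∃ w ∈ K', w ∉ K ∧ hammingNorm w = m) ↔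
        ∃ c ∈ coset rows 0, wdist n x c + t = m := by
  obtain ⟨v, hv, hvK, hK'⟩ := exists_eq_add_of_finrank hKK' hdim
  have hsupp :
      {i : Fin N | ∃ c ∈ K', c i ≠ 0} = Set.range e ∪ (outerSupport e v : Set (Fin N)) := by
    rw [← hK.support]
    ext i
    simp only [Set.mem_union, Set.mem_ofPred_eq]
    constructor
    · rintro ⟨w, hw, hwi⟩
      by_cases hi : i ∈ Set.range e
      · left
        rw [← hK.support] at hi
        exact hi
      · right
        rcases (hK' w).1 hw with hw | ⟨u, hu, rfl⟩
        · obtain ⟨c, -, rfl⟩ := (hK.mem w).1 hw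
          exact absurd (copyWord_of_notMem e c hi) hwi
        · obtain ⟨c, -, rfl⟩ := (hK.mem u).1 hu
          rw [Pi.add_apply, copyWord_of_notMem e c hi, add_zero] at hwi
          simpa [outerSupport, hwi] using hi
    · rintro (⟨w, hw, hwi⟩ | hi)
      · exact ⟨w, hKK' hw, hwi⟩
      · exact ⟨v, hv, by simpa [outerSupport] using (Finset.mem_filter.1 hi).2.2⟩
  have hn : effLength K = n := by
    rw [effLength, hK.support, ← Set.image_univ, Set.ncard_image_of_injective _ e.injective,
      Set.ncard_univ, Nat.card_eq_fintype_card, Fintype.card_fin]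
  have hn' : effLength K' = n + (outerSupport e v).card := by
    rw [effLength, hsupp, Set.ncard_union_eq, Set.ncard_coe_finset, ← hK.support]
    · exact congrArg (· + (outerSupport e v).card) hn
    · rw [Set.disjoint_right]
      intro i hi
      exact (Finset.mem_filter.1 hi).2.1
  have hmem : ∀ c ∈ coset rows 0, v + copyWord e c ∈ K' ∧ v + copyWord e c ∉ K := by
    intro c hc
    have hcK := (hK.mem _).2 ⟨c, hc, rfl⟩
    exact ⟨(hK' _).2 (Or.inr ⟨_, hcK, rfl⟩), fun h => hvK ((K.add_mem_iff_left hcK).1 h)⟩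
  refine ⟨(outerSupport e v).card, restrict e v, by omega, hn', fun c hc => ?_,
    fun m => ⟨?_, ?_⟩⟩
  · rw [← hammingNorm_add_copyWord]
    have := hwt _ (hmem c hc).1 (hmem c hc).2
    omega
  · rintro ⟨w, hw, hwK, rfl⟩
    obtain ⟨u, hu, rfl⟩ := ((hK' w).1 hw).resolve_left hwK
    obtain ⟨c, hc, rfl⟩ := (hK.mem u).1 hu
    exact ⟨c, hc, (hammingNorm_add_copyWord e v c).symm⟩
  · rintro ⟨c, hc, rfl⟩
    exact ⟨_, (hmem c hc).1, (hmem c hc).2, hammingNorm_add_copyWord e v c⟩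

theorem IsCopyAlong.hammingNorm_le (hK : IsCopyAlong e rows K)
    (hC : IsThreeWeight {c | c ∈ coset rows 0} n) {w : Fin N → ZMod 2} (hw : w ∈ K) :
    hammingNorm w ≤ 40 := by
  obtain ⟨c, hc, rfl⟩ := (hK.mem w).1 hw
  have h1 := hammingNorm_add_copyWord e (0 : Fin N → ZMod 2) c
  have h2 : (outerSupport e (0 : Fin N → ZMod 2)).card = 0 := by simp [outerSupport]
  have h3 : wdist n (restrict e (0 : Fin N → ZMod 2)) c = weight n c :=
    List.countP_congr fun i _ => by simp [restrict]
  rw [zero_add, h2, h3] at h1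
  rcases hC.weight_mem c hc with h | h | h | h
  · rw [h, weight_zero] at h1
    rw [h]
    omega
  all_goals omega

end extension

end CodeExtension

open CodeExtension in
theorem mainTheorem4 (N : ℕ) (K K' : Submodule (ZMod 2) (Fin N → ZMod 2))
    (hK : IsCopyOf K code63 ∨ IsCopyOf K code64 ∨ IsCopyOf K code65)
    (hKK' : K ≤ K')
    (hdim : Module.finrank (ZMod 2) K' = Module.finrank (ZMod 2) K + 1)
    (hwt : ∀ c ∈ K', c ∉ K →
      4 ∣ hammingNorm c ∧ 16 ≤ hammingNorm c ∧ hammingNorm c ≠ 20 ∧ hammingNorm c ≠ 24)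
    (hlt : effLength K < effLength K') (hle : effLength K' ≤ 66) :
    IsCopyOf K code65 ∧ IsGreatest {w : ℕ | ∃ c ∈ K', hammingNorm c = w} 44 := by
  rcases hK with hK | hK | hK
  · obtain ⟨e, he⟩ := hK.exists_isCopyAlong (rows := rows63) (by decide) (by decide +kernel)
    obtain ⟨t, x, ht, hK', hx, -⟩ := he.exists_valid hKK' hdim hwt hlt
    exact absurd hx (not_valid63 ht (by omega) x)
  · obtain ⟨e, he⟩ := hK.exists_isCopyAlong (rows := rows64) (by decide) (by decide +kernel)
    obtain ⟨t, x, ht, hK', hx, -⟩ := he.exists_valid hKK' hdim hwt hlt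
    exact absurd hx (not_valid64 ht (by omega) x)
  · refine ⟨hK, ?_⟩
    obtain ⟨e, he⟩ := hK.exists_isCopyAlong (rows := rows65) (by decide) (by decide +kernel)
    obtain ⟨t, x, ht, hK', hx, hw⟩ := he.exists_valid hKK' hdim hwt hlt
    obtain rfl : t = 1 := by omega
    have h44 := hx.hasCoveringWeight65
    constructor
    · obtain ⟨w, hw', -, h⟩ := (hw 44).2 h44.2
      exact ⟨w, hw', h⟩
    · rintro _ ⟨w, hw', rfl⟩
      by_cases hwK : w ∈ K
      · exact (he.hammingNorm_le isThreeWeight65 hwK).trans (by norm_num)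
      · obtain ⟨c, hc, h⟩ := (hw _).1 ⟨w, hw', hwK, rfl⟩
        rw [← h]
        exact h44.1 c hc
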